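/- Let $K$ be a non-archimedean local field with separable closure $K^s$, $G_K=\mathrm{Gal}(K^s/K)$, Weil group $W_K\subset G_K$ and inertia group $I_K$; for a finite extension $L\subset K^s$ of $K$ write $\mathrm{Frob}_L\in W_K\cap \mathrm{Gal}(K^s/L)$ for an arithmetic Frobenius element of $L$. All representations are finite-dimensional and over $\mathbb C$; a representation of $W_K$ is unramified if it is trivial on $I_K$. Let $F/K$ be a finite Galois extension inside $K^s$, with maximal unramified extension $F^{nr}\subset K^s$, and let $\rho$ be a semisimple representation of $W_K$ that factors through $\mathrm{Gal}(F^{nr}/K)$. Let $I<\mathrm{Gal}(F/K)$ be the inertia subgroup. Let $\{\rho_i\}_{i\in\Lambda}$ be irreducible representations of $\mathrm{Gal}(F/K)$, exactly one in each class of unramified twists: for $i\ne j$, $\rho_i$ is not isomorphic to $\rho_j\otimes\chi$ for any one-dimensional representation $\chi$ of $\mathrm{Gal}(F/K)$ trivial on $I$, and every irreducible representation of $\mathrm{Gal}(F/K)$ is isomorphic to $\rho_i\otimes\chi$ for some $i$ and some such $\chi$. View the $\rho_i$ also as representations of $W_K$. Let $m_i=\langle \mathrm{Res}_I\rho_i,\mathrm{Res}_I\rho_i\rangle=\dim\mathrm{Hom}_I(\rho_i,\rho_i)$.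 Then: (i) There are unramified representations $\Psi_i$ of $W_K$ such that $\rho\cong\bigoplus_{i\in\Lambda}\rho_i\otimes\Psi_i$. Now let $(\Psi_i)_{i\in\Lambda}$ be any unramified representations as in (i), and fix $i\in\Lambda$. (ii) For every integer $d>0$, $$\mathrm{tr}\,\Psi_i(\mathrm{Frob}_K^{dm_i})=\frac{1}{|I|\,m_i}\sum_L\overline{\mathrm{tr}\,\rho_i(\mathrm{Frob}_L)}\;\mathrm{tr}\,\rho(\mathrm{Frob}_L),$$ where $L$ ranges over the (finitely many) extensions of $K$ in $F^{nr}$ of ramification degree $|I|$ and residue degree $dm_i$ over $K$. This holds for any choice of the Frobenius elements. (iii) The twist $\rho_i\otimes\Psi_i$ is uniquely determined by (ii): if $\Psi'$ is an unramified representation of $W_K$ such that $\rho_i\otimes\Psi'$ is semisimple and, for all $d>0$, $\mathrm{tr}\,\Psi'(\mathrm{Frob}_K^{dm_i})$ equals the right-hand side of (ii), then $\rho_i\otimes\Psi'\cong\rho_i\otimes\Psi_i$. (iv) Suppose $\dim\Psi_i\le N$. There are a unique $0\le n\le N$ and $\lambda_1,\dots,\lambda_n\in\mathbb C^\times$, unique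 up to order, such that $\sum_k\lambda_k^d=\mathrm{tr}\,\Psi_i(\mathrm{Frob}_K^{dm_i})$ for $d=1,\dots,N$. The eigenvalues of $\Psi_i(\mathrm{Frob}_K)$, with multiplicity, are $\sqrt[m_i]{\lambda_1},\dots,\sqrt[m_i]{\lambda_n}$ for some choice of the roots. The twist $\rho_i\otimes\Psi_i$ is independent of this choice: for every choice of the roots there is a semisimple unramified representation $\Psi'$ of $W_K$ for which $\Psi'(\mathrm{Frob}_K)$ has these roots as its eigenvalues with multiplicity, and every such $\Psi'$ satisfies $\rho_i\otimes\Psi'\cong\rho_i\otimes\Psi_i$. -/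

import Mathlib

open ValuativeRel

namespace LocalGalois

noncomputable section

section Fields

variable (K : Type*) [Field K] [ValuativeRel K] [TopologicalSpace K]
  [IsNonarchimedeanLocalField K]

/-- The ring of integers `𝒪_L` of an algebraic extension `L` of the local field `K`:
the integral closure of `𝒪_K` in `L`. -/
abbrev ringOfInt (L : Type*) [Field L] [Algebra K L] : Subalgebra 𝒪[K] L :=
  integralClosure 𝒪[K] L

/-- The maximal ideal `𝔪_L` of `𝒪_L`. For `L / K` algebraic the ring `𝒪_L` is local, so that its
maximal ideal is its Jacobson radical (the intersection of all maximal ideals). -/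
def maxIdeal (L : Type*) [Field L] [Algebra K L] : Ideal (ringOfInt K L) :=
  (⊥ : Ideal (ringOfInt K L)).jacobson

/-- The ramification degree `e(L/K)`. -/
def ramDeg (L : Type*) [Field L] [Algebra K L] : ℕ :=
  (maxIdeal K L).ramificationIdx 𝒪[K]

/-- The residue degree `f(L/K)`. -/
def resDeg (L : Type*) [Field L] [Algebra K L] : ℕ :=
  (maxIdeal K L).inertiaDeg 𝒪[K]

/-- The number of elements of the residue field `𝒪_L / 𝔪_L`. -/
def resCard (L : Type*) [Field L] [Algebra K L] : ℕ :=
  Nat.card (ringOfInt K L ⧸ maxIdeal K L)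

/-- The inertia subgroup of `Gal(L/K)`: the automorphisms acting trivially on the residue
field of `L`. -/
def inertia (L : Type*) [Field L] [Algebra K L] : Subgroup Gal(L/K) :=
  (maxIdeal K L).inertia Gal(L/K)

/-- The Weil group `W_K`: those elements of `G_K = Gal(K^s/K)` that act on the residue field of
`K^s` as an integral power `Frob^n`, `n = b - a`, of the `q`-power map, `q = |𝓀_K|`. -/
def weilGroup : Subgroup Gal(SeparableClosure K/K) where
  carrier := {σ | ∃ a b : ℕ, ∀ x : ringOfInt K (SeparableClosure K),
    (σ • x) ^ Nat.card 𝓀[K] ^ a - x ^ Nat.card 𝓀[K] ^ b ∈ maxIdeal K (SeparableClosure K)}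
  one_mem' := ⟨0, 0, fun x => by simp⟩
  mul_mem' := by
    rintro σ τ ⟨a, b, h⟩ ⟨a', b', h'⟩
    refine ⟨a + a', b + b', fun x => ?_⟩
    have h1 := h (τ • x)
    have h2 := h' x
    rw [← Ideal.Quotient.eq] at h1 h2 ⊢
    simp only [map_pow, mul_smul] at h1 h2 ⊢
    rw [pow_add, pow_mul, h1, add_comm b b', pow_add, pow_mul, ← h2, ← pow_mul, ← pow_mul,
      mul_comm]
  inv_mem' := by
    rintro σ ⟨a, b, h⟩
    refine ⟨b, a, fun x => ?_⟩
    have h1 := h (σ⁻¹ • x)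
    rw [smul_inv_smul] at h1
    rw [← Ideal.Quotient.eq] at h1 ⊢
    exact h1.symm

variable {K}

/-- `σ ∈ W_K` is an arithmetic Frobenius element `Frob_L` of the finite extension
`K ⊆ L ⊆ K^s`: it lies in `G_L = Gal(K^s/L)` and acts on the residue field of `K^s` as the
`|𝓀_L|`-power map. It is determined up to multiplication by elements of the inertia
group `I_L`. -/
def IsFrob (L : IntermediateField K (SeparableClosure K)) (σ : weilGroup K) : Prop :=
  (σ : Gal(SeparableClosure K/K)) ∈ L.fixingSubgroup ∧
    ∀ x : ringOfInt K (SeparableClosure K),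
      (σ : Gal(SeparableClosure K/K)) • x - x ^ resCard K L ∈ maxIdeal K (SeparableClosure K)

/-- The maximal unramified extension `F^nr` of `F` in `K^s`: the compositum of all finite
extensions `L` of `F` that are unramified over `F`, that is, for which `e(L/K) = e(F/K)`.
(Residue fields are finite, so residue extensions are separable.) -/
def maxUnram (F : IntermediateField K (SeparableClosure K)) :
    IntermediateField K (SeparableClosure K) :=
  sSup {L | F ≤ L ∧ FiniteDimensional K L ∧ ramDeg K L = ramDeg K F}

/-- The extensions `L` of `K` inside `F^nr` of ramification degree `|I|`, for `I` the inertia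
subgroup of `Gal(F/K)`, and of residue degree `n`. -/
def subextensions (F : IntermediateField K (SeparableClosure K)) (n : ℕ) :
    Set (IntermediateField K (SeparableClosure K)) :=
  {L | L ≤ maxUnram F ∧ FiniteDimensional K L ∧
    ramDeg K L = Nat.card (inertia K F) ∧ resDeg K L = n}

end Fields

section Representations

variable {K : Type*} [Field K] [ValuativeRel K] [TopologicalSpace K]
  [IsNonarchimedeanLocalField K]

/-- The representation `ρ` of the Weil group factors through (the image of the Weil group in)
`Gal(F^nr/K)`. For finite-dimensional complex representations this includes continuity,
because the subgroup `Gal(K^s/F^nr) = I_F` is open in `I_K` for `F / K` finite. -/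
def FactorsThroughMaxUnram (F : IntermediateField K (SeparableClosure K))
    {V : Type*} [AddCommGroup V] [Module ℂ V] (ρ : Representation ℂ (weilGroup K) V) : Prop :=
  ∀ w : weilGroup K, (w : Gal(SeparableClosure K/K)) ∈ (maxUnram F).fixingSubgroup → ρ w = 1

/-- A representation of the Weil group is unramified if it is trivial on the absolute inertia
group `I_K`; continuity is then automatic. -/
def IsUnramified {V : Type*} [AddCommGroup V] [Module ℂ V]
    (ρ : Representation ℂ (weilGroup K) V) : Prop :=
  ∀ w : weilGroup K,
    (w : Gal(SeparableClosure K/K)) ∈ inertia K (SeparableClosure K) → ρ w = 1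

variable {F : IntermediateField K (SeparableClosure K)}

/-- A representation of `Gal(F/K)` is unramified if it is trivial on the inertia subgroup. -/
def IsUnramifiedFin {V : Type*} [AddCommGroup V] [Module ℂ V]
    (τ : Representation ℂ Gal(F/K) V) : Prop :=
  ∀ g ∈ inertia K F, τ g = 1

/-- Two representations of `Gal(F/K)` are unramified twists of each other:
`τ ≅ τ' ⊗ χ` for a one-dimensional unramified representation `χ` of `Gal(F/K)`. -/
def IsUnramifiedTwist {V V' : Type*} [AddCommGroup V] [Module ℂ V] [AddCommGroup V'] [Module ℂ V']
    (τ : Representation ℂ Gal(F/K) V) (τ' : Representation ℂ Gal(F/K) V') : Prop :=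
  ∃ χ : Representation ℂ Gal(F/K) ℂ, IsUnramifiedFin χ ∧ Nonempty (τ.Equiv (τ'.tprod χ))

/-- `⟨Res_I τ, Res_I τ⟩ = dim Hom_I(τ, τ)`, for `I` the inertia subgroup of `Gal(F/K)`. -/
def inertiaMult {V : Type*} [AddCommGroup V] [Module ℂ V]
    (τ : Representation ℂ Gal(F/K) V) : ℕ :=
  Module.finrank ℂ (Representation.IntertwiningMap
    (τ.comp (inertia K F).subtype) (τ.comp (inertia K F).subtype))

variable [IsGalois K F]

/-- The restriction map `W_K → Gal(F/K)`. -/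
def weilRestrict (F : IntermediateField K (SeparableClosure K)) [IsGalois K F] :
    weilGroup K →* Gal(F/K) :=
  (AlgEquiv.restrictNormalHom F).comp (weilGroup K).subtype

/-- A representation of `Gal(F/K)`, viewed as a representation of the Weil group. -/
def inflate {V : Type*} [AddCommGroup V] [Module ℂ V]
    (τ : Representation ℂ Gal(F/K) V) : Representation ℂ (weilGroup K) V :=
  τ.comp (weilRestrict F)

/-- The weighted average of Frobenius traces
`1 / (|I| m) * ∑_L conj (tr τ(Frob_L)) * tr ρ(Frob_L)`, where `m = ⟨Res_I τ, Res_I τ⟩` and `L`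
ranges over the extensions of `K` in `F^nr` of ramification degree `|I|` and residue
degree `n`. The Frobenius elements `Frob_L` are given by the function `frob`. -/
def frobAverage {V V' : Type*} [AddCommGroup V] [Module ℂ V] [AddCommGroup V'] [Module ℂ V']
    (frob : IntermediateField K (SeparableClosure K) → weilGroup K)
    (τ : Representation ℂ Gal(F/K) V) (ρ : Representation ℂ (weilGroup K) V') (n : ℕ) : ℂ :=
  1 / ((Nat.card (inertia K F) : ℂ) * (inertiaMult τ : ℂ)) *
    ∑ᶠ L ∈ subextensions F n,
      (starRingEnd ℂ) ((inflate τ).character (frob L)) * ρ.character (frob L)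

/-- The eigenvalues of the endomorphism `f`, counted with multiplicity, form the multiset `t`. -/
def HasEigenvalues {V : Type*} [AddCommGroup V] [Module ℂ V] [FiniteDimensional ℂ V]
    (f : Module.End ℂ V) (t : Multiset ℂˣ) : Prop :=
  f.charpoly.roots = t.map (fun z : ℂˣ => (z : ℂ))

end Representations

end

end LocalGalois

open LocalGalois

set_option linter.unusedSectionVars false

/-! Write `W` for the Weil group, `v : W → ℤ` for the degree (`weilVal`), `π : W → G` for
restriction to the finite group `G = Gal(F/K)` (`weilRestrict`), and `φ` for an element of degree 1.
The representation theory uses only that `π` is surjective, that `I = π(ker v)`, and that `ρ` is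
trivial on `ker v ∩ ker π`; an unramified representation is one that is trivial on `ker v`.

Part (i) is Schur's lemma. An element `z` of `ker π` commutes with `W` modulo `ker v ∩ ker π`, so it
acts as a scalar on each irreducible constituent of `ρ`. Choose `z` such that `v z` generates `v(ker
π)`. A suitable unramified twist makes `z` act trivially, and then the constituent comes from `G`
(`exists_twist_eq_comp`). Hence every constituent is an unramified twist of some `τ i`.

The central object is the space `Hom_I(τ, τ')` with its action of `φ`. That action has finite order,
so it is diagonalizable, and an eigenvector with eigenvalue `c` is precisely an isomorphism from the
twist of `τ` by `c ^ v` to `τ'` (`exists_twist_equiv`). So `Hom_I(τ i, τ j) = 0` for `i ≠ j`. On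
`End_I(τ i)` every eigenspace is a line, and the eigenvalues form the group of unramified characters
fixing `τ i`. This group has order `m = dim End_I(τ i)`, so it is the group of `m`-th roots of unity
(`mem_twistStabilizer_iff`).

Consequently `φ ^ (d * m)` is trivial on `End_I(τ i)`, and summing `conj χ_i * χ_j` over the coset
`φ ^ (d * m) I` gives `|I| m` for `j = i` and `0` otherwise (`sum_star_character_mul_sum`). Part
(ii) follows because the elements `Frob_L` run exactly once through this coset
(`bijOn_subextensions`). That is the arithmetic input: the fields `L` are those with the same
inertia group as `F` and the right residue degree.

For (iii) and (iv), the twist `τ i ⊗ Ψ` depends only on the `m`-th powers of the Frobenius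
eigenvalues of a diagonalizable `Ψ` (`nonempty_tprod_equiv_of_map_pow_eq`), and by Newton's
identities these powers are determined by their power sums (`multiset_eq_of_psum_eq`). -/

namespace LocalGalois

noncomputable section

/-! ### Integral closures in algebraic extensions of complete fields -/

section SpectralNorm

variable {R K L : Type*} [CommRing R] [IsDomain R] [IsIntegrallyClosed R]
  [NontriviallyNormedField K] [CompleteSpace K] [IsUltrametricDist K] [Algebra R K]
  [IsFractionRing R K] [Field L] [Algebra K L] [Algebra R L] [IsScalarTower R K L]
  [Algebra.IsAlgebraic K L]

/-- Over a complete field with unit ball `R`, integrality over `R` is detected by the spectral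
norm. -/
theorem isIntegral_iff_spectralNorm_le_one
    (hR : ∀ x : K, ‖x‖ ≤ 1 ↔ x ∈ Set.range (algebraMap R K)) (x : L) :
    IsIntegral R x ↔ spectralNorm K L x ≤ 1 := by
  have hx : IsIntegral K x := (Algebra.IsAlgebraic.isAlgebraic x).isIntegral
  rw [spectralNorm, spectralValue_le_one_iff (minpoly.monic hx)]
  constructor
  · intro h n
    have : FaithfulSMul R L := by
      rw [faithfulSMul_iff_algebraMap_injective, IsScalarTower.algebraMap_eq R K L]
      exact (algebraMap K L).injective.comp (IsFractionRing.injective R K)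
    rw [minpoly.isIntegrallyClosed_eq_field_fractions' K h, Polynomial.coeff_map, hR]
    exact ⟨_, rfl⟩
  · intro h
    have hl : minpoly K x ∈ Polynomial.lifts (algebraMap R K) := by
      rw [Polynomial.lifts_iff_coeff_lifts]
      exact fun n => (hR _).1 (h n)
    obtain ⟨p, hp, -, hm⟩ := Polynomial.lifts_and_natDegree_eq_and_monic hl (minpoly.monic hx)
    refine ⟨p, hm, ?_⟩
    rw [← Polynomial.aeval_def, ← Polynomial.aeval_map_algebraMap K, hp, minpoly.aeval]

/-- The spectral norm is multiplicative, so the units are the elements of norm exactly 1. The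
non-units have norm less than 1, and the ultrametric inequality makes them closed under addition. -/
theorem isLocalRing_integralClosure_of_norm
    (hR : ∀ x : K, ‖x‖ ≤ 1 ↔ x ∈ Set.range (algebraMap R K)) :
    IsLocalRing (integralClosure R L) := by
  have hu : ∀ a : integralClosure R L, IsUnit a ↔ spectralNorm K L (a : L) = 1 := by
    intro a
    have ha := (isIntegral_iff_spectralNorm_le_one hR (a : L)).1 a.2
    constructor
    · rintro ⟨u, rfl⟩
      have hv := (isIntegral_iff_spectralNorm_le_one hR _).1 (↑u⁻¹ : integralClosure R L).2
      have hm := spectralAlgNorm_mul (K := K) ((u : integralClosure R L) : L)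
        ((↑u⁻¹ : integralClosure R L) : L)
      rw [← MulMemClass.coe_mul, Units.mul_inv, OneMemClass.coe_one, spectralAlgNorm_one,
        spectralAlgNorm_def, spectralAlgNorm_def] at hm
      refine le_antisymm ha ?_
      rw [hm]
      exact mul_le_of_le_one_right (spectralNorm_nonneg _) hv
    · intro h
      have h0 : (a : L) ≠ 0 := by
        intro h0
        rw [h0, spectralNorm_zero] at h
        exact zero_ne_one h
      have hm := spectralAlgNorm_mul (K := K) (a : L) ((a : L)⁻¹)
      rw [mul_inv_cancel₀ h0, spectralAlgNorm_one, spectralAlgNorm_def, spectralAlgNorm_def, h,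
        one_mul] at hm
      refine IsUnit.of_mul_eq_one ⟨(a : L)⁻¹, (isIntegral_iff_spectralNorm_le_one hR _).2 hm.symm.le⟩ ?_
      exact Subtype.ext (mul_inv_cancel₀ h0)
  refine IsLocalRing.of_nonunits_add fun a b ha hb => ?_
  rw [mem_nonunits_iff, hu] at *
  have ha' := lt_of_le_of_ne ((isIntegral_iff_spectralNorm_le_one hR (a : L)).1 a.2) ha
  have hb' := lt_of_le_of_ne ((isIntegral_iff_spectralNorm_le_one hR (b : L)).1 b.2) hb
  exact ((isNonarchimedean_spectralNorm (K := K) (a : L) b).trans_lt (max_lt ha' hb')).ne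

end SpectralNorm

/-! ### The ring of integers of an algebraic extension is local -/

section LocalField

variable (K : Type*) [Field K] [ValuativeRel K] [TopologicalSpace K]
  [IsNonarchimedeanLocalField K] (L : Type*) [Field L] [Algebra K L] [Algebra.IsAlgebraic K L]

open scoped Valued in
instance isLocalRing_ringOfInt : IsLocalRing (ringOfInt K L) := by
  let := IsTopologicalAddGroup.rightUniformSpace K
  have := isUniformAddGroup_of_addCommGroup (G := K)
  -- Embedding the rank-one value group in the reals gives a norm on `K` with closed unit ball
  -- `𝒪[K]`.
  let : (Valued.v (R := K)).RankOne :=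
  { hom' := IsRankLeOne.nonempty.some.emb (R := K).comp MonoidWithZeroHom.ValueGroup₀.embedding
    strictMono' := IsRankLeOne.nonempty.some.strictMono.comp
        MonoidWithZeroHom.ValueGroup₀.embedding_strictMono }
  refine isLocalRing_integralClosure_of_norm (R := (valuation K).integer) (K := K) fun x => ?_
  rw [Valued.toNormedField.norm_le_one_iff]
  exact ⟨fun h => ⟨⟨x, h⟩, rfl⟩, by rintro ⟨y, rfl⟩; exact y.2⟩

theorem maxIdeal_eq : maxIdeal K L = IsLocalRing.maximalIdeal (ringOfInt K L) :=
  IsLocalRing.jacobson_eq_maximalIdeal ⊥ bot_ne_top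

instance isMaximal_maxIdeal : (maxIdeal K L).IsMaximal := by
  rw [maxIdeal_eq]; infer_instance

instance liesOver_maxIdeal : (maxIdeal K L).LiesOver 𝓂[K] := by
  constructor
  exact (IsLocalRing.eq_maximalIdeal (Ideal.isMaximal_comap_of_isIntegral_of_isMaximal _)).symm

end LocalField

end

noncomputable section

/-! ### The Galois action on the residue field -/

section ResidueAction

variable (K : Type*) [Field K] [ValuativeRel K] [TopologicalSpace K]
  [IsNonarchimedeanLocalField K] (S : Type*) [Field S] [Algebra K S]

/-- The residue field of the local field `K`. -/
def baseResidueField : Type _ := 𝒪[K] ⧸ 𝓂[K]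

instance fieldBaseResidueField : Field (baseResidueField K) := Ideal.Quotient.field 𝓂[K]

instance finite_baseResidueField : Finite (baseResidueField K) :=
  inferInstanceAs (Finite 𝓀[K])

/-- The residue field of an algebraic extension of a local field. -/
def extResidueField : Type _ := ringOfInt K S ⧸ maxIdeal K S

variable [Algebra.IsAlgebraic K S]

instance fieldExtResidueField : Field (extResidueField K S) :=
  Ideal.Quotient.field (maxIdeal K S)

instance algebraExtResidueField : Algebra (baseResidueField K) (extResidueField K S) :=
  inferInstanceAs (Algebra (𝒪[K] ⧸ 𝓂[K]) (ringOfInt K S ⧸ maxIdeal K S))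

instance isAlgebraic_extResidueField : Algebra.IsAlgebraic (baseResidueField K) (extResidueField K S) := by
  have h : Algebra.IsIntegral (𝒪[K] ⧸ 𝓂[K]) (ringOfInt K S ⧸ maxIdeal K S) := inferInstance
  exact @Algebra.IsIntegral.isAlgebraic (baseResidueField K) (extResidueField K S) _ _ _ _ h

/-- The Galois action on the ring of integers (a shortcut for instance resolution). -/
instance mulSemiringActionRingOfInt : MulSemiringAction Gal(S/K) (ringOfInt K S) := inferInstance

open Pointwise in
/-- The Galois action on the ideals of the ring of integers (a shortcut for instance resolution). -/
instance mulActionIdealRingOfInt : MulAction Gal(S/K) (Ideal (ringOfInt K S)) :=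
  Ideal.pointwiseDistribMulAction.toMulAction

open Pointwise in
theorem mem_stabilizer_maxIdeal (σ : Gal(S/K)) :
    σ ∈ MulAction.stabilizer Gal(S/K) (maxIdeal K S) := by
  rw [MulAction.mem_stabilizer_iff, maxIdeal_eq]
  have : (σ • IsLocalRing.maximalIdeal (ringOfInt K S)).IsMaximal := by
    rw [Ideal.pointwise_smul_eq_comap]
    exact Ideal.comap_isMaximal_of_equiv _
  exact IsLocalRing.eq_maximalIdeal this

open Pointwise in
/-- The action of the Galois group on the residue field of the top field. -/
def residueAction : Gal(S/K) →* Gal(extResidueField K S/baseResidueField K) :=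
  (Ideal.Quotient.stabilizerHom (maxIdeal K S) 𝓂[K] Gal(S/K)).comp
    ((MonoidHom.id _).codRestrict _ (mem_stabilizer_maxIdeal K S))

variable {K S}

/-- The reduction map to the residue field. -/
def toResidue : ringOfInt K S →+* extResidueField K S := Ideal.Quotient.mk _

theorem toResidue_eq_iff {x y : ringOfInt K S} :
    toResidue x = toResidue y ↔ x - y ∈ maxIdeal K S := Ideal.Quotient.eq

theorem toResidue_surjective : Function.Surjective (toResidue (K := K) (S := S)) :=
  Ideal.Quotient.mk_surjective

theorem residueAction_toResidue (σ : Gal(S/K)) (x : ringOfInt K S) :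
    residueAction K S σ (toResidue x) = toResidue (σ • x) := rfl

theorem mem_inertia_iff (σ : Gal(S/K)) : σ ∈ inertia K S ↔ residueAction K S σ = 1 := by
  rw [AlgEquiv.ext_iff, toResidue_surjective.forall]
  simp only [residueAction_toResidue, AlgEquiv.one_apply]
  exact forall_congr' fun x => toResidue_eq_iff.symm

theorem inertia_eq_ker : inertia K S = (residueAction K S).ker := by
  ext σ
  rw [mem_inertia_iff, MonoidHom.mem_ker]

/-- The integers of the intermediate field `L` inside the integers of `S`. -/
def intSubring (L : IntermediateField K S) : Subring (ringOfInt K S) :=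
  L.toSubfield.toSubring.comap (ringOfInt K S).val.toRingHom

theorem smul_eq_self_of_mem_fixingSubgroup {L : IntermediateField K S} {σ : Gal(S/K)}
    (hσ : σ ∈ L.fixingSubgroup) {x : ringOfInt K S} (hx : (x : S) ∈ L) : σ • x = x :=
  Subtype.ext ((IntermediateField.mem_fixingSubgroup_iff _ _).1 hσ x hx)

theorem isOpen_stabilizer_ringOfInt (x : ringOfInt K S) :
    IsOpen (MulAction.stabilizer Gal(S/K) x : Set Gal(S/K)) := by
  convert stabilizer_isOpen_of_isIntegral (K := K) (x : S)
  ext σ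
  exact Subtype.ext_iff

/-- `Gal(S/L)` surjects onto the automorphisms of the residue field of `S` that are trivial on
the residue field of `L`. -/
theorem exists_fixingSubgroup_residueAction_eq [IsGalois K S] (L : IntermediateField K S)
    (t : Gal(extResidueField K S/baseResidueField K))
    (ht : ∀ x : ringOfInt K S, (x : S) ∈ L → t (toResidue x) = toResidue x) :
    ∃ σ ∈ L.fixingSubgroup, residueAction K S σ = t := by
  let A := intSubring L
  let H := L.fixingSubgroup
  -- With the discrete topology on the integers the action is continuous, since stabilizers are
  -- open; this allows the surjectivity theorem for profinite groups to be applied to `Gal(S/L)`.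
  let _ : TopologicalSpace (ringOfInt K S) := ⊥
  have : DiscreteTopology (ringOfInt K S) := ⟨rfl⟩
  have : CompactSpace H :=
    isCompact_iff_compactSpace.1 (InfiniteGalois.fixingSubgroup_isClosed L).isCompact
  have : ContinuousSMul H (ringOfInt K S) := by
    rw [continuousSMul_iff_stabilizer_isOpen]
    intro x
    exact (isOpen_stabilizer_ringOfInt x).preimage continuous_subtype_val
  have : SMulCommClass H A (ringOfInt K S) := by
    refine ⟨fun σ a x => ?_⟩
    change (σ : Gal(S/K)) • ((a : ringOfInt K S) * x) = a * ((σ : Gal(S/K)) • x)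
    rw [smul_mul', smul_eq_self_of_mem_fixingSubgroup σ.2 a.2]
  have : Algebra.IsInvariant A (ringOfInt K S) H := by
    refine ⟨fun b hb => ⟨⟨b, ?_⟩, rfl⟩⟩
    change (b : S) ∈ L
    rw [← InfiniteGalois.fixedField_fixingSubgroup L]
    exact fun σ => congrArg Subtype.val (hb σ)
  let e : (ringOfInt K S ⧸ maxIdeal K S) ≃ₐ[A ⧸ (maxIdeal K S).under A]
      (ringOfInt K S ⧸ maxIdeal K S) :=
    AlgEquiv.ofRingEquiv (f := t.toRingEquiv) (by
      intro a
      obtain ⟨a, rfl⟩ := Ideal.Quotient.mk_surjective a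
      exact ht a a.2)
  obtain ⟨g, hg⟩ := Ideal.Quotient.stabilizerHom_surjective_of_profinite (G := H)
    ((maxIdeal K S).under A) (maxIdeal K S) e
  refine ⟨g, g.1.2, ?_⟩
  ext x
  obtain ⟨x, rfl⟩ := toResidue_surjective x
  exact DFunLike.congr_fun hg (toResidue x)

/-- This is the case `L = K`. Since `𝒪[K]` is integrally closed, integers of `S` lying in `K` come
from `𝒪[K]`, so every automorphism over the base residue field satisfies the condition. -/
theorem residueAction_surjective [IsGalois K S] : Function.Surjective (residueAction K S) := by
  intro t
  obtain ⟨σ, -, h⟩ := exists_fixingSubgroup_residueAction_eq (⊥ : IntermediateField K S) t (by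
    intro x hx
    obtain ⟨y, hy⟩ := IntermediateField.mem_bot.1 hx
    have hyi : IsIntegral 𝒪[K] y := by
      rw [← isIntegral_algebraMap_iff (algebraMap K S).injective, hy]
      exact x.2
    obtain ⟨z, rfl⟩ := IsIntegrallyClosed.isIntegral_iff.1 hyi
    have : x = algebraMap 𝒪[K] _ z := Subtype.ext hy.symm
    rw [this]
    exact t.commutes (Ideal.Quotient.mk 𝓂[K] z))
  exact ⟨σ, h⟩

end ResidueAction

end

noncomputable section

/-! ### Ramification and residue degrees of finite extensions -/

section Degrees

variable (K : Type*) [Field K] [ValuativeRel K] [TopologicalSpace K]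
  [IsNonarchimedeanLocalField K] (L : Type*) [Field L] [Algebra K L]

instance module_finite_ringOfInt [FiniteDimensional K L] [Algebra.IsSeparable K L] :
    Module.Finite 𝒪[K] (ringOfInt K L) :=
  IsIntegralClosure.finite 𝒪[K] K L (ringOfInt K L)

/-- As `𝒪_L` is local, a single prime lies over `𝓂[K]`, and the sum in the fundamental identity `∑ e
f = n` has only one term. -/
theorem ramDeg_mul_resDeg [FiniteDimensional K L] [Algebra.IsSeparable K L] :
    ramDeg K L * resDeg K L = Module.finrank K L := by
  have hfr : IsFractionRing (ringOfInt K L) L :=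
    integralClosure.isFractionRing_of_finite_extension K L
  have hu : ∀ q : (𝓂[K]).primesOver (ringOfInt K L), q.1 = maxIdeal K L := by
    rintro ⟨q, hq, hl⟩
    rw [maxIdeal_eq]
    exact IsLocalRing.eq_maximalIdeal (Ideal.IsMaximal.of_liesOver_isMaximal q 𝓂[K])
  let _ : Unique ((𝓂[K]).primesOver (ringOfInt K L)) :=
    { default := ⟨maxIdeal K L, inferInstance, inferInstance⟩
      uniq := fun q => Subtype.ext (hu q) }
  have : Module.Free 𝒪[K] (ringOfInt K L) :=
    IsIntegralClosure.module_free 𝒪[K] K L (ringOfInt K L)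
  have : Module.Flat 𝒪[K] (ringOfInt K L) := Module.Flat.of_free
  have h := Ideal.sum_ramification_inertia_eq_finrank 𝓂[K] (ringOfInt K L)
  rw [Fintype.sum_unique, hu] at h
  rw [IsFractionRing.finrank_eq 𝒪[K] K (ringOfInt K L) L, ← h]
  rfl

theorem resDeg_eq_finrank [Algebra.IsAlgebraic K L] :
    resDeg K L = Module.finrank (baseResidueField K) (extResidueField K L) :=
  Ideal.inertiaDeg_eq_of_isMaximal 𝓂[K] (maxIdeal K L)

theorem ramDeg_pos [FiniteDimensional K L] [Algebra.IsSeparable K L] : 0 < ramDeg K L := by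
  have h := ramDeg_mul_resDeg K L
  exact Nat.pos_of_ne_zero fun h0 => (Module.finrank_pos (R := K) (M := L)).ne' (by rw [← h, h0, zero_mul])

theorem resDeg_pos [FiniteDimensional K L] [Algebra.IsSeparable K L] : 0 < resDeg K L := by
  have h := ramDeg_mul_resDeg K L
  exact Nat.pos_of_ne_zero fun h0 => (Module.finrank_pos (R := K) (M := L)).ne' (by rw [← h, h0, mul_zero])

theorem resCard_eq [FiniteDimensional K L] [Algebra.IsSeparable K L] :
    resCard K L = Nat.card 𝓀[K] ^ resDeg K L := by
  have h := Ideal.cardQuot_pow_inertiaDeg 𝓂[K] (maxIdeal K L)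
  rw [Submodule.cardQuot_apply, Submodule.cardQuot_apply] at h
  exact h.symm

end Degrees

/-! ### Ramification and residue degrees as indices of subgroups -/

section Index

/-- When `N` is normal, `H ⊔ N` is the product set, so the injection of the cosets of `H ∩ N` in `N`
into those of `H` in `H ⊔ N` is also surjective. -/
theorem relIndex_sup_of_normal {G : Type*} [Group G] (H N : Subgroup G) [N.Normal] :
    H.relIndex (H ⊔ N) = H.relIndex N := by
  refine (Nat.card_eq_of_bijective
    (Subgroup.quotientSubgroupOfEmbeddingOfLE H (le_sup_right : N ≤ H ⊔ N))
    ⟨Function.Embedding.injective _, fun x => ?_⟩).symm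
  obtain ⟨⟨x, hx⟩, rfl⟩ := QuotientGroup.mk_surjective x
  rw [sup_comm] at hx
  obtain ⟨n, hn, h, hh, rfl⟩ := Subgroup.mem_sup_of_normal_left.1 hx
  refine ⟨QuotientGroup.mk ⟨n, hn⟩, ?_⟩
  rw [Subgroup.quotientSubgroupOfEmbeddingOfLE_apply_mk, QuotientGroup.eq, Subgroup.mem_subgroupOf]
  simpa using hh

variable {K : Type*} [Field K] [ValuativeRel K] [TopologicalSpace K]
  [IsNonarchimedeanLocalField K] {S : Type*} [Field S] [Algebra K S]

/-- An algebraic extension of a finite field is Galois. -/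
theorem isGalois_of_finite (k l : Type*) [Field k] [Finite k] [Field l] [Algebra k l]
    [Algebra.IsAlgebraic k l] : IsGalois k l := by
  have : Normal k l := by
    rw [normal_iff]
    intro x
    have hx : IsIntegral k x := (Algebra.IsAlgebraic.isAlgebraic x).isIntegral
    refine ⟨hx, ?_⟩
    -- The field `k(x)` is finite, hence normal over `k`, so the minimal polynomial of `x` already
    -- splits there.
    have : FiniteDimensional k (IntermediateField.adjoin k {x}) :=
      IntermediateField.adjoin.finiteDimensional hx
    have : Finite (IntermediateField.adjoin k {x}) := Module.finite_of_finite k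
    have hs := Normal.splits (inferInstance : Normal k (IntermediateField.adjoin k {x}))
      (IntermediateField.AdjoinSimple.gen k x)
    rw [IntermediateField.minpoly_gen] at hs
    have h2 := hs.map (algebraMap (IntermediateField.adjoin k {x}) l)
    rwa [Polynomial.map_map, ← IsScalarTower.algebraMap_eq] at h2
  exact {}

variable [Algebra.IsAlgebraic K S]

instance isGalois_extResidueField : IsGalois (baseResidueField K) (extResidueField K S) :=
  isGalois_of_finite _ _

/-- The inclusion of the integers of an intermediate field. -/
def ringOfIntMap (L : IntermediateField K S) : ringOfInt K L →ₐ[𝒪[K]] ringOfInt K S :=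
  (L.val.restrictScalars 𝒪[K]).mapIntegralClosure

theorem exists_ringOfIntMap_eq {L : IntermediateField K S} {x : ringOfInt K S}
    (hx : (x : S) ∈ L) : ∃ y, ringOfIntMap L y = x := by
  refine ⟨⟨⟨x, hx⟩, ?_⟩, rfl⟩
  have := x.2
  rw [mem_integralClosure_iff] at this ⊢
  exact (isIntegral_algHom_iff (L.val.restrictScalars 𝒪[K]) L.val.injective).1 this

theorem comap_ringOfIntMap (L : IntermediateField K S) :
    (maxIdeal K S).comap (ringOfIntMap L) = maxIdeal K L := by
  have : Algebra.IsAlgebraic K L := inferInstance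
  rw [maxIdeal_eq K L]
  have hm : ((maxIdeal K S).comap (ringOfIntMap L)).IsPrime := inferInstance
  have hl : ((maxIdeal K S).comap (ringOfIntMap L)).LiesOver 𝓂[K] := by
    constructor
    rw [(liesOver_maxIdeal K S).over, Ideal.under_def, Ideal.under_def, 
      ← (ringOfIntMap L).comp_algebraMap]
    rfl
  exact IsLocalRing.eq_maximalIdeal (Ideal.IsMaximal.of_liesOver_isMaximal _ 𝓂[K])

/-- The inclusion of the residue field of an intermediate field. -/
def residueMap (L : IntermediateField K S) :
    extResidueField K L →ₐ[(baseResidueField K)] extResidueField K S where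
  toRingHom := Ideal.quotientMap (maxIdeal K S) (ringOfIntMap L : ringOfInt K L →+* ringOfInt K S)
    (comap_ringOfIntMap L).ge
  commutes' r := by
    obtain ⟨r, rfl⟩ := Ideal.Quotient.mk_surjective r
    exact congrArg toResidue ((ringOfIntMap L).commutes r)

theorem residueMap_toResidue (L : IntermediateField K S) (x : ringOfInt K L) :
    residueMap L (toResidue x) = toResidue (ringOfIntMap L x) := rfl

/-- The residue field of an intermediate field, as a subfield of the residue field of `S`. -/
def residueSubfield (L : IntermediateField K S) : IntermediateField (baseResidueField K) (extResidueField K S) :=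
  (residueMap L).fieldRange

theorem mem_residueSubfield {L : IntermediateField K S} {y : extResidueField K S} :
    y ∈ residueSubfield L ↔ ∃ x : ringOfInt K S, (x : S) ∈ L ∧ toResidue x = y := by
  constructor
  · rintro ⟨x, rfl⟩
    obtain ⟨x, rfl⟩ := toResidue_surjective x
    exact ⟨ringOfIntMap L x, (x : L).2, rfl⟩
  · rintro ⟨x, hx, rfl⟩
    obtain ⟨x, rfl⟩ := exists_ringOfIntMap_eq hx
    exact ⟨toResidue x, rfl⟩

theorem finrank_residueSubfield (L : IntermediateField K S) :
    Module.finrank (baseResidueField K) (residueSubfield L) = resDeg K L := by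
  rw [resDeg_eq_finrank]
  exact (AlgEquiv.ofInjectiveField (residueMap L)).symm.toLinearEquiv.finrank_eq

variable [IsGalois K S]

/-- The automorphisms that act trivially on the subfield `k` of the residue field. -/
def residueFixing (k : IntermediateField (baseResidueField K) (extResidueField K S)) : Subgroup Gal(S/K) :=
  k.fixingSubgroup.comap (residueAction K S)

theorem mem_residueFixing {k : IntermediateField (baseResidueField K) (extResidueField K S)} {σ : Gal(S/K)} :
    σ ∈ residueFixing k ↔ ∀ x ∈ k, residueAction K S σ x = x :=
  IntermediateField.mem_fixingSubgroup_iff _ _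

theorem index_residueFixing (k : IntermediateField (baseResidueField K) (extResidueField K S)) :
    (residueFixing k).index = Module.finrank (baseResidueField K) k := by
  rw [residueFixing, Subgroup.index_comap_of_surjective _ residueAction_surjective,
    IntermediateField.finrank_eq_fixingSubgroup_index]

theorem inertia_le_residueFixing (k : IntermediateField (baseResidueField K) (extResidueField K S)) :
    inertia K S ≤ residueFixing k := by
  intro σ hσ
  rw [mem_inertia_iff] at hσ
  rw [mem_residueFixing]
  intro x _
  rw [hσ, AlgEquiv.one_apply]

instance normal_inertia : (inertia K S).Normal := by
  rw [inertia_eq_ker]; infer_instance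

/-- Some `g` in `Gal(S/L)` has the same residue action as `σ`, and then `σ * g⁻¹` is inertial. -/
theorem exists_mul_of_mem_residueFixing {L : IntermediateField K S} {σ : Gal(S/K)}
    (hσ : σ ∈ residueFixing (residueSubfield L)) :
    ∃ u ∈ inertia K S, ∃ g ∈ L.fixingSubgroup, σ = u * g := by
  obtain ⟨g, hg, h⟩ := exists_fixingSubgroup_residueAction_eq L (residueAction K S σ)
    fun x hx => mem_residueFixing.1 hσ _ (mem_residueSubfield.2 ⟨x, hx, rfl⟩)
  refine ⟨σ * g⁻¹, ?_, g, hg, by group⟩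
  rw [mem_inertia_iff, map_mul, map_inv, h, mul_inv_cancel]

theorem residueFixing_residueSubfield (L : IntermediateField K S) :
    residueFixing (residueSubfield L) = inertia K S ⊔ L.fixingSubgroup := by
  apply le_antisymm
  · intro σ hσ
    obtain ⟨u, hu, g, hg, rfl⟩ := exists_mul_of_mem_residueFixing hσ
    exact Subgroup.mul_mem_sup hu hg
  · refine sup_le (inertia_le_residueFixing _) fun σ hσ => ?_
    rw [mem_residueFixing]
    intro y hy
    obtain ⟨x, hx, rfl⟩ := mem_residueSubfield.1 hy
    rw [residueAction_toResidue, smul_eq_self_of_mem_fixingSubgroup hσ hx]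

/-- The residue degree is the index of the image of `Gal(S/L)` in the residue Galois group. -/
theorem index_inertia_sup_fixingSubgroup (L : IntermediateField K S) :
    (inertia K S ⊔ L.fixingSubgroup).index = resDeg K L := by
  rw [← residueFixing_residueSubfield, index_residueFixing, finrank_residueSubfield]

/-- The ramification degree of `L` is the index of the inertia group of `L`. -/
theorem relIndex_fixingSubgroup_inertia (L : IntermediateField K S) [FiniteDimensional K L] :
    L.fixingSubgroup.relIndex (inertia K S) = ramDeg K L := by
  -- Here `[L : K] = e f` is the index of `Gal(S/L)`, and `f` is the index of the larger group `I ·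
  -- Gal(S/L)`; cancelling `f` leaves `e`.
  have h1 := Subgroup.relIndex_mul_index (le_sup_right : L.fixingSubgroup ≤ inertia K S ⊔ L.fixingSubgroup)
  rw [index_inertia_sup_fixingSubgroup, ← IntermediateField.finrank_eq_fixingSubgroup_index,
    ← ramDeg_mul_resDeg, sup_comm] at h1
  rw [← relIndex_sup_of_normal]
  exact Nat.eq_of_mul_eq_mul_right (resDeg_pos K L) h1

end Index

end

noncomputable section

/-! ### Frobenius and the finite subfields of the residue field -/

section Residue

variable {K : Type*} [Field K] [ValuativeRel K] [TopologicalSpace K]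
  [IsNonarchimedeanLocalField K] {S : Type*} [Field S] [Algebra K S] [Algebra.IsAlgebraic K S]

variable (K S) in
/-- The Frobenius automorphism of the residue field. -/
def residueFrob : Gal(extResidueField K S/baseResidueField K) :=
  letI := Fintype.ofFinite (baseResidueField K)
  FiniteField.frobeniusAlgEquivOfAlgebraic _ _

theorem residueFrob_pow_apply (n : ℕ) (y : extResidueField K S) :
    (residueFrob K S ^ n) y = y ^ Nat.card (baseResidueField K) ^ n := by
  let _ := Fintype.ofFinite (baseResidueField K)
  rw [AlgEquiv.coe_pow, Nat.card_eq_fintype_card]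
  exact congrFun (FiniteField.coe_frobeniusAlgEquivOfAlgebraic_iterate _ _ n) y

theorem natCast_card_baseResidueField :
    ((Nat.card (baseResidueField K) : ℕ) : extResidueField K S) = 0 := by
  let _ := Fintype.ofFinite (baseResidueField K)
  rw [Nat.card_eq_fintype_card, ← map_natCast (algebraMap (baseResidueField K) (extResidueField K S)),
    FiniteField.cast_card_eq_zero, map_zero]

theorem one_lt_card_baseResidueField : 1 < Nat.card (baseResidueField K) :=
  Finite.one_lt_card

theorem card_intermediateField (k : IntermediateField (baseResidueField K) (extResidueField K S))
    [Module.Finite (baseResidueField K) k] :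
    Nat.card k = Nat.card (baseResidueField K) ^ Module.finrank (baseResidueField K) k :=
  Module.natCard_eq_pow_finrank

/-- A subfield of the residue field fixed by the `n`-th power of Frobenius has degree at most `n`. -/
theorem finrank_le_of_residueFrob_pow
    (k : IntermediateField (baseResidueField K) (extResidueField K S))
    [Module.Finite (baseResidueField K) k] {n : ℕ} (hn : 0 < n)
    (h : ∀ y ∈ k, (residueFrob K S ^ n) y = y) :
    Module.finrank (baseResidueField K) k ≤ n := by
  classical
  have hq := one_lt_card_baseResidueField (K := K)
  rw [← Nat.pow_le_pow_iff_right hq, ← card_intermediateField]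
  have hn' : 1 < Nat.card (baseResidueField K) ^ n := Nat.one_lt_pow hn.ne' hq
  -- The elements of `k` are roots of `X ^ (q ^ n) - X`, which bounds their number by `q ^ n`.
  set p : Polynomial (extResidueField K S) :=
    Polynomial.X ^ (Nat.card (baseResidueField K) ^ n) - Polynomial.X with hp
  have hp0 : p ≠ 0 := FiniteField.X_pow_card_sub_X_ne_zero _ hn'
  have hd : p.natDegree = Nat.card (baseResidueField K) ^ n :=
    FiniteField.X_pow_card_sub_X_natDegree_eq _ hn'
  rw [← hd]
  have hs : (k : Set (extResidueField K S)) ⊆ (p.roots.toFinset : Set (extResidueField K S)) := by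
    intro y hy
    rw [Finset.mem_coe, Multiset.mem_toFinset, Polynomial.mem_roots hp0, Polynomial.IsRoot, hp]
    have := h y hy
    rw [residueFrob_pow_apply] at this
    simp [this]
  calc Nat.card k = (k : Set (extResidueField K S)).ncard := rfl
    _ ≤ p.roots.toFinset.card := by
      rw [← Set.ncard_coe_finset]; exact Set.ncard_le_ncard hs
    _ ≤ p.roots.card := Multiset.toFinset_card_le _
    _ ≤ _ := p.card_roots'

variable (K S) in
/-- The subfield of the residue field fixed by the `m`-th power of Frobenius. -/
def frobFixed (m : ℕ) : IntermediateField (baseResidueField K) (extResidueField K S) :=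
  IntermediateField.fixedField (Subgroup.zpowers (residueFrob K S ^ m))

theorem mem_frobFixed {m : ℕ} {y : extResidueField K S} :
    y ∈ frobFixed K S m ↔ (residueFrob K S ^ m) y = y := by
  constructor
  · intro h
    exact h ⟨_, Subgroup.mem_zpowers _⟩
  · rintro h ⟨t, ht⟩
    have h2 : Subgroup.zpowers (residueFrob K S ^ m) ≤
        MulAction.stabilizer Gal(extResidueField K S/baseResidueField K) y := by
      rw [Subgroup.zpowers_le]
      exact h
    exact h2 ht

/-- The exponent `q ^ m - 1` equals `-1` in the residue field, so it is nonzero there and therefore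
nonzero in `S`. A separably closed `S` thus contains a primitive root of unity of this order. It is
integral, and the factorization over its powers reduces to the residue field. -/
theorem splits_X_pow_sub_one [IsSepClosed S] {m : ℕ} (hm : 0 < m) :
    (Polynomial.X ^ (Nat.card (baseResidueField K) ^ m - 1) - 1 :
      Polynomial (extResidueField K S)).Splits := by
  set M := Nat.card (baseResidueField K) ^ m - 1 with hM
  have h1 : 1 < Nat.card (baseResidueField K) ^ m :=
    Nat.one_lt_pow hm.ne' one_lt_card_baseResidueField
  have hM0 : 0 < M := by omega
  have hMres : (M : extResidueField K S) ≠ 0 := by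
    intro h
    have h2 : ((M + 1 : ℕ) : extResidueField K S) = 0 := by
      rw [hM, Nat.sub_add_cancel h1.le, Nat.cast_pow, natCast_card_baseResidueField, zero_pow hm.ne']
    rw [Nat.cast_add, h, Nat.cast_one, zero_add] at h2
    exact one_ne_zero h2
  have hMS : (M : S) ≠ 0 := by
    intro h
    apply hMres
    have : (M : ringOfInt K S) = 0 := Subtype.ext (by simpa using h)
    rw [← map_natCast (toResidue (K := K) (S := S)), this, map_zero]
  have : NeZero (M : S) := ⟨hMS⟩
  have : NeZero M := ⟨hM0.ne'⟩
  obtain ⟨ζ, hζ⟩ := HasEnoughRootsOfUnity.exists_primitiveRoot S M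
  have hint : IsIntegral 𝒪[K] ζ := IsIntegral.of_pow hM0 (by rw [hζ.pow_eq_one]; exact isIntegral_one)
  have hζ' : IsPrimitiveRoot (⟨ζ, hint⟩ : ringOfInt K S) M :=
    IsPrimitiveRoot.of_map_of_injective (f := (ringOfInt K S).val) hζ Subtype.val_injective
  have h2 := congrArg (Polynomial.map (toResidue (K := K) (S := S))) (Polynomial.X_pow_sub_one_eq_prod hM0 hζ')
  rw [Polynomial.map_sub, Polynomial.map_pow, Polynomial.map_X, Polynomial.map_one,
    Polynomial.map_prod] at h2
  rw [h2]
  apply Polynomial.Splits.prod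
  intro x _
  rw [Polynomial.map_sub, Polynomial.map_X, Polynomial.map_C]
  exact Polynomial.Splits.X_sub_C _

/-- The fixed elements are the roots of `X ^ (q ^ m) - X`, which is separable and splits by
`splits_X_pow_sub_one`. -/
theorem natCard_frobFixed [IsSepClosed S] {m : ℕ} (hm : 0 < m) :
    Nat.card (frobFixed K S m) = Nat.card (baseResidueField K) ^ m := by
  have h1 : 1 < Nat.card (baseResidueField K) ^ m :=
    Nat.one_lt_pow hm.ne' one_lt_card_baseResidueField
  set p : Polynomial (extResidueField K S) :=
    Polynomial.X ^ (Nat.card (baseResidueField K) ^ m) - Polynomial.X with hp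
  have hp0 : p ≠ 0 := FiniteField.X_pow_card_sub_X_ne_zero _ h1
  have hd : p.natDegree = Nat.card (baseResidueField K) ^ m :=
    FiniteField.X_pow_card_sub_X_natDegree_eq _ h1
  have hfac : p = Polynomial.X * (Polynomial.X ^ (Nat.card (baseResidueField K) ^ m - 1) - 1) := by
    rw [mul_sub, mul_one, ← pow_succ', Nat.sub_add_cancel h1.le]
  have hs : p.Splits := by
    rw [hfac]
    exact Polynomial.Splits.X.mul (splits_X_pow_sub_one hm)
  obtain ⟨c, hc⟩ := CharP.exists (extResidueField K S)
  have hsep : p.Separable := by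
    refine galois_poly_separable c _ ?_
    rw [← CharP.cast_eq_zero_iff (extResidueField K S) c, Nat.cast_pow,
      natCast_card_baseResidueField, zero_pow hm.ne']
  have := Polynomial.card_rootSet_eq_natDegree (K := extResidueField K S) hsep
    (by simpa using hs)
  rw [← hd, ← this, ← Nat.card_eq_fintype_card]
  refine Nat.card_congr (Equiv.subtypeEquivRight fun y => ?_)
  rw [mem_frobFixed, residueFrob_pow_apply, Polynomial.mem_rootSet]
  simp only [ne_eq, hp0, not_false_eq_true, true_and]
  simp [hp, sub_eq_zero]

theorem finrank_frobFixed [IsSepClosed S] {m : ℕ} (hm : 0 < m) :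
    Module.finrank (baseResidueField K) (frobFixed K S m) = m := by
  have hc := natCard_frobFixed (K := K) (S := S) hm
  have hq := one_lt_card_baseResidueField (K := K)
  have : Finite (frobFixed K S m) := Nat.finite_of_card_ne_zero (by rw [hc]; positivity)
  have : Module.Finite (baseResidueField K) (frobFixed K S m) := Module.Finite.of_finite
  rw [card_intermediateField] at hc
  exact Nat.pow_right_injective hq hc

/-- If the `n`-th power of Frobenius were trivial with `n > 0`, the fixed field of the power `n +
1`, of degree `n + 1`, would be fixed by Frobenius itself and so have degree at most 1. This is what
makes the degree of a Weil group element well defined. -/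
theorem residueFrob_pow_injective [IsSepClosed S] :
    Function.Injective fun n : ℤ => residueFrob K S ^ n := by
  rw [injective_zpow_iff_not_isOfFinOrder, isOfFinOrder_iff_pow_eq_one]
  rintro ⟨n, hn, h⟩
  have h2 : frobFixed K S (n + 1) ≤ frobFixed K S 1 := by
    intro y hy
    rw [mem_frobFixed] at hy ⊢
    rwa [pow_succ, h, one_mul, ← pow_one (residueFrob K S)] at hy
  have h3 : _ = n + 1 := finrank_frobFixed (K := K) (S := S) n.succ_pos
  have : Module.Finite (baseResidueField K) (frobFixed K S (n + 1)) := by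
    exact Module.finite_of_finrank_pos (n.succ_pos.trans_eq h3.symm)
  have := finrank_le_of_residueFrob_pow (frobFixed K S (n + 1)) one_pos
    fun y hy => mem_frobFixed.1 (h2 hy)
  exact hn.ne' (by omega)

end Residue

end

noncomputable section

/-! ### Maximal unramified extensions and fields with a prescribed inertia group -/

section Local

variable {K : Type*} [Field K] [ValuativeRel K] [TopologicalSpace K]
  [IsNonarchimedeanLocalField K] {S : Type*} [Field S] [Algebra K S] [IsGalois K S]

instance finite_residueSubfield (L : IntermediateField K S) [FiniteDimensional K L] :
    Module.Finite (baseResidueField K) (residueSubfield L) :=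
  Module.finite_of_finrank_pos (by rw [finrank_residueSubfield]; exact resDeg_pos K L)

theorem residueAction_residueMap (F : IntermediateField K S) [IsGalois K F] (σ : Gal(S/K))
    (z : extResidueField K F) :
    residueAction K S σ (residueMap F z) =
      residueMap F (residueAction K F (AlgEquiv.restrictNormalHom F σ) z) := by
  obtain ⟨x, rfl⟩ := toResidue_surjective z
  rw [residueAction_toResidue, residueMap_toResidue, residueMap_toResidue, residueAction_toResidue]
  congr 1
  exact Subtype.ext (AlgEquiv.restrictNormalHom_apply F σ (x : F)).symm

/-- The inertia group surjects onto the inertia group of a Galois subextension. -/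
theorem map_restrictNormalHom_inertia (F : IntermediateField K S) [IsGalois K F] :
    (inertia K S).map (AlgEquiv.restrictNormalHom F) = inertia K F := by
  apply le_antisymm
  · rintro _ ⟨σ, hσ, rfl⟩
    rw [SetLike.mem_coe, mem_inertia_iff] at hσ
    rw [mem_inertia_iff]
    ext z
    apply (residueMap F).injective
    change residueMap F _ = residueMap F z
    rw [← residueAction_residueMap, hσ]
    rfl
  · intro g hg
    obtain ⟨σ, rfl⟩ := AlgEquiv.restrictNormalHom_surjective (F := K) (K₁ := F) S g
    rw [mem_inertia_iff] at hg
    have h : σ ∈ residueFixing (residueSubfield F) := by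
      rw [mem_residueFixing]
      rintro _ ⟨z, rfl⟩
      change residueAction K S σ (residueMap F z) = residueMap F z
      rw [residueAction_residueMap, hg]
      rfl
    obtain ⟨u, hu, k, hk, rfl⟩ := exists_mul_of_mem_residueFixing h
    refine ⟨u, hu, ?_⟩
    rw [← F.restrictNormalHom_ker, MonoidHom.mem_ker] at hk
    rw [map_mul, hk, mul_one]

theorem natCard_inertia (F : IntermediateField K S) [FiniteDimensional K F] [IsGalois K F] :
    Nat.card (inertia K F) = ramDeg K F := by
  rw [← map_restrictNormalHom_inertia, ← Subgroup.relIndex_ker, F.restrictNormalHom_ker,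
    relIndex_fixingSubgroup_inertia]

/-- The ramification degrees are the indices in `I` of the inertia groups `I ∩ Gal(S/L) ≤ I ∩
Gal(S/F)`, so they agree exactly when these two groups coincide. -/
theorem ramDeg_eq_iff {F L : IntermediateField K S} [FiniteDimensional K L] (h : F ≤ L) :
    ramDeg K L = ramDeg K F ↔ inertia K S ⊓ F.fixingSubgroup ≤ L.fixingSubgroup := by
  have : FiniteDimensional K F :=
    Module.Finite.of_injective (IntermediateField.inclusion h).toLinearMap
      (IntermediateField.inclusion h).injective
  have h1 := Subgroup.relIndex_mul_relIndex (L.fixingSubgroup ⊓ inertia K S)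
    (F.fixingSubgroup ⊓ inertia K S) (inertia K S)
    (inf_le_inf_right _ (IntermediateField.fixingSubgroup_le h)) inf_le_right
  rw [Subgroup.inf_relIndex_right, Subgroup.inf_relIndex_right, relIndex_fixingSubgroup_inertia,
    relIndex_fixingSubgroup_inertia] at h1
  rw [← h1, Nat.mul_eq_right (ramDeg_pos K F).ne', Subgroup.relIndex_eq_one, le_inf_iff,
    inf_comm (inertia K S)]
  exact and_iff_left inf_le_right

/-- The group is an intersection of stabilizers of residue classes, each of which is open because it
contains the stabilizer of a lift. -/
theorem isClosed_residueFixing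
    (k : IntermediateField (baseResidueField K) (extResidueField K S)) :
    IsClosed (residueFixing (S := S) k : Set Gal(S/K)) := by
  have h : (residueFixing (S := S) k : Set Gal(S/K)) = ⋂ y ∈ k,
      (((MulAction.stabilizer Gal(extResidueField K S/baseResidueField K) y).comap
        (residueAction K S) : Subgroup Gal(S/K)) : Set Gal(S/K)) := by
    ext σ
    rw [Set.mem_iInter₂, SetLike.mem_coe, mem_residueFixing]
    rfl
  rw [h]
  refine isClosed_biInter fun y _ => Subgroup.isClosed_of_isOpen _ ?_
  obtain ⟨x, rfl⟩ := toResidue_surjective y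
  refine Subgroup.isOpen_mono ?_ (isOpen_stabilizer_ringOfInt x)
  intro σ hσ
  change residueAction K S σ (toResidue x) = toResidue x
  rw [residueAction_toResidue]
  exact congrArg _ hσ

theorem inertia_eq_residueFixing_top : inertia K S = residueFixing ⊤ := by
  ext σ
  rw [mem_inertia_iff, mem_residueFixing, AlgEquiv.ext_iff]
  simp

theorem isClosed_inertia : IsClosed (inertia K S : Set Gal(S/K)) := by
  rw [inertia_eq_residueFixing_top]
  exact isClosed_residueFixing _

/-- The group `Gal(S/F^nr)` of the maximal unramified extension is the inertia group of `F`. -/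
theorem fixingSubgroup_fixedField_inertia_inf (F : IntermediateField K S) :
    (IntermediateField.fixedField (inertia K S ⊓ F.fixingSubgroup)).fixingSubgroup =
      inertia K S ⊓ F.fixingSubgroup :=
  InfiniteGalois.fixingSubgroup_fixedField
    ⟨inertia K S ⊓ F.fixingSubgroup, isClosed_inertia.inter (InfiniteGalois.fixingSubgroup_isClosed F)⟩

/-- If `x` is fixed by the inertia group of `F`, then so is the finite extension `F(x)`, which is
therefore unramified over `F` by `ramDeg_eq_iff`. -/
theorem sSup_unramified_eq_fixedField (F : IntermediateField K S) [FiniteDimensional K F] :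
    sSup {L : IntermediateField K S | F ≤ L ∧ FiniteDimensional K L ∧ ramDeg K L = ramDeg K F} =
      IntermediateField.fixedField (inertia K S ⊓ F.fixingSubgroup) := by
  apply le_antisymm
  · refine sSup_le ?_
    rintro L ⟨hFL, hL, h⟩
    rw [IntermediateField.le_iff_le]
    exact (ramDeg_eq_iff hFL).1 h
  · intro x hx
    have hxa : IsIntegral K x := Algebra.IsIntegral.isIntegral x
    have : FiniteDimensional K (IntermediateField.adjoin K {x}) :=
      IntermediateField.adjoin.finiteDimensional hxa
    have hL : F ⊔ IntermediateField.adjoin K {x} ≤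
        IntermediateField.fixedField (inertia K S ⊓ F.fixingSubgroup) := by
      refine sup_le ?_ ?_
      · rw [IntermediateField.le_iff_le]
        exact inf_le_right
      · rw [IntermediateField.adjoin_simple_le_iff]
        exact hx
    rw [IntermediateField.le_iff_le] at hL
    have hm : F ⊔ IntermediateField.adjoin K {x} ∈
        {L : IntermediateField K S | F ≤ L ∧ FiniteDimensional K L ∧ ramDeg K L = ramDeg K F} :=
      ⟨le_sup_left, inferInstance, (ramDeg_eq_iff le_sup_left).2 hL⟩
    exact le_sSup hm (le_sup_right (a := F) (IntermediateField.mem_adjoin_simple_self K x))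

/-- The finite extensions inside `F^nr` of ramification degree `e(F/K)` are those with the same
inertia group as `F`. -/
theorem le_fixedField_and_ramDeg_eq_iff (F L : IntermediateField K S) [FiniteDimensional K F]
    [FiniteDimensional K L] :
    (L ≤ IntermediateField.fixedField (inertia K S ⊓ F.fixingSubgroup) ∧
      ramDeg K L = ramDeg K F) ↔
    inertia K S ⊓ L.fixingSubgroup = inertia K S ⊓ F.fixingSubgroup := by
  have hF : (inertia K S ⊓ F.fixingSubgroup).relIndex (inertia K S) = ramDeg K F := by
    rw [inf_comm, Subgroup.inf_relIndex_right, relIndex_fixingSubgroup_inertia]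
  have hL : (inertia K S ⊓ L.fixingSubgroup).relIndex (inertia K S) = ramDeg K L := by
    rw [inf_comm, Subgroup.inf_relIndex_right, relIndex_fixingSubgroup_inertia]
  rw [IntermediateField.le_iff_le]
  constructor
  · rintro ⟨h, he⟩
    have h2 : inertia K S ⊓ F.fixingSubgroup ≤ inertia K S ⊓ L.fixingSubgroup :=
      le_inf inf_le_left h
    have h1 := Subgroup.relIndex_mul_relIndex _ _ (inertia K S) h2 inf_le_left
    rw [hF, hL, he, Nat.mul_eq_right (ramDeg_pos K F).ne', Subgroup.relIndex_eq_one] at h1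
    exact le_antisymm h1 h2
  · intro h
    exact ⟨h ▸ inf_le_right, by rw [← hF, ← hL, h]⟩

/-- The compositum of `L` and `L'` has the same inertia group, hence the same ramification degree.
Its residue field is fixed by `g`, that is by the `n`-th power of Frobenius, so its residue degree
is at most `n`. Its degree over `K` thus does not exceed that of `L` or of `L'`. -/
theorem eq_of_mem_fixingSubgroup {F L L' : IntermediateField K S}
    [FiniteDimensional K L] [FiniteDimensional K L'] {n : ℕ} (hn : 0 < n)
    (hL : inertia K S ⊓ L.fixingSubgroup = inertia K S ⊓ F.fixingSubgroup)
    (hL' : inertia K S ⊓ L'.fixingSubgroup = inertia K S ⊓ F.fixingSubgroup)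
    (hn1 : resDeg K L = n) (hn2 : resDeg K L' = n)
    {g : Gal(S/K)} (hg : residueAction K S g = residueFrob K S ^ n)
    (hgL : g ∈ L.fixingSubgroup) (hgL' : g ∈ L'.fixingSubgroup) : L = L' := by
  have hsup : (L ⊔ L').fixingSubgroup = L.fixingSubgroup ⊓ L'.fixingSubgroup :=
    IntermediateField.fixingSubgroup_sup
  have hi : inertia K S ⊓ (L ⊔ L').fixingSubgroup = inertia K S ⊓ F.fixingSubgroup := by
    rw [hsup, inf_inf_distrib_left, hL, hL', inf_idem]
  have hram (M : IntermediateField K S) [FiniteDimensional K M]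
      (hM : inertia K S ⊓ M.fixingSubgroup = inertia K S ⊓ F.fixingSubgroup) :
      ramDeg K M = F.fixingSubgroup.relIndex (inertia K S) := by
    rw [← relIndex_fixingSubgroup_inertia, ← Subgroup.inf_relIndex_left, hM,
      Subgroup.inf_relIndex_left]
  have hf : resDeg K (L ⊔ L' : IntermediateField K S) ≤ n := by
    rw [← finrank_residueSubfield]
    refine finrank_le_of_residueFrob_pow _ hn fun y hy => ?_
    obtain ⟨x, hx, rfl⟩ := mem_residueSubfield.1 hy
    rw [← hg, residueAction_toResidue, smul_eq_self_of_mem_fixingSubgroup _ hx]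
    rw [hsup]
    exact ⟨hgL, hgL'⟩
  have hle (M : IntermediateField K S) [FiniteDimensional K M]
      (hM : inertia K S ⊓ M.fixingSubgroup = inertia K S ⊓ F.fixingSubgroup)
      (hn : resDeg K M = n) (h : M ≤ L ⊔ L') : M = L ⊔ L' := by
    refine IntermediateField.eq_of_le_of_finrank_le h ?_
    rw [← ramDeg_mul_resDeg, ← ramDeg_mul_resDeg K M, hram _ hi, hram _ hM, hn]
    exact Nat.mul_le_mul_left _ hf
  exact (hle L hL hn1 le_sup_left).trans (hle L' hL' hn2 le_sup_right).symm

/-- On the subfield of degree `n * j` the `n`-th power of Frobenius has order `j`: if the remainder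
`r` of `a` modulo `j` were nonzero, the power `n * r` would fix a field of degree `n * j > n * r`.
-/
theorem dvd_of_residueFrob_zpow [IsSepClosed S] {n j : ℕ} (hn : 0 < n) (hj : 0 < j) {a : ℤ}
    (h : ∀ y ∈ frobFixed K S (n * j), ((residueFrob K S ^ n) ^ a) y = y) : (j : ℤ) ∣ a := by
  by_contra hd
  set r := (a % j).toNat with hr
  have hr0 : 0 < a % j := (Int.emod_nonneg _ (by positivity)).lt_of_ne'
    fun h0 => hd (Int.dvd_of_emod_eq_zero h0)
  have hrj : a % j < j := Int.emod_lt_of_pos _ (by positivity)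
  have hr' : (r : ℤ) = a % j := Int.toNat_of_nonneg hr0.le
  have hfr := finrank_frobFixed (K := K) (S := S) (m := n * j) (by positivity)
  have : Module.Finite (baseResidueField K) (frobFixed K S (n * j)) :=
    Module.finite_of_finrank_pos (by rw [hfr]; positivity)
  have hle := finrank_le_of_residueFrob_pow (frobFixed K S (n * j)) (n := n * r)
    (Nat.mul_pos hn (by omega)) fun y hy => by
      have hmem : ∀ b : ℤ, ((residueFrob K S ^ (n * j)) ^ b) y = y := fun b => by
        have h2 : Subgroup.zpowers (residueFrob K S ^ (n * j)) ≤
            MulAction.stabilizer Gal(extResidueField K S/baseResidueField K) y := by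
          rw [Subgroup.zpowers_le]
          exact mem_frobFixed.1 hy
        exact h2 ⟨b, rfl⟩
      have h3 : residueFrob K S ^ (n * r) =
          ((residueFrob K S ^ n) ^ a) * (residueFrob K S ^ (n * j)) ^ (-(a / j)) := by
        rw [← zpow_natCast, ← zpow_natCast, ← zpow_natCast, ← zpow_mul, ← zpow_mul, ← zpow_add]
        congr 1
        push_cast
        rw [hr', Int.emod_def]
        ring
      rw [h3, AlgEquiv.mul_apply, hmem, h y hy]
  rw [hfr] at hle
  have := Nat.le_of_mul_le_mul_left hle hn
  omega

/-- Every lift of the `n`-th power of Frobenius lies in the Galois group of a finite extension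
with the same inertia group as `F` and residue degree `n`. -/
theorem exists_mem_fixingSubgroup [IsSepClosed S] (F : IntermediateField K S)
    [FiniteDimensional K F] [IsGalois K F] {n : ℕ} (hn : 0 < n) {g : Gal(S/K)}
    (hg : residueAction K S g = residueFrob K S ^ n) :
    ∃ L : IntermediateField K S, FiniteDimensional K L ∧
      inertia K S ⊓ L.fixingSubgroup = inertia K S ⊓ F.fixingSubgroup ∧
      resDeg K L = n ∧ g ∈ L.fixingSubgroup := by
  -- With this `j`, the power `g ^ j` lies in `Gal(S/F)`.
  set j := Nat.card Gal(F/K) with hj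
  have hj0 : 0 < j := Nat.card_pos
  have : F.fixingSubgroup.Normal := by rw [← F.restrictNormalHom_ker]; infer_instance
  let k := frobFixed K S (n * j)
  have hkfr : Module.finrank (baseResidueField K) k = n * j := finrank_frobFixed (by positivity)
  have : (residueFixing (S := S) k).Normal := by
    constructor
    intro σ hσ τ
    rw [mem_residueFixing] at hσ ⊢
    intro y hy
    rw [map_mul, map_mul, map_inv, AlgEquiv.mul_apply, AlgEquiv.mul_apply, hσ]
    · rw [← AlgEquiv.mul_apply, mul_inv_cancel, AlgEquiv.one_apply]
    · rw [mem_frobFixed, residueFrob_pow_apply] at hy ⊢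
      rw [← map_pow, hy]
  have hUopen : IsOpen ((F.fixingSubgroup ⊓ residueFixing k : Subgroup Gal(S/K)) : Set Gal(S/K)) := by
    have : (residueFixing (S := S) k).FiniteIndex :=
      ⟨by rw [index_residueFixing, hkfr]; positivity⟩
    exact (IntermediateField.fixingSubgroup_isOpen F).inter
      (Subgroup.isOpen_of_isClosed_of_finiteIndex _ (isClosed_residueFixing k))
  -- `L` is the fixed field of `P`. The second factor makes `P` open. Requiring it to fix the
  -- residue subfield `k` of degree `n * j` forces `j ∣ a` whenever `g ^ a * u` is inertial, and
  -- then `g ^ a` lies in `Gal(S/F)`.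
  set P := Subgroup.zpowers g ⊔ (F.fixingSubgroup ⊓ residueFixing k) with hP
  have hPopen : IsOpen (P : Set Gal(S/K)) := Subgroup.isOpen_mono le_sup_right hUopen
  let L := IntermediateField.fixedField P
  have hL : L.fixingSubgroup = P :=
    InfiniteGalois.fixingSubgroup_fixedField ⟨P, Subgroup.isClosed_of_isOpen _ hPopen⟩
  have hgL : g ∈ L.fixingSubgroup := by
    rw [hL]; exact Subgroup.mem_sup_left (Subgroup.mem_zpowers g)
  have hfd : FiniteDimensional K L := by
    rw [← InfiniteGalois.isOpen_iff_finite, hL]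
    exact hPopen
  refine ⟨L, hfd, ?_, ?_, hgL⟩
  · rw [hL]
    apply le_antisymm
    · rintro x ⟨hxI, hxP⟩
      refine ⟨hxI, ?_⟩
      obtain ⟨y, ⟨a, rfl⟩, u, hu, rfl⟩ := Subgroup.mem_sup_of_normal_right.1 hxP
      have hga : g ^ a ∈ residueFixing k :=
        (Subgroup.mul_mem_cancel_right _ hu.2).1 (inertia_le_residueFixing k hxI)
      have hd : (j : ℤ) ∣ a := by
        refine dvd_of_residueFrob_zpow (K := K) (S := S) hn hj0 fun y hy => ?_
        rw [← hg, ← map_zpow]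
        exact mem_residueFixing.1 hga y hy
      obtain ⟨b, rfl⟩ := hd
      refine F.fixingSubgroup.mul_mem ?_ hu.1
      change g ^ ((j : ℤ) * b) ∈ _
      rw [zpow_mul]
      refine F.fixingSubgroup.zpow_mem ?_ b
      rw [← F.restrictNormalHom_ker, MonoidHom.mem_ker, map_zpow, zpow_natCast, hj,
        pow_card_eq_one']
    · refine le_inf inf_le_left (le_trans ?_ le_sup_right)
      exact le_inf inf_le_right (inf_le_left.trans (inertia_le_residueFixing k))
  · apply le_antisymm
    · rw [← finrank_residueSubfield]
      refine finrank_le_of_residueFrob_pow _ hn fun y hy => ?_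
      obtain ⟨x, hx, rfl⟩ := mem_residueSubfield.1 hy
      rw [← hg, residueAction_toResidue, smul_eq_self_of_mem_fixingSubgroup hgL hx]
    -- Both factors of `P`, and inertia, fix the residue subfield of degree `n`, so `n` divides the
    -- index of `I · P`, which is the residue degree.
    · refine Nat.le_of_dvd (resDeg_pos K L) ?_
      rw [← index_inertia_sup_fixingSubgroup L]
      have h1 := finrank_frobFixed (K := K) (S := S) hn
      rw [← index_residueFixing] at h1
      conv_lhs => rw [← h1]
      apply Subgroup.index_dvd_of_le
      rw [hL]
      refine sup_le (inertia_le_residueFixing _) (sup_le ?_ ?_)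
      · rw [Subgroup.zpowers_le, mem_residueFixing]
        intro y hy
        rw [hg]
        exact mem_frobFixed.1 hy
      · intro x hx
        rw [mem_residueFixing]
        intro y hy
        refine mem_residueFixing.1 hx.2 y ?_
        rw [mem_frobFixed] at hy ⊢
        rw [pow_mul]
        have h2 : Subgroup.zpowers (residueFrob K S ^ n) ≤
            MulAction.stabilizer Gal(extResidueField K S/baseResidueField K) y := by
          rw [Subgroup.zpowers_le]
          exact hy
        exact h2 (Subgroup.npow_mem_zpowers _ j)

end Local

end

noncomputable section

theorem exists_frobenius_pow_eq {k l : Type*} [Field k] [Fintype k] [Field l] [Algebra k l]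
    [Module.Finite k l] (t : Gal(l/k)) :
    ∃ i : ℕ, FiniteField.frobeniusAlgEquivOfAlgebraic k l ^ i = t := by
  have : Finite l := Module.finite_of_finite k
  obtain ⟨⟨i, _⟩, hi⟩ := (FiniteField.bijective_frobeniusAlgEquivOfAlgebraic_pow k l).2 t
  exact ⟨i, hi⟩

/-! ### Powers of Frobenius as residue actions -/

section Generic

variable {K : Type*} [Field K] [ValuativeRel K] [TopologicalSpace K]
  [IsNonarchimedeanLocalField K] {S : Type*} [Field S] [Algebra K S] [Algebra.IsAlgebraic K S]

theorem residueAction_eq_zpow_iff (σ : Gal(S/K)) (a b : ℕ) :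
    (∀ x : ringOfInt K S, (σ • x) ^ Nat.card 𝓀[K] ^ a - x ^ Nat.card 𝓀[K] ^ b ∈ maxIdeal K S) ↔
      residueAction K S σ = residueFrob K S ^ ((b : ℤ) - a) := by
  rw [zpow_sub, zpow_natCast, zpow_natCast, ← (Commute.pow_pow_self (residueFrob K S) a b).inv_left.eq,
    eq_inv_mul_iff_mul_eq, AlgEquiv.ext_iff, toResidue_surjective.forall]
  refine forall_congr' fun x => ?_
  rw [← toResidue_eq_iff, map_pow, map_pow, AlgEquiv.mul_apply, residueAction_toResidue,
    residueFrob_pow_apply, residueFrob_pow_apply]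
  rfl

theorem residueAction_eq_pow_iff (σ : Gal(S/K)) (n : ℕ) :
    (∀ x : ringOfInt K S, σ • x - x ^ Nat.card 𝓀[K] ^ n ∈ maxIdeal K S) ↔
      residueAction K S σ = residueFrob K S ^ n := by
  have := residueAction_eq_zpow_iff σ 0 n
  simpa using this

variable [IsGalois K S]

/-- Every automorphism of a finite Galois extension lifts to one acting on the residue field as a
power of Frobenius. -/
theorem exists_restrictNormalHom_eq_and_residueAction_eq (F : IntermediateField K S)
    [FiniteDimensional K F] [IsGalois K F] (g : Gal(F/K)) :
    ∃ (σ : Gal(S/K)) (n : ℕ), AlgEquiv.restrictNormalHom F σ = g ∧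
      residueAction K S σ = residueFrob K S ^ n := by
  obtain ⟨σ, rfl⟩ := AlgEquiv.restrictNormalHom_surjective (F := K) (K₁ := F) S g
  let _ := Fintype.ofFinite (baseResidueField K)
  have : Module.Finite (baseResidueField K) (extResidueField K F) :=
    let e : residueSubfield F ≃ₐ[(baseResidueField K)] extResidueField K F :=
      (AlgEquiv.ofInjectiveField (residueMap F)).symm
    Module.Finite.equiv e.toLinearEquiv
  obtain ⟨i, hi⟩ := exists_frobenius_pow_eq (residueAction K F (AlgEquiv.restrictNormalHom F σ))
  -- On the residue field of `F`, `σ` already acts as the `i`-th power of Frobenius. The discrepancy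
  -- on the residue field of `S` can therefore be corrected inside `Gal(S/F)`, which leaves the
  -- restriction to `F` unchanged.
  obtain ⟨h, hh, ht⟩ := exists_fixingSubgroup_residueAction_eq F
    ((residueAction K S σ)⁻¹ * residueFrob K S ^ i) fun x hx => by
      obtain ⟨z, rfl⟩ := exists_ringOfIntMap_eq hx
      rw [AlgEquiv.mul_apply, ← residueMap_toResidue]
      apply (residueAction K S σ).injective
      rw [← AlgEquiv.mul_apply (residueAction K S σ), mul_inv_cancel, AlgEquiv.one_apply,
        residueAction_residueMap, ← hi]
      change _ = residueMap F ((residueFrob K F ^ i) _)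
      rw [residueFrob_pow_apply, residueFrob_pow_apply, map_pow]
  refine ⟨σ * h, i, ?_, ?_⟩
  · rw [← F.restrictNormalHom_ker, MonoidHom.mem_ker] at hh
    rw [map_mul, hh, mul_one]
  · rw [map_mul, ht, mul_inv_cancel_left]

theorem resDeg_bot : resDeg K (⊥ : IntermediateField K S) = 1 := by
  have h := ramDeg_mul_resDeg K (⊥ : IntermediateField K S)
  rw [IntermediateField.finrank_bot] at h
  exact Nat.eq_one_of_mul_eq_one_left h

end Generic

/-! ### The Weil group: degree map, restriction, Frobenius elements -/

section Weil

variable {K : Type*} [Field K] [ValuativeRel K] [TopologicalSpace K]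
  [IsNonarchimedeanLocalField K]

theorem mem_weilGroup_iff {σ : Gal(SeparableClosure K/K)} :
    σ ∈ weilGroup K ↔ ∃ n : ℤ, residueAction K (SeparableClosure K) σ =
      residueFrob K (SeparableClosure K) ^ n := by
  constructor
  · rintro ⟨a, b, h⟩
    exact ⟨_, (residueAction_eq_zpow_iff σ a b).1 h⟩
  · rintro ⟨n, h⟩
    obtain ⟨b, a, rfl⟩ : ∃ b a : ℕ, n = b - a :=
      ⟨n.toNat, (-n).toNat, by omega⟩
    exact ⟨a, b, (residueAction_eq_zpow_iff σ a b).2 h⟩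

variable (K) in
/-- The degree map of the Weil group: `w` acts on the residue field of `K^s` as the power of
Frobenius with exponent `weilVal K w`. -/
def weilVal : weilGroup K →* Multiplicative ℤ :=
  MonoidHom.mk' (fun w => Multiplicative.ofAdd (mem_weilGroup_iff.1 w.2).choose) fun w w' => by
    rw [← ofAdd_add]
    congr 1
    apply residueFrob_pow_injective (K := K) (S := SeparableClosure K)
    change _ ^ _ = _ ^ (_ + _)
    rw [zpow_add, ← (mem_weilGroup_iff.1 w.2).choose_spec, ← (mem_weilGroup_iff.1 w'.2).choose_spec,
      ← map_mul, ← (mem_weilGroup_iff.1 (w * w').2).choose_spec]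
    rfl

theorem weilVal_eq_iff {w : weilGroup K} {n : ℤ} : weilVal K w = Multiplicative.ofAdd n ↔
    residueAction K (SeparableClosure K) w = residueFrob K (SeparableClosure K) ^ n := by
  rw [(mem_weilGroup_iff.1 w.2).choose_spec]
  exact (Multiplicative.ofAdd.injective.eq_iff).trans
    (residueFrob_pow_injective (K := K) (S := SeparableClosure K)).eq_iff.symm

theorem weilVal_eq_one_iff {w : weilGroup K} :
    weilVal K w = 1 ↔ (w : Gal(SeparableClosure K/K)) ∈ inertia K (SeparableClosure K) := by
  rw [mem_inertia_iff, ← ofAdd_zero, weilVal_eq_iff, zpow_zero]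

theorem weilVal_of_isFrob {L : IntermediateField K (SeparableClosure K)} [FiniteDimensional K L]
    {w : weilGroup K} (h : IsFrob L w) :
    weilVal K w = Multiplicative.ofAdd (resDeg K L : ℤ) := by
  rw [weilVal_eq_iff, zpow_natCast, ← residueAction_eq_pow_iff, ← resCard_eq]
  exact h.2

theorem weilVal_of_isFrob_bot {w : weilGroup K} (h : IsFrob ⊥ w) :
    weilVal K w = Multiplicative.ofAdd 1 := by
  rw [weilVal_of_isFrob h, resDeg_bot, Nat.cast_one]

variable (K) in
theorem exists_weilVal_eq_one : ∃ φ : weilGroup K, weilVal K φ = Multiplicative.ofAdd 1 := by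
  obtain ⟨σ, hσ⟩ := residueAction_surjective (K := K) (S := SeparableClosure K)
    (residueFrob K (SeparableClosure K) ^ (1 : ℤ))
  exact ⟨⟨σ, mem_weilGroup_iff.2 ⟨1, hσ⟩⟩, weilVal_eq_iff.2 hσ⟩

variable (F : IntermediateField K (SeparableClosure K)) [FiniteDimensional K F] [IsGalois K F]

theorem weilRestrict_surjective : Function.Surjective (weilRestrict F) := by
  intro g
  obtain ⟨σ, n, h1, h2⟩ := exists_restrictNormalHom_eq_and_residueAction_eq F g
  exact ⟨⟨σ, mem_weilGroup_iff.2 ⟨n, by rw [h2, zpow_natCast]⟩⟩, h1⟩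

theorem map_weilRestrict_ker : (weilVal K).ker.map (weilRestrict F) = inertia K F := by
  rw [← map_restrictNormalHom_inertia F]
  ext g
  constructor
  · rintro ⟨w, hw, rfl⟩
    exact ⟨w, weilVal_eq_one_iff.1 hw, rfl⟩
  · rintro ⟨σ, hσ, rfl⟩
    have hm : σ ∈ weilGroup K :=
      mem_weilGroup_iff.2 ⟨0, by rw [zpow_zero]; exact (mem_inertia_iff σ).1 hσ⟩
    exact ⟨⟨σ, hm⟩, weilVal_eq_one_iff.2 hσ, rfl⟩

theorem weilRestrict_eq_one_iff {w : weilGroup K} :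
    weilRestrict F w = 1 ↔ (w : Gal(SeparableClosure K/K)) ∈ F.fixingSubgroup := by
  rw [← F.restrictNormalHom_ker]
  rfl

/-- This turns factoring through `Gal(F^nr/K)` into the group-theoretic condition of being trivial
on `ker v ∩ ker π`. -/
theorem mem_fixingSubgroup_maxUnram_iff {w : weilGroup K} :
    (w : Gal(SeparableClosure K/K)) ∈ (maxUnram F).fixingSubgroup ↔
      weilVal K w = 1 ∧ weilRestrict F w = 1 := by
  rw [weilVal_eq_one_iff, weilRestrict_eq_one_iff, ← Subgroup.mem_inf,
    ← fixingSubgroup_fixedField_inertia_inf, ← sSup_unramified_eq_fixedField]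
  rfl

theorem mem_subextensions_iff {n : ℕ} {L : IntermediateField K (SeparableClosure K)} :
    L ∈ subextensions F n ↔ FiniteDimensional K L ∧
      inertia K (SeparableClosure K) ⊓ L.fixingSubgroup =
        inertia K (SeparableClosure K) ⊓ F.fixingSubgroup ∧ resDeg K L = n := by
  have hmax : maxUnram F = IntermediateField.fixedField
      (inertia K (SeparableClosure K) ⊓ F.fixingSubgroup) := sSup_unramified_eq_fixedField F
  rw [subextensions, Set.mem_ofPred_eq, hmax, natCard_inertia]
  constructor
  · rintro ⟨h1, h2, h3, h4⟩
    exact ⟨h2, (le_fixedField_and_ramDeg_eq_iff F L).1 ⟨h1, h3⟩, h4⟩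
  · rintro ⟨h2, h3, h4⟩
    have := (le_fixedField_and_ramDeg_eq_iff F L).2 h3
    exact ⟨this.1, h2, this.2, h4⟩

/-- The Frobenius elements of the fields in `subextensions F n` run through a coset of the inertia
group of `Gal(F/K)`. -/
theorem bijOn_subextensions {n : ℕ} (hn : 0 < n) {φ : weilGroup K}
    (hφ : weilVal K φ = Multiplicative.ofAdd 1)
    (frob : IntermediateField K (SeparableClosure K) → weilGroup K)
    (hfrob : ∀ L : IntermediateField K (SeparableClosure K), FiniteDimensional K L →
      IsFrob L (frob L)) :
    Set.BijOn (fun L => weilRestrict F ((φ ^ n)⁻¹ * frob L)) (subextensions F n)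
      (inertia K F) := by
  have hφn : weilVal K (φ ^ n) = Multiplicative.ofAdd (n : ℤ) := by
    rw [map_pow, hφ, ← ofAdd_nsmul, nsmul_one]
  refine ⟨?_, ?_, ?_⟩
  · intro L hL
    obtain ⟨hfd, -, hr⟩ := (mem_subextensions_iff F).1 hL
    rw [SetLike.mem_coe, ← map_weilRestrict_ker]
    refine ⟨_, ?_, rfl⟩
    rw [SetLike.mem_coe, MonoidHom.mem_ker, map_mul, map_inv, hφn, weilVal_of_isFrob (hfrob L hfd),
      hr, inv_mul_cancel]
  · intro L hL L' hL' heq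
    obtain ⟨hfd, hi, hr⟩ := (mem_subextensions_iff F).1 hL
    obtain ⟨hfd', hi', hr'⟩ := (mem_subextensions_iff F).1 hL'
    have h1 := weilVal_of_isFrob (hfrob L hfd)
    have h2 := weilVal_of_isFrob (hfrob L' hfd')
    have h3 : weilVal K ((frob L')⁻¹ * frob L) = 1 := by
      rw [map_mul, map_inv, h1, h2, hr, hr', inv_mul_cancel]
    have h4 : weilRestrict F ((frob L')⁻¹ * frob L) = 1 := by
      simp only [map_mul] at heq
      rw [map_mul, map_inv, mul_left_cancel heq, inv_mul_cancel]
    -- The quotient of the two Frobenius elements lies in the inertia group of `F`, which is also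
    -- that of `L'`. Hence `Frob_L` fixes `L'` as well as `L`, and the two fields coincide.
    have h5 : (((frob L')⁻¹ * frob L : weilGroup K) : Gal(SeparableClosure K/K)) ∈
        inertia K (SeparableClosure K) ⊓ L'.fixingSubgroup := by
      rw [hi']
      exact ⟨weilVal_eq_one_iff.1 h3, (weilRestrict_eq_one_iff F).1 h4⟩
    refine eq_of_mem_fixingSubgroup (g := (frob L : Gal(SeparableClosure K/K))) hn hi hi' hr hr' ?_
      (hfrob L hfd).1 ?_
    · rw [← zpow_natCast, ← weilVal_eq_iff, h1, hr]
    · have := L'.fixingSubgroup.mul_mem (hfrob L' hfd').1 h5.2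
      rwa [← Subgroup.coe_mul, mul_inv_cancel_left] at this
  · intro x hx
    rw [SetLike.mem_coe, ← map_weilRestrict_ker] at hx
    obtain ⟨u, hu, rfl⟩ := hx
    have hv : weilVal K (φ ^ n * u) = Multiplicative.ofAdd (n : ℤ) := by
      rw [map_mul, hφn, MonoidHom.mem_ker.1 hu, mul_one]
    have hres := weilVal_eq_iff.1 hv
    rw [zpow_natCast] at hres
    -- The element `φ ^ n * u` is itself a Frobenius element of this `L`. It differs from `frob L`
    -- by the inertia group of `L`, which is that of `F` and dies in `Gal(F/K)`.
    obtain ⟨L, hfd, hi, hr, hg⟩ := exists_mem_fixingSubgroup F hn hres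
    refine ⟨L, (mem_subextensions_iff F).2 ⟨hfd, hi, hr⟩, ?_⟩
    have h1 := weilVal_of_isFrob (hfrob L hfd)
    have h2 : (((φ ^ n * u)⁻¹ * frob L : weilGroup K) : Gal(SeparableClosure K/K)) ∈
        inertia K (SeparableClosure K) ⊓ L.fixingSubgroup := by
      refine ⟨weilVal_eq_one_iff.1 ?_, ?_⟩
      · rw [map_mul, map_inv, hv, h1, hr, inv_mul_cancel]
      · exact L.fixingSubgroup.mul_mem (L.fixingSubgroup.inv_mem hg) (hfrob L hfd).1
    rw [hi] at h2
    have h3 := (weilRestrict_eq_one_iff F).2 h2.2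
    rw [mul_inv_rev, mul_assoc, map_mul, map_inv, inv_mul_eq_one] at h3
    exact h3.symm

end Weil

end

noncomputable section

/-! ### Power sums determine a multiset -/

section PowerSums

/-- Newton's identities express `k * e_k` through earlier elementary symmetric functions and power
sums; `k` is invertible in characteristic zero. -/
theorem aeval_esymm_eq_of_psum_eq {N : ℕ} (x y : Fin N → ℂ)
    (h : ∀ d, 1 ≤ d → d ≤ N → ∑ i, x i ^ d = ∑ i, y i ^ d) :
    ∀ k ≤ N, MvPolynomial.aeval x (MvPolynomial.esymm (Fin N) ℂ k) =
      MvPolynomial.aeval y (MvPolynomial.esymm (Fin N) ℂ k) := by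
  intro k
  induction k using Nat.strong_induction_on with
  | _ k ih =>
    intro hk
    rcases Nat.eq_zero_or_pos k with rfl | hk0
    · simp
    have hx := congrArg (MvPolynomial.aeval x) (MvPolynomial.mul_esymm_eq_sum (Fin N) ℂ k)
    have hy := congrArg (MvPolynomial.aeval y) (MvPolynomial.mul_esymm_eq_sum (Fin N) ℂ k)
    have hxy : MvPolynomial.aeval x ((k : MvPolynomial (Fin N) ℂ) * MvPolynomial.esymm (Fin N) ℂ k) =
        MvPolynomial.aeval y ((k : MvPolynomial (Fin N) ℂ) * MvPolynomial.esymm (Fin N) ℂ k) := by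
      rw [hx, hy, map_mul, map_mul, map_sum, map_sum]
      simp only [map_pow, map_neg, map_one]
      congr 1
      refine Finset.sum_congr rfl fun a ha => ?_
      rw [Finset.mem_filter, Finset.HasAntidiagonal.mem_antidiagonal] at ha
      simp only [map_mul, map_pow, map_neg, map_one]
      rw [ih a.1 ha.2 (ha.2.le.trans hk)]
      congr 1
      simpa [MvPolynomial.psum] using h a.2 (by omega) (by omega)
    rw [map_mul, map_mul, map_natCast, map_natCast] at hxy
    exact mul_left_cancel₀ (by exact_mod_cast hk0.ne') hxy

/-- The power sums `p_1, …, p_N` of a multiset of `N` complex numbers determine it. -/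
theorem map_univ_eq_of_psum_eq {N : ℕ} (x y : Fin N → ℂ)
    (h : ∀ d, 1 ≤ d → d ≤ N → ∑ i, x i ^ d = ∑ i, y i ^ d) :
    Finset.univ.val.map x = Finset.univ.val.map y := by
  have hes : ∀ k ≤ N, (Finset.univ.val.map x).esymm k = (Finset.univ.val.map y).esymm k := by
    intro k hk
    have := aeval_esymm_eq_of_psum_eq x y h k hk
    rwa [MvPolynomial.aeval_esymm_eq_multiset_esymm, MvPolynomial.aeval_esymm_eq_multiset_esymm] at this
  have hp : ((Finset.univ.val.map x).map fun t => Polynomial.X - Polynomial.C t).prod =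
      ((Finset.univ.val.map y).map fun t => Polynomial.X - Polynomial.C t).prod := by
    rw [Multiset.prod_X_sub_X_eq_sum_esymm, Multiset.prod_X_sub_X_eq_sum_esymm]
    simp only [Multiset.card_map, Finset.card_val, Finset.card_univ, Fintype.card_fin]
    refine Finset.sum_congr rfl fun k hk => ?_
    rw [hes k (by simpa [Nat.lt_succ_iff] using hk)]
  rw [← Polynomial.roots_multiset_prod_X_sub_C (Finset.univ.val.map x), hp,
    Polynomial.roots_multiset_prod_X_sub_C]

/-- The power sums `p_1, …, p_N` of a multiset of at most `N` non-zero complex numbers determine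
it. -/
theorem multiset_eq_of_psum_eq {N : ℕ} {s t : Multiset ℂˣ} (hs : s.card ≤ N) (ht : t.card ≤ N)
    (h : ∀ d, 1 ≤ d → d ≤ N →
      (s.map fun z : ℂˣ => (z : ℂ) ^ d).sum = (t.map fun z : ℂˣ => (z : ℂ) ^ d).sum) : s = t := by
  -- Padding with zeros to exactly `N` entries does not affect the power sums with `d ≥ 1`. The
  -- zeros are filtered out again at the end, so the number of nonzero entries is recovered too.
  have key : ∀ s : Multiset ℂˣ, s.card ≤ N → ∃ x : Fin N → ℂ,
      Finset.univ.val.map x =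
        s.map (fun z : ℂˣ => (z : ℂ)) + Multiset.replicate (N - s.card) 0 := by
    intro s hs
    obtain ⟨l, hl⟩ := Quotient.exists_rep
      (s.map (fun z : ℂˣ => (z : ℂ)) + Multiset.replicate (N - s.card) (0 : ℂ))
    have hlen : l.length = N := by
      have := congrArg Multiset.card hl
      rw [Multiset.quot_mk_to_coe, Multiset.coe_card] at this
      simp [this, hs]
    subst hlen
    refine ⟨l.get, ?_⟩
    rw [← hl]
    simp
  obtain ⟨x, hx⟩ := key s hs
  obtain ⟨y, hy⟩ := key t ht
  have hsum : ∀ (s : Multiset ℂˣ) (x : Fin N → ℂ), Finset.univ.val.map x =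
        s.map (fun z : ℂˣ => (z : ℂ)) + Multiset.replicate (N - s.card) 0 → ∀ d, 1 ≤ d →
      ∑ i, x i ^ d = (s.map fun z : ℂˣ => (z : ℂ) ^ d).sum := by
    intro s x hx d hd
    have := congrArg (fun u : Multiset ℂ => (u.map fun z => z ^ d).sum) hx
    simp only [Multiset.map_map, Multiset.map_add, Multiset.sum_add, Multiset.map_replicate,
      zero_pow (show d ≠ 0 by omega), Multiset.sum_replicate, smul_zero, add_zero] at this
    exact this
  have hxy := map_univ_eq_of_psum_eq x y fun d h1 h2 => by
    rw [hsum s x hx d h1, hsum t y hy d h1, h d h1 h2]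
  rw [hx, hy] at hxy
  have hf := congrArg (Multiset.filter fun z : ℂ => z ≠ 0) hxy
  have hfil : ∀ s : Multiset ℂˣ, ∀ n, Multiset.filter (fun z : ℂ => z ≠ 0)
      (s.map (fun z : ℂˣ => (z : ℂ)) + Multiset.replicate n 0) = s.map (fun z : ℂˣ => (z : ℂ)) := by
    intro s n
    rw [Multiset.filter_add, Multiset.filter_eq_self.2, Multiset.filter_eq_nil.2, add_zero]
    · intro a ha
      simpa using Multiset.eq_of_mem_replicate ha
    · intro a ha
      obtain ⟨z, -, rfl⟩ := Multiset.mem_map.1 ha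
      exact z.ne_zero
  rw [hfil, hfil] at hf
  exact Multiset.map_injective Units.val_injective hf

/-- Equal multiplicities mean that the fibres over each value have the same cardinality; the
bijection is glued from bijections of fibres. -/
theorem exists_equiv_of_map_univ_eq {ι κ α : Type*} [Fintype ι] [Fintype κ] (f : ι → α) (g : κ → α)
    (h : Finset.univ.val.map f = Finset.univ.val.map g) : ∃ e : ι ≃ κ, ∀ i, g (e i) = f i := by
  classical
  have hc : ∀ a, Nonempty ({i // f i = a} ≃ {j // g j = a}) := by
    intro a
    rw [← Fintype.card_eq, Fintype.card_subtype, Fintype.card_subtype]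
    have := congrArg (Multiset.count a) h
    rw [Multiset.count_map, Multiset.count_map] at this
    simp only [eq_comm (a := a)] at this
    exact this
  refine ⟨(Equiv.sigmaFiberEquiv f).symm.trans
    ((Equiv.sigmaCongrRight fun a => (hc a).some).trans (Equiv.sigmaFiberEquiv g)), fun i => ?_⟩
  exact ((hc (f i)).some ⟨i, rfl⟩).2

end PowerSums

/-! ### Diagonalizable endomorphisms -/

section Diagonalizable

variable {U : Type*} [AddCommGroup U] [Module ℂ U]

/-- An endomorphism without nontrivial generalized eigenvectors. -/
def IsDiag (f : Module.End ℂ U) : Prop :=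
  ∀ (a : ℂ) (x y : U), f x = a • x + y → f y = a • y → y = 0

/-- The generalized eigenspaces span over `ℂ`, and `IsDiag` lowers the nilpotency exponent of a
generalized eigenvector step by step until it is an eigenvector. -/
theorem IsDiag.iSup_eigenspace_eq_top [FiniteDimensional ℂ U] {f : Module.End ℂ U} (hf : IsDiag f) :
    ⨆ a, f.eigenspace a = ⊤ := by
  rw [← top_le_iff, ← Module.End.iSup_maxGenEigenspace_eq_top f]
  refine iSup_mono fun a => ?_
  intro x hx
  obtain ⟨n, hn⟩ := (Module.End.mem_maxGenEigenspace f a x).1 hx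
  rw [Module.End.mem_eigenspace_iff]
  induction n generalizing x with
  | zero =>
    rw [pow_zero, Module.End.one_apply] at hn
    rw [hn, map_zero, smul_zero]
  | succ n ih =>
    rw [pow_succ, Module.End.mul_apply] at hn
    have h1 := ih ((Module.End.mem_maxGenEigenspace f a _).2 ⟨n, hn⟩) hn
    have h2 := hf a x ((f - a • 1) x) (by simp) h1
    rw [LinearMap.sub_apply, sub_eq_zero] at h2
    simpa using h2

/-- A diagonalizable invertible endomorphism has a basis of eigenvectors. -/
theorem IsDiag.exists_basis [FiniteDimensional ℂ U] {f : Module.End ℂ U} (hf : IsDiag f)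
    (hu : IsUnit f) : ∃ (n : ℕ) (b : Module.Basis (Fin n) ℂ U) (c : Fin n → ℂˣ),
      ∀ k, f (b k) = (c k : ℂ) • b k := by
  have hs : ⊤ ≤ Submodule.span ℂ {x : U | ∃ a : ℂ, f x = a • x} := by
    rw [← hf.iSup_eigenspace_eq_top, iSup_le_iff]
    intro a x hx
    exact Submodule.subset_span ⟨a, Module.End.mem_eigenspace_iff.1 hx⟩
  let b := Module.Basis.ofSpan hs
  have := Module.Finite.finite_basis b
  let _ := Fintype.ofFinite ((linearIndepOn_empty ℂ id).extend (Set.empty_subset {x : U | ∃ a : ℂ, f x = a • x}))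
  let b' := b.reindex (Fintype.equivFin _)
  have hb : ∀ k, ∃ a : ℂˣ, f (b' k) = (a : ℂ) • b' k := by
    intro k
    obtain ⟨a, ha⟩ : ∃ a : ℂ, f (b' k) = a • b' k := by
      have : b' k ∈ {x : U | ∃ a : ℂ, f x = a • x} := by
        rw [Module.Basis.reindex_apply]
        exact Module.Basis.ofSpan_subset hs ⟨_, rfl⟩
      exact this
    have ha0 : a ≠ 0 := by
      rintro rfl
      rw [zero_smul] at ha
      have hinj : Function.Injective f := ((Module.End.isUnit_iff f).1 hu).1
      exact b'.ne_zero k (hinj (by rw [ha, map_zero]))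
    exact ⟨Units.mk0 a ha0, ha⟩
  choose c hc using hb
  exact ⟨_, b', c, hc⟩

theorem roots_charpoly_of_basis {n : ℕ} [FiniteDimensional ℂ U] {f : Module.End ℂ U}
    (b : Module.Basis (Fin n) ℂ U) (c : Fin n → ℂ) (h : ∀ k, f (b k) = c k • b k) :
    f.charpoly.roots = Finset.univ.val.map c := by
  have hm : LinearMap.toMatrix b b f = Matrix.diagonal c := by
    ext i j
    rw [LinearMap.toMatrix_apply, h, map_smul, Module.Basis.repr_self, Matrix.diagonal_apply]
    by_cases hij : i = j
    · simp [hij]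
    · simp [hij]
  rw [← LinearMap.charpoly_toMatrix f b, hm, Matrix.charpoly_diagonal]
  convert! Polynomial.roots_multiset_prod_X_sub_C (Finset.univ.val.map c) using 2
  rw [Multiset.map_map]
  rfl

theorem trace_of_basis {n : ℕ} {f : Module.End ℂ U}
    (b : Module.Basis (Fin n) ℂ U) (c : Fin n → ℂ) (h : ∀ k, f (b k) = c k • b k) :
    LinearMap.trace ℂ U f = ∑ k, c k := by
  rw [LinearMap.trace_eq_matrix_trace ℂ b, Matrix.trace]
  refine Finset.sum_congr rfl fun k _ => ?_
  rw [Matrix.diag_apply, LinearMap.toMatrix_apply, h, map_smul, Module.Basis.repr_self]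
  simp

/-- An invertible endomorphism is diagonalizable if some power is. -/
theorem IsDiag.of_pow {f : Module.End ℂ U} (hu : IsUnit f) {n : ℕ} (hn : 0 < n)
    (h : IsDiag (f ^ n)) : IsDiag f := by
  intro a x y hx hy
  have hinj : Function.Injective f := ((Module.End.isUnit_iff f).1 hu).1
  by_cases ha : a = 0
  · subst ha
    rw [zero_smul] at hy
    exact hinj (by rw [hy, map_zero])
  have h1 : ∀ m : ℕ, (f ^ m) y = a ^ m • y := by
    intro m
    induction m with
    | zero => simp
    | succ m ih => rw [pow_succ', Module.End.mul_apply, ih, map_smul, hy, smul_smul, pow_succ]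
  -- A Jordan pair for `f` yields one for its power, with off-diagonal coefficient `(m + 1) * a ^
  -- m`, which is nonzero in characteristic zero.
  have h2 : ∀ m : ℕ, (f ^ (m + 1)) x = a ^ (m + 1) • x + ((m + 1 : ℕ) * a ^ m : ℂ) • y := by
    intro m
    induction m with
    | zero => simp [hx]
    | succ m ih =>
      rw [pow_succ', Module.End.mul_apply, ih, map_add, map_smul, map_smul, hx, hy]
      push_cast
      module
  obtain ⟨m, rfl⟩ := Nat.exists_eq_add_one.2 hn
  have h3 := h (a ^ (m + 1)) x _ (h2 m) (by rw [map_smul, h1, smul_comm])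
  rw [smul_eq_zero] at h3
  refine h3.resolve_left (mul_ne_zero ?_ (pow_ne_zero _ ha))
  exact_mod_cast m.succ_ne_zero

end Diagonalizable

end

noncomputable section

open Representation
open scoped TensorProduct

/-! ### Unramified twists of representations -/

section Twist

variable {W : Type*} [Group W] {V V' : Type*} [AddCommGroup V] [Module ℂ V]
  [AddCommGroup V'] [Module ℂ V']

/-- An equivariant linear equivalence is an isomorphism of representations. -/
def repEquiv {ρ : Representation ℂ W V} {ρ' : Representation ℂ W V'} (e : V ≃ₗ[ℂ] V')
    (h : ∀ g x, e (ρ g x) = ρ' g (e x)) : ρ.Equiv ρ' :=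
  Representation.Equiv.mk e fun g => LinearMap.ext (h g)

theorem equiv_apply_apply {ρ : Representation ℂ W V} {ρ' : Representation ℂ W V'} (e : ρ.Equiv ρ')
    (g : W) (x : V) : e (ρ g x) = ρ' g (e x) :=
  IntertwiningMap.isIntertwining _ _ e.toIntertwiningMap g x

theorem isIrreducible_iff (ρ : Representation ℂ W V) : ρ.IsIrreducible ↔
    Nontrivial V ∧ ∀ p : Submodule ℂ V, (∀ g, ∀ x ∈ p, ρ g x ∈ p) → p = ⊥ ∨ p = ⊤ := by
  have hinj := Subrepresentation.toSubmodule_injective (ρ := ρ)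
  constructor
  · intro h
    refine ⟨?_, fun p hp => ?_⟩
    · by_contra hV
      rw [not_nontrivial_iff_subsingleton] at hV
      exact bot_ne_top (α := Subrepresentation ρ) (hinj (Subsingleton.elim _ _))
    · exact (eq_bot_or_eq_top (⟨p, hp⟩ : Subrepresentation ρ)).imp
        (congrArg Subrepresentation.toSubmodule) (congrArg Subrepresentation.toSubmodule)
  · rintro ⟨hV, h⟩
    have : Nontrivial (Subrepresentation ρ) :=
      ⟨⊥, ⊤, fun h => bot_ne_top (α := Submodule ℂ V) (congrArg Subrepresentation.toSubmodule h)⟩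
    exact ⟨fun p => (h p.toSubmodule p.apply_mem_toSubmodule).imp (fun h => hinj h) fun h => hinj h⟩

theorem isIrreducible_of_equiv {ρ : Representation ℂ W V} {ρ' : Representation ℂ W V'}
    (e : ρ.Equiv ρ') (h : ρ.IsIrreducible) : ρ'.IsIrreducible := by
  rw [isIrreducible_iff] at h ⊢
  obtain ⟨hV, h⟩ := h
  refine ⟨e.symm.toLinearEquiv.toEquiv.nontrivial, fun p hp => ?_⟩
  have := h (p.comap e.toLinearEquiv.toLinearMap) fun g x hx => by
    rw [Submodule.mem_comap] at hx ⊢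
    exact (equiv_apply_apply e g x).symm ▸ hp g _ hx
  refine this.imp (fun h => ?_) fun h => ?_
  · rw [Submodule.eq_bot_iff] at h ⊢
    intro x hx
    have := h (e.symm x) (by
      rw [Submodule.mem_comap]
      exact (e.apply_symm_apply x).symm ▸ hx)
    rw [← e.apply_symm_apply x, this, map_zero]
  · rw [Submodule.eq_top_iff'] at h ⊢
    intro x
    have := h (e.symm x)
    rw [Submodule.mem_comap] at this
    exact (e.apply_symm_apply x) ▸ this

/-- The twist of a representation by the unramified character `w ↦ c ^ v w`. -/
def twist (v : W →* Multiplicative ℤ) (σ : Representation ℂ W V) (c : ℂˣ) :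
    Representation ℂ W V where
  toFun w := ((c ^ (v w).toAdd : ℂˣ) : ℂ) • σ w
  map_one' := by simp
  map_mul' w w' := by
    rw [map_mul v, map_mul σ, toAdd_mul, zpow_add, Units.val_mul, smul_mul_smul_comm]

variable (v : W →* Multiplicative ℤ)

theorem twist_apply (σ : Representation ℂ W V) (c : ℂˣ) (w : W) (x : V) :
    twist v σ c w x = ((c ^ (v w).toAdd : ℂˣ) : ℂ) • σ w x := rfl

theorem twist_twist (σ : Representation ℂ W V) (c c' : ℂˣ) :
    twist v (twist v σ c) c' = twist v σ (c * c') := by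
  ext w x
  rw [twist_apply, twist_apply, twist_apply, smul_smul, mul_zpow, Units.val_mul, mul_comm]

theorem twist_one (σ : Representation ℂ W V) : twist v σ 1 = σ := by
  ext w x
  rw [twist_apply, one_zpow, Units.val_one, one_smul]

variable {v} in
/-- Isomorphic representations have isomorphic twists. -/
def twistCongr {σ : Representation ℂ W V} {σ' : Representation ℂ W V'} (e : σ.Equiv σ') (c : ℂˣ) :
    (twist v σ c).Equiv (twist v σ' c) :=
  repEquiv e.toLinearEquiv fun g x => by
    rw [twist_apply, map_smul, twist_apply]
    exact congrArg _ (equiv_apply_apply e g x)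

variable {v} in
theorem nonempty_twist_equiv_mul {V'' : Type*} [AddCommGroup V''] [Module ℂ V'']
    {σ : Representation ℂ W V} {σ' : Representation ℂ W V'} {σ'' : Representation ℂ W V''} {c c' : ℂˣ}
    (h : Nonempty ((twist v σ c).Equiv σ')) (h' : Nonempty ((twist v σ' c').Equiv σ'')) :
    Nonempty ((twist v σ (c * c')).Equiv σ'') := by
  obtain ⟨e⟩ := h
  obtain ⟨e'⟩ := h'
  have := (twistCongr (v := v) e c').trans e'
  rw [twist_twist] at this
  exact ⟨this⟩

variable {v} in
theorem nonempty_twist_equiv_inv {σ : Representation ℂ W V} {σ' : Representation ℂ W V'} {c : ℂˣ}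
    (h : Nonempty ((twist v σ c).Equiv σ')) : Nonempty ((twist v σ' c⁻¹).Equiv σ) := by
  obtain ⟨e⟩ := h
  have := (twistCongr (v := v) e c⁻¹)
  rw [twist_twist, mul_inv_cancel, twist_one] at this
  exact ⟨this.symm⟩

theorem isIrreducible_twist {σ : Representation ℂ W V} (h : σ.IsIrreducible) (c : ℂˣ) :
    (twist v σ c).IsIrreducible := by
  rw [isIrreducible_iff] at h ⊢
  refine ⟨h.1, fun p hp => h.2 p fun g x hx => ?_⟩
  have := hp g x hx
  rwa [twist_apply, p.smul_mem_iff (Units.ne_zero _)] at this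

theorem isIrreducible_comp {G : Type*} [Group G] {π : W →* G} (hπ : Function.Surjective π)
    {τ : Representation ℂ G V} :
    Representation.IsIrreducible (τ.comp π : Representation ℂ W V) ↔ τ.IsIrreducible := by
  rw [isIrreducible_iff, isIrreducible_iff]
  refine and_congr_right fun _ => forall_congr' fun p => ?_
  rw [hπ.forall]
  rfl

variable {v} {φ : W}

/-- `W` is generated by `ker v` and `φ`. -/
theorem apply_eq_self_of_ker (hφ : v φ = Multiplicative.ofAdd 1) {M : Representation ℂ W V} {x : V}
    (h1 : ∀ u, v u = 1 → M u x = x) (h2 : M φ x = x) (w : W) : M w x = x := by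
  let P : Subgroup W :=
    { carrier := {w | M w x = x}
      one_mem' := by simp
      mul_mem' := fun {a b} ha hb => by
        rw [Set.mem_ofPred_eq] at ha hb ⊢
        rw [map_mul, Module.End.mul_apply, hb, ha]
      inv_mem' := fun {a} ha => by
        rw [Set.mem_ofPred_eq] at ha ⊢
        nth_rewrite 1 [← ha]
        rw [← Module.End.mul_apply, ← map_mul, inv_mul_cancel, map_one, Module.End.one_apply] }
  have hw : w = φ ^ (v w).toAdd * (φ ^ (-(v w).toAdd) * w) := by group
  have hmem : w ∈ P := by
    rw [hw]
    refine P.mul_mem (P.zpow_mem h2 _) (h1 _ ?_)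
    rw [map_mul, map_zpow, hφ, ← ofAdd_zsmul, smul_eq_mul, mul_one, ofAdd_neg]
    exact inv_mul_cancel _
  exact hmem

/-- An eigenvector of `φ` with eigenvalue `c` is an invariant vector of the twist by `c⁻¹`. -/
theorem twist_apply_eigenvector (hφ : v φ = Multiplicative.ofAdd 1) {Ψ : Representation ℂ W V}
    (hΨ : ∀ u, v u = 1 → Ψ u = 1) {x : V} {c : ℂˣ} (hx : Ψ φ x = (c : ℂ) • x) (w : W) :
    Ψ w x = ((c ^ (v w).toAdd : ℂˣ) : ℂ) • x := by
  have := apply_eq_self_of_ker hφ (M := twist v Ψ c⁻¹) (x := x)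
    (fun u hu => by rw [twist_apply, hu, hΨ u hu]; simp)
    (by rw [twist_apply, hφ, hx]; simp [smul_smul]) w
  rw [twist_apply, inv_zpow, Units.val_inv_eq_inv_val, inv_smul_eq_iff₀ (Units.ne_zero _)] at this
  exact this

theorem unramified_apply_eq {Ψ : Representation ℂ W V}
    (hΨ : ∀ u, v u = 1 → Ψ u = 1) {w w' : W} (h : v w = v w') : Ψ w = Ψ w' := by
  have : Ψ (w'⁻¹ * w) = 1 := hΨ _ (by rw [map_mul, map_inv, h, inv_mul_cancel])
  rw [← mul_inv_cancel_left w' w, map_mul, this, mul_one]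

end Twist

/-! ### Products of representations and diagonal unramified representations -/

section Pi

variable {W : Type*} [Group W]

/-- The product of a family of representations. -/
def piRep {ι : Type*} {V : ι → Type*} [∀ i, AddCommGroup (V i)] [∀ i, Module ℂ (V i)]
    (σ : ∀ i, Representation ℂ W (V i)) : Representation ℂ W (∀ i, V i) where
  toFun w := LinearMap.pi fun i => σ i w ∘ₗ LinearMap.proj i
  map_one' := by ext; simp
  map_mul' w w' := by ext; simp

/-- Products of isomorphic representations are isomorphic. -/
def piRepCongr {ι κ : Type*} {V : ι → Type*} [∀ i, AddCommGroup (V i)] [∀ i, Module ℂ (V i)]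
    {V' : κ → Type*} [∀ i, AddCommGroup (V' i)] [∀ i, Module ℂ (V' i)]
    {σ : ∀ i, Representation ℂ W (V i)} {σ' : ∀ i, Representation ℂ W (V' i)} (e : ι ≃ κ)
    (T : ∀ i, (σ i).Equiv (σ' (e i))) : (piRep σ).Equiv (piRep σ') :=
  (repEquiv (LinearEquiv.piCongrRight fun i => (T i).toLinearEquiv) (fun g f =>
      funext fun i => equiv_apply_apply (T i) g (f i)) :
    (piRep σ).Equiv (piRep fun i => σ' (e i))).trans
  (repEquiv (LinearEquiv.piCongrLeft ℂ V' e).symm (fun _ _ => rfl) :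
    (piRep σ').Equiv (piRep fun i => σ' (e i))).symm

variable (v : W →* Multiplicative ℤ)

/-- The diagonal unramified representation with Frobenius eigenvalues `c`. -/
def unrDiag {ι : Type*} (c : ι → ℂˣ) : Representation ℂ W (ι → ℂ) :=
  piRep fun i => twist v (Representation.trivial ℂ W ℂ) (c i)

theorem unrDiag_apply {ι : Type*} (c : ι → ℂˣ) (w : W) (f : ι → ℂ) (i : ι) :
    unrDiag v c w f i = ((c i ^ (v w).toAdd : ℂˣ) : ℂ) * f i := rfl

theorem unrDiag_eq_one {ι : Type*} (c : ι → ℂˣ) {w : W} (hw : v w = 1) : unrDiag v c w = 1 := by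
  refine LinearMap.ext fun f => funext fun i => ?_
  rw [unrDiag_apply, hw]
  simp

variable {V : Type*} [AddCommGroup V] [Module ℂ V]

theorem piScalarRight_tprod_apply {ι : Type*} [Fintype ι] [DecidableEq ι] (σ : Representation ℂ W V)
    (c : ι → ℂˣ) (w : W) (f : TensorProduct ℂ V (ι → ℂ)) (i : ι) :
    TensorProduct.piScalarRight ℂ ℂ V ι (σ.tprod (unrDiag v c) w f) i =
      twist v σ (c i) w (TensorProduct.piScalarRight ℂ ℂ V ι f i) := by
  induction f with
  | zero => simp
  | add x y hx hy => rw [map_add, map_add, Pi.add_apply, hx, hy, map_add, Pi.add_apply, map_add]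
  | tmul x f =>
    rw [Representation.tprod_apply, TensorProduct.map_tmul, TensorProduct.piScalarRight_apply,
      TensorProduct.piScalarRight_apply, TensorProduct.piScalarRightHom_tmul,
      TensorProduct.piScalarRightHom_tmul, twist_apply]
    beta_reduce
    rw [unrDiag_apply, map_smul, smul_smul]

theorem nonempty_tprod_unrDiag_equiv {ι : Type*} [Fintype ι] (σ : Representation ℂ W V)
    (c : ι → ℂˣ) :
    Nonempty ((σ.tprod (unrDiag v c)).Equiv (piRep fun i => twist v σ (c i))) := by
  classical
  exact ⟨repEquiv (TensorProduct.piScalarRight ℂ ℂ V ι) fun g f =>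
    funext fun i => piScalarRight_tprod_apply v σ c g f i⟩

theorem nonempty_tprod_congr {V' : Type*} [AddCommGroup V'] [Module ℂ V'] {U U' : Type*}
    [AddCommGroup U] [Module ℂ U] [AddCommGroup U'] [Module ℂ U']
    {σ : Representation ℂ W V} {σ' : Representation ℂ W V'} {Ψ : Representation ℂ W U}
    {Ψ' : Representation ℂ W U'} (e : σ.Equiv σ') (e' : Ψ.Equiv Ψ') :
    Nonempty ((σ.tprod Ψ).Equiv (σ'.tprod Ψ')) :=
  ⟨repEquiv (TensorProduct.congr e.toLinearEquiv e'.toLinearEquiv) fun g f => by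
    induction f with
    | zero => simp
    | add x y hx hy => rw [map_add, map_add, hx, hy, map_add, map_add]
    | tmul x y =>
      exact congrArg₂ (· ⊗ₜ[ℂ] ·) (equiv_apply_apply e g x) (equiv_apply_apply e' g y)⟩

variable {v} in
/-- An unramified representation with a basis of Frobenius eigenvectors is diagonal. -/
theorem nonempty_equiv_unrDiag {φ : W} (hφ : v φ = Multiplicative.ofAdd 1)
    {Ψ : Representation ℂ W V} (hΨ : ∀ u, v u = 1 → Ψ u = 1) {n : ℕ}
    (b : Module.Basis (Fin n) ℂ V) (c : Fin n → ℂˣ) (h : ∀ k, Ψ φ (b k) = (c k : ℂ) • b k) :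
    Nonempty (Ψ.Equiv (unrDiag v c)) := by
  have hb : ∀ g k, b.equivFun (Ψ g (b k)) = unrDiag v c g (b.equivFun (b k)) := by
    intro g k
    ext i
    rw [twist_apply_eigenvector hφ hΨ (h k), map_smul, unrDiag_apply, Pi.smul_apply, smul_eq_mul]
    by_cases hik : i = k
    · rw [hik]
    · simp [Ne.symm hik]
  exact ⟨repEquiv b.equivFun fun g x => LinearMap.congr_fun
    (b.ext (f₁ := b.equivFun.toLinearMap ∘ₗ Ψ g) (f₂ := unrDiag v c g ∘ₗ b.equivFun.toLinearMap)
      (hb g)) x⟩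

end Pi

end

noncomputable section

open Representation
open scoped TensorProduct

theorem IsDiag.of_pow_eq_one {U : Type*} [AddCommGroup U] [Module ℂ U] {f : Module.End ℂ U}
    {n : ℕ} (hn : 0 < n) (h : f ^ n = 1) : IsDiag f := by
  refine IsDiag.of_pow (IsUnit.of_pow_eq_one h hn.ne') hn ?_
  rw [h]
  intro a x y hx hy
  rw [Module.End.one_apply] at hx hy
  by_contra hy0
  have ha : a = 1 := by
    have h2 : (1 - a) • y = 0 := by rw [sub_smul, one_smul, ← hy, sub_self]
    exact (sub_eq_zero.1 ((smul_eq_zero.1 h2).resolve_right hy0)).symm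
  rw [ha, one_smul, left_eq_add] at hx
  exact hy0 hx

/-! ### Frobenius on the homomorphisms commuting with inertia, and characters on cosets -/

section Inertia

variable {W G : Type*} [Group W] [Group G] [Finite G] {v : W →* Multiplicative ℤ} {π : W →* G}
  {φ : W} {I : Subgroup G} {E E' : Type*} [AddCommGroup E] [Module ℂ E] [FiniteDimensional ℂ E]
  [AddCommGroup E'] [Module ℂ E'] [FiniteDimensional ℂ E']

variable (I) in
/-- The space of homomorphisms commuting with the subgroup `I`. -/
def homOn (τ : Representation ℂ G E) (τ' : Representation ℂ G E') : Submodule ℂ (E →ₗ[ℂ] E') :=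
  (linHom (τ.comp I.subtype) (τ'.comp I.subtype)).invariants

theorem mem_homOn {τ : Representation ℂ G E} {τ' : Representation ℂ G E'} {T : E →ₗ[ℂ] E'} :
    T ∈ homOn I τ τ' ↔ ∀ x ∈ I, linHom τ τ' x T = T :=
  Subtype.forall

theorem linHom_mem_homOn [I.Normal] {τ : Representation ℂ G E} {τ' : Representation ℂ G E'}
    {T : E →ₗ[ℂ] E'} (hT : T ∈ homOn I τ τ') (g : G) : linHom τ τ' g T ∈ homOn I τ τ' := by
  rw [mem_homOn] at hT ⊢
  intro x hx
  have h := hT _ (Subgroup.Normal.conj_mem' ‹_› x hx g)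
  rw [← Module.End.mul_apply, ← map_mul]
  have h2 : x * g = g * (g⁻¹ * x * g) := by group
  rw [h2, map_mul, Module.End.mul_apply, h]

theorem linHom_injective (τ : Representation ℂ G E) (τ' : Representation ℂ G E') (g : G) :
    Function.Injective (linHom τ τ' g) :=
  (apply_bijective _ g).1

/-- An eigenvector of Frobenius on `Hom_I(τ, τ')` gives an isomorphism of an unramified twist. -/
theorem exists_twist_equiv (hφ : v φ = Multiplicative.ofAdd 1) (hπ : Function.Surjective π)
    (hI : v.ker.map π = I) {τ : Representation ℂ G E} {τ' : Representation ℂ G E'}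
    (hτ : τ.IsIrreducible) (hτ' : τ'.IsIrreducible) {T : E →ₗ[ℂ] E'} (hT : T ∈ homOn I τ τ')
    (hT0 : T ≠ 0) {c : ℂˣ} (h : linHom τ τ' (π φ) T = (c : ℂ) • T) :
    ∃ e : (twist v (τ.comp π) c).Equiv (τ'.comp π), ∀ x, e x = T x := by
  -- After the twist, `T` is fixed by `ker v` and by `φ`, hence by all of `W`. It is then a nonzero
  -- intertwining map between irreducible representations, so Schur's lemma applies.
  have hinv : ∀ w, linHom (twist v (τ.comp π) c) (τ'.comp π) w T = T := by
    refine apply_eq_self_of_ker hφ (fun u hu => ?_) ?_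
    · have h1 := mem_homOn.1 hT (π u) (hI ▸ ⟨u, hu, rfl⟩)
      rw [linHom_apply] at h1 ⊢
      have h2 : twist v (τ.comp π) c u⁻¹ = τ (π u)⁻¹ := by
        ext x
        rw [twist_apply, map_inv, hu]
        simp
      rw [h2]
      exact h1
    · rw [linHom_apply] at h ⊢
      have h2 : twist v (τ.comp π) c φ⁻¹ = ((c⁻¹ : ℂˣ) : ℂ) • τ (π φ)⁻¹ := by
        ext x
        rw [twist_apply, map_inv, hφ]
        simp
      rw [h2, LinearMap.comp_smul, LinearMap.comp_smul]
      refine (congrArg _ h).trans ?_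
      rw [smul_smul, Units.inv_mul, one_smul]
  let f : IntertwiningMap (twist v (τ.comp π) c) (τ'.comp π) :=
    invariantsEquivIntertwiningMap _ _ ⟨T, hinv⟩
  have hf : f.toLinearMap = T := rfl
  have h1 : (twist v (τ.comp π) c).IsIrreducible :=
    isIrreducible_twist v ((isIrreducible_comp hπ).2 hτ) c
  have h2 : Representation.IsIrreducible (τ'.comp π : Representation ℂ W E') :=
    (isIrreducible_comp hπ).2 hτ'
  rcases IsIrreducible.bijective_or_eq_zero f with hb | h0
  · exact ⟨f.ofBijective hb, fun x => rfl⟩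
  · exact absurd (hf ▸ congrArg IntertwiningMap.toLinearMap h0) hT0

/-- The converse of `exists_twist_equiv`: isomorphisms from twists are Frobenius eigenvectors. -/
theorem equiv_mem_homOn (hφ : v φ = Multiplicative.ofAdd 1)
    (hI : v.ker.map π = I) {τ : Representation ℂ G E} {τ' : Representation ℂ G E'} {c : ℂˣ}
    (e : (twist v (τ.comp π) c).Equiv (τ'.comp π)) :
    (e.toLinearEquiv : E →ₗ[ℂ] E') ∈ homOn I τ τ' ∧
      linHom τ τ' (π φ) (e.toLinearEquiv : E →ₗ[ℂ] E') =
        (c : ℂ) • (e.toLinearEquiv : E →ₗ[ℂ] E') := by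
  have key : ∀ w, linHom τ τ' (π w) (e.toLinearEquiv : E →ₗ[ℂ] E') =
      ((c ^ (v w).toAdd : ℂˣ) : ℂ) • (e.toLinearEquiv : E →ₗ[ℂ] E') := by
    intro w
    ext x
    have h := equiv_apply_apply e w (τ (π w)⁻¹ x)
    rw [twist_apply, map_smul] at h
    have h1 : (τ.comp π) w (τ (π w)⁻¹ x) = x := self_inv_apply τ (π w) x
    rw [h1] at h
    exact h.symm
  refine ⟨mem_homOn.2 fun x hx => ?_, ?_⟩
  · rw [← hI] at hx
    obtain ⟨u, hu, rfl⟩ := hx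
    rw [key, MonoidHom.mem_ker.1 hu]
    simp
  · rw [key, hφ]
    simp

theorem isDiag_linHom [I.Normal] (τ : Representation ℂ G E) (τ' : Representation ℂ G E') (g : G) :
    IsDiag ((linHom τ τ' g).restrict (p := homOn I τ τ') fun _ hT => linHom_mem_homOn hT g) := by
  refine IsDiag.of_pow_eq_one (Nat.card_pos (α := G)) ?_
  rw [Module.End.pow_restrict]
  ext1 T
  apply Subtype.ext
  rw [LinearMap.coe_restrict_apply, ← map_pow, pow_card_eq_one', map_one]
  rfl

/-- On a nonzero space Frobenius would have an eigenvector, and this would give an isomorphism by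
`exists_twist_equiv`. -/
theorem homOn_eq_bot [I.Normal] (hφ : v φ = Multiplicative.ofAdd 1) (hπ : Function.Surjective π)
    (hI : v.ker.map π = I) {τ : Representation ℂ G E} {τ' : Representation ℂ G E'}
    (hτ : τ.IsIrreducible) (hτ' : τ'.IsIrreducible)
    (h : ∀ c, IsEmpty ((twist v (τ.comp π) c).Equiv (τ'.comp π))) : homOn I τ τ' = ⊥ := by
  by_contra hne
  have : Nontrivial (homOn I τ τ') := Submodule.nontrivial_iff_ne_bot.2 hne
  obtain ⟨a, ha⟩ := Module.End.exists_eigenvalue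
    ((linHom τ τ' (π φ)).restrict (p := homOn I τ τ') fun _ hT => linHom_mem_homOn hT (π φ))
  obtain ⟨T, hT⟩ := ha.exists_hasEigenvector
  have h1 := congrArg Subtype.val hT.apply_eq_smul
  rw [LinearMap.coe_restrict_apply, Submodule.coe_smul] at h1
  have hT0 : (T : E →ₗ[ℂ] E') ≠ 0 := fun h0 => hT.2 (Subtype.ext h0)
  have ha0 : a ≠ 0 := by
    rintro rfl
    rw [zero_smul, ← map_zero (linHom τ τ' (π φ))] at h1
    exact hT0 (linHom_injective τ τ' _ h1)
  obtain ⟨e, -⟩ := exists_twist_equiv hφ hπ hI hτ hτ' T.2 hT0 (c := Units.mk0 a ha0) h1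
  exact (h _).false e

/-- The unramified characters fixing the isomorphism class of a representation. -/
def twistStabilizer (v : W →* Multiplicative ℤ) {V : Type*} [AddCommGroup V] [Module ℂ V]
    (σ : Representation ℂ W V) : Subgroup ℂˣ where
  carrier := {c | Nonempty ((twist v σ c).Equiv σ)}
  one_mem' := by
    change Nonempty ((twist v σ 1).Equiv σ)
    rw [twist_one]
    exact ⟨Representation.Equiv.refl σ⟩
  mul_mem' ha hb := nonempty_twist_equiv_mul ha hb
  inv_mem' ha := nonempty_twist_equiv_inv ha

/-- Eigenvectors for distinct eigenvalues are independent. Two eigenvectors with the same eigenvalue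
`c` are isomorphisms from the same irreducible twist, so they are proportional by Schur's lemma. As
Frobenius is diagonalizable here, one eigenvector for each `c` in the stabilizer gives a basis. -/
theorem exists_basis_homOn [I.Normal] (hφ : v φ = Multiplicative.ofAdd 1)
    (hπ : Function.Surjective π) (hI : v.ker.map π = I) {τ : Representation ℂ G E}
    (hτ : τ.IsIrreducible) :
    ∃ b : Module.Basis (twistStabilizer v (τ.comp π : Representation ℂ W E)) ℂ (homOn I τ τ),
      ∀ c, linHom τ τ (π φ) (b c) = ((c : ℂˣ) : ℂ) • (b c : E →ₗ[ℂ] E) := by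
  have hne : ∀ c : twistStabilizer v (τ.comp π : Representation ℂ W E),
      Nonempty ((twist v (τ.comp π) c.1).Equiv (τ.comp π)) := fun c => c.2
  let e := fun c => (hne c).some
  let T : twistStabilizer v (τ.comp π : Representation ℂ W E) → homOn I τ τ := fun c =>
    ⟨((e c).toLinearEquiv : E →ₗ[ℂ] E), (equiv_mem_homOn hφ hI (e c)).1⟩
  set Φ := (linHom τ τ (π φ)).restrict (p := homOn I τ τ) fun _ hT => linHom_mem_homOn hT (π φ)
    with hΦ
  have hT : ∀ c, Φ (T c) = ((c : ℂˣ) : ℂ) • T c := fun c =>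
    Subtype.ext (equiv_mem_homOn hφ hI (e c)).2
  have hnt : Nontrivial E := ((isIrreducible_iff τ).1 hτ).1
  have hT0 : ∀ c, T c ≠ 0 := by
    intro c h0
    obtain ⟨x, hx⟩ := exists_ne (0 : E)
    have h1 : (e c) x = 0 := LinearMap.congr_fun (congrArg Subtype.val h0) x
    exact hx ((e c).toLinearEquiv.map_eq_zero_iff.1 h1)
  have hli : LinearIndependent ℂ T :=
    Module.End.eigenvectors_linearIndependent' Φ
      (fun c : twistStabilizer v (τ.comp π : Representation ℂ W E) => ((c : ℂˣ) : ℂ))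
      (fun c c' h => Subtype.ext (Units.ext h)) T
      fun c => ⟨Module.End.mem_eigenspace_iff.2 (hT c), hT0 c⟩
  have hsp : ⊤ ≤ Submodule.span ℂ (Set.range T) := by
    rw [← (isDiag_linHom (I := I) τ τ (π φ)).iSup_eigenspace_eq_top, iSup_le_iff]
    intro a X hX
    rw [Module.End.mem_eigenspace_iff] at hX
    by_cases hX0 : X = 0
    · rw [hX0]; exact zero_mem _
    have h1 := congrArg Subtype.val hX
    rw [LinearMap.coe_restrict_apply, Submodule.coe_smul] at h1
    have hX0' : (X : E →ₗ[ℂ] E) ≠ 0 := fun h0 => hX0 (Subtype.ext h0)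
    have ha0 : a ≠ 0 := by
      rintro rfl
      rw [zero_smul, ← map_zero (linHom τ τ (π φ))] at h1
      exact hX0' (linHom_injective τ τ _ h1)
    obtain ⟨e', he'⟩ := exists_twist_equiv hφ hπ hI hτ hτ X.2 hX0' (c := Units.mk0 a ha0) h1
    let c : twistStabilizer v (τ.comp π : Representation ℂ W E) := ⟨Units.mk0 a ha0, ⟨e'⟩⟩
    have hirr : (twist v (τ.comp π) c.1).IsIrreducible :=
      isIrreducible_twist v ((isIrreducible_comp hπ).2 hτ) c.1
    obtain ⟨s, hs⟩ := (IsIrreducible.algebraMap_intertwiningMap_bijective_of_isAlgClosed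
      (ρ := twist v (τ.comp π) c.1)).2
        (e'.trans (e c).symm).toIntertwiningMap
    have hXs : X = s • T c := by
      ext x
      have h2 : s • x = (e c).symm (e' x) := congrArg (fun f => f x) hs
      have h3 := congrArg (e c) h2
      rw [map_smul, (e c).apply_symm_apply, he'] at h3
      exact h3.symm
    rw [hXs]
    exact Submodule.smul_mem _ _ (Submodule.subset_span ⟨c, rfl⟩)
  refine ⟨Module.Basis.mk hli hsp, fun c => ?_⟩
  rw [Module.Basis.mk_apply]
  exact congrArg Subtype.val (hT c)

theorem natCard_twistStabilizer [I.Normal] (hφ : v φ = Multiplicative.ofAdd 1)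
    (hπ : Function.Surjective π) (hI : v.ker.map π = I) {τ : Representation ℂ G E}
    (hτ : τ.IsIrreducible) : Finite (twistStabilizer v (τ.comp π : Representation ℂ W E)) ∧
    Nat.card (twistStabilizer v (τ.comp π : Representation ℂ W E)) =
      Module.finrank ℂ (homOn I τ τ) := by
  obtain ⟨b, -⟩ := exists_basis_homOn hφ hπ hI hτ
  have := Module.Finite.finite_basis b
  let _ := Fintype.ofFinite (twistStabilizer v (τ.comp π : Representation ℂ W E))
  exact ⟨this, by rw [Module.finrank_eq_card_basis b, Nat.card_eq_fintype_card]⟩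

theorem finrank_homOn_pos [I.Normal] (hφ : v φ = Multiplicative.ofAdd 1)
    (hπ : Function.Surjective π) (hI : v.ker.map π = I) {τ : Representation ℂ G E}
    (hτ : τ.IsIrreducible) : 0 < Module.finrank ℂ (homOn I τ τ) := by
  obtain ⟨hf, hc⟩ := natCard_twistStabilizer hφ hπ hI hτ
  rw [← hc]
  exact Nat.card_pos

/-- The unramified characters fixing `τ` are those of order dividing `dim Hom_I(τ, τ)`. -/
theorem mem_twistStabilizer_iff [I.Normal] (hφ : v φ = Multiplicative.ofAdd 1)
    (hπ : Function.Surjective π) (hI : v.ker.map π = I) {τ : Representation ℂ G E}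
    (hτ : τ.IsIrreducible) (c : ℂˣ) :
    c ∈ twistStabilizer v (τ.comp π : Representation ℂ W E) ↔
      c ^ Module.finrank ℂ (homOn I τ τ) = 1 := by
  obtain ⟨hf, hc⟩ := natCard_twistStabilizer hφ hπ hI hτ
  have : NeZero (Module.finrank ℂ (homOn I τ τ)) := ⟨(finrank_homOn_pos hφ hπ hI hτ).ne'⟩
  have hle : twistStabilizer v (τ.comp π : Representation ℂ W E) ≤
      rootsOfUnity (Module.finrank ℂ (homOn I τ τ)) ℂ := by
    intro c hc'
    rw [mem_rootsOfUnity, ← hc]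
    exact congrArg Subtype.val (pow_card_eq_one'
      (x := (⟨c, hc'⟩ : twistStabilizer v (τ.comp π : Representation ℂ W E))))
  -- By Lagrange the stabilizer, of order `m`, lies in the group of `m`-th roots of unity, which
  -- also has order `m`.
  have heq := Subgroup.eq_of_le_of_card_ge hle
    (by rw [hc, Complex.card_rootsOfUnity])
  rw [heq, mem_rootsOfUnity]

/-- The eigenvalues of Frobenius on this space are `m`-th roots of unity, where `m` is its
dimension. -/
theorem linHom_pow_apply [I.Normal] (hφ : v φ = Multiplicative.ofAdd 1)
    (hπ : Function.Surjective π) (hI : v.ker.map π = I) {τ : Representation ℂ G E}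
    (hτ : τ.IsIrreducible) (d : ℕ) {T : E →ₗ[ℂ] E} (hT : T ∈ homOn I τ τ) :
    linHom τ τ (π φ ^ (d * Module.finrank ℂ (homOn I τ τ))) T = T := by
  obtain ⟨b, hb⟩ := exists_basis_homOn hφ hπ hI hτ
  have h1 : ∀ c (n : ℕ), linHom τ τ (π φ ^ n) (b c) =
      ((c : ℂˣ) : ℂ) ^ n • (b c : E →ₗ[ℂ] E) := by
    intro c n
    induction n with
    | zero => simp
    | succ n ih => rw [pow_succ, map_mul, Module.End.mul_apply, hb, map_smul, ih, smul_smul, pow_succ']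
  have h2 := b.ext (f₁ := linHom τ τ (π φ ^ (d * Module.finrank ℂ (homOn I τ τ))) ∘ₗ
    (homOn I τ τ).subtype) (f₂ := (homOn I τ τ).subtype) fun c => by
      rw [LinearMap.comp_apply, Submodule.subtype_apply, h1, mul_comm, pow_mul, ← Units.val_pow_eq_pow_val,
        (mem_twistStabilizer_iff hφ hπ hI hτ c.1).1 c.2, Units.val_one, one_pow, one_smul]
  exact LinearMap.congr_fun h2 ⟨T, hT⟩

/-- The eigenvalues of `τ g` are roots of unity, for which conjugation is inversion. -/
theorem star_character (τ : Representation ℂ G E) (g : G) :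
    (starRingEnd ℂ) (τ.character g) = τ.character g⁻¹ := by
  have hu : IsUnit (τ g) := (Group.isUnit g).map τ
  have hd : IsDiag (τ g) :=
    IsDiag.of_pow_eq_one (Nat.card_pos (α := G)) (by rw [← map_pow, pow_card_eq_one', map_one])
  obtain ⟨n, b, c, hc⟩ := hd.exists_basis hu
  have hinv : ∀ k, τ g⁻¹ (b k) = ((c k : ℂ)⁻¹) • b k := by
    intro k
    rw [eq_inv_smul_iff₀ (c k).ne_zero, ← map_smul, ← hc, inv_self_apply]
  have hroot : ∀ k, (c k : ℂ) ^ Nat.card G = 1 := by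
    intro k
    have h1 : ∀ m : ℕ, τ (g ^ m) (b k) = (c k : ℂ) ^ m • b k := by
      intro m
      induction m with
      | zero => simp
      | succ m ih => rw [pow_succ, map_mul, Module.End.mul_apply, hc, map_smul, ih, smul_smul, pow_succ']
    have h2 := h1 (Nat.card G)
    rw [pow_card_eq_one', map_one, Module.End.one_apply] at h2
    have h3 : (1 - (c k : ℂ) ^ Nat.card G) • b k = 0 := by
      rw [sub_smul, one_smul, ← h2, sub_self]
    exact (sub_eq_zero.1 ((smul_eq_zero.1 h3).resolve_right (b.ne_zero k))).symm
  rw [character, character, trace_of_basis b _ hc, trace_of_basis b _ hinv, map_sum]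
  refine Finset.sum_congr rfl fun k _ => ?_
  exact (Complex.inv_eq_conj (Complex.norm_eq_one_of_pow_eq_one (hroot k) Nat.card_pos.ne')).symm

/-- The scalar product of two characters on a coset of `I`. -/
theorem sum_star_character_mul_character (τ : Representation ℂ G E) (τ' : Representation ℂ G E')
    (g : G) (hg : ∀ T ∈ homOn I τ τ', linHom τ τ' g T = T) [Fintype I] :
    ∑ x : I, (starRingEnd ℂ) (τ.character (g * x)) * τ'.character (g * x) =
      Nat.card I * Module.finrank ℂ (homOn I τ τ') := by
  let M := linHom (τ.comp I.subtype) (τ'.comp I.subtype)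
  have : Invertible (Fintype.card I : ℂ) := invertibleOfNonzero (by simp)
  have h1 : ∀ x : I, (starRingEnd ℂ) (τ.character (g * x)) * τ'.character (g * x) =
      LinearMap.trace ℂ _ (linHom τ τ' g * M x) := by
    intro x
    rw [star_character, ← char_linHom, character, map_mul]
    rfl
  -- The sum is `|I|` times the projector onto the `I`-invariants. Since `g` is trivial on its
  -- image, the trace is `|I|` times the dimension of the invariants.
  have h2 : ∑ x : I, M x = (Nat.card I : ℂ) • M.averageMap := by
    rw [averageMap, GroupAlgebra.average, map_smul, map_sum, smul_smul, Nat.card_eq_fintype_card,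
      mul_invOf_self, one_smul]
    exact Finset.sum_congr rfl fun x _ => (asAlgebraHom_of M x).symm
  have h3 : linHom τ τ' g * M.averageMap = M.averageMap := by
    ext1 T
    exact hg _ (averageMap_invariant M T)
  rw [Finset.sum_congr rfl fun x _ => h1 x, ← map_sum, ← Finset.mul_sum, h2, mul_smul_comm, h3,
    map_smul, smul_eq_mul, (isProj_averageMap M).trace]
  rfl

end Inertia

end

noncomputable section

open Representation
open scoped TensorProduct DirectSum

/-! ### Semisimple representations -/

section Semisimple

variable {W : Type*} [Group W] {V : Type*} [AddCommGroup V] [Module ℂ V]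

theorem IsDiag.of_injective {U U' : Type*} [AddCommGroup U] [Module ℂ U] [AddCommGroup U']
    [Module ℂ U'] {f : Module.End ℂ U} {g : Module.End ℂ U'} (hg : IsDiag g) (j : U →ₗ[ℂ] U')
    (hj : Function.Injective j) (h : ∀ x, j (f x) = g (j x)) : IsDiag f := by
  intro a x y hx hy
  have h1 := hg a (j x) (j y) (by rw [← h, hx, map_add, map_smul]) (by rw [← h, hy, map_smul])
  rwa [map_eq_zero_iff j hj] at h1

/-- An element acting centrally on a semisimple representation is diagonalizable. -/
theorem isDiag_of_commute {ρ : Representation ℂ W V} (hρ : ρ.IsSemisimpleRepresentation) {z : W}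
    (hz : ∀ w x, ρ z (ρ w x) = ρ w (ρ z x)) : IsDiag (ρ z) := by
  intro a x y hx hy
  let N : Subrepresentation ρ :=
    { toSubmodule := Module.End.eigenspace (ρ z) a
      apply_mem_toSubmodule := fun g u hu => by
        rw [Module.End.mem_eigenspace_iff] at hu ⊢
        rw [hz, hu, map_smul] }
  -- By centrality the eigenspace `N` is a subrepresentation. Removing the `N`-component of `x`
  -- shows that `y` lies in the invariant complement `C`; since `y` is also in `N`, it vanishes.
  obtain ⟨C, hC⟩ := exists_isCompl N
  have hxm : x ∈ N.toSubmodule ⊔ C.toSubmodule := by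
    rw [← Subrepresentation.toSubmodule_sup, hC.sup_eq_top]
    trivial
  obtain ⟨n, hn, m, hm, rfl⟩ := Submodule.mem_sup.1 hxm
  rw [Module.End.mem_eigenspace_iff] at hn
  rw [map_add, hn, smul_add, add_assoc, add_right_inj] at hx
  have hyC : y ∈ C.toSubmodule := by
    rw [← sub_eq_iff_eq_add'] at hx
    rw [← hx]
    exact C.toSubmodule.sub_mem (C.apply_mem_toSubmodule z hm) (C.toSubmodule.smul_mem a hm)
  have hyN : y ∈ N.toSubmodule := Module.End.mem_eigenspace_iff.2 hy
  have h0 : y ∈ (N ⊓ C).toSubmodule := by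
    rw [Subrepresentation.toSubmodule_inf]
    exact ⟨hyN, hyC⟩
  rw [hC.inf_eq_bot] at h0
  exact h0

/-- This is the decomposition of a semisimple module of finite length over the group algebra,
translated back to representations. -/
theorem exists_equiv_piRep [FiniteDimensional ℂ V] {ρ : Representation ℂ W V}
    (hρ : ρ.IsSemisimpleRepresentation) :
    ∃ (n : ℕ) (S : Fin n → Subrepresentation ρ), (∀ k, (S k).toRepresentation.IsIrreducible) ∧
      Nonempty (ρ.Equiv (piRep fun k => (S k).toRepresentation)) := by
  have hss := (isSemisimpleRepresentation_iff_isSemisimpleModule_asModule ρ).1 hρ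
  have hfin : Module.Finite (MonoidAlgebra ℂ W) ρ.asModule :=
    Module.Finite.of_restrictScalars_finite ℂ (MonoidAlgebra ℂ W) ρ.asModule
  obtain ⟨n, N, e, hN⟩ :=
    IsSemisimpleModule.exists_linearEquiv_fin_dfinsupp (MonoidAlgebra ℂ W) ρ.asModule
  refine ⟨n, fun k => Subrepresentation.ofSubmodule' (N k), fun k => ?_, ?_⟩
  · have hatom := isSimpleModule_iff_isAtom.1 (hN k)
    rw [isIrreducible_iff]
    constructor
    · have := IsSimpleModule.nontrivial (MonoidAlgebra ℂ W) (N k)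
      exact this
    · intro p hp
      let P : Subrepresentation ρ :=
        { toSubmodule := p.map (Subrepresentation.ofSubmodule' (N k)).toSubmodule.subtype
          apply_mem_toSubmodule := by
            rintro g _ ⟨x, hx, rfl⟩
            exact ⟨_, hp g x hx, rfl⟩ }
      have hle : P.asSubmodule ≤ N k := by
        rintro _ ⟨x, -, rfl⟩
        exact x.2
      rcases hatom.le_iff.1 hle with h | h
      · left
        rw [Submodule.eq_bot_iff]
        intro x hx
        have h1 : (x : V) ∈ P.asSubmodule := ⟨x, hx, rfl⟩
        rw [h] at h1
        exact Subtype.ext h1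
      · right
        rw [Submodule.eq_top_iff']
        intro x
        have h1 : (x : V) ∈ P.asSubmodule := h ▸ x.2
        obtain ⟨y, hy, hyx⟩ := h1
        rwa [← Subtype.ext hyx]
  · have hsm : ∀ (a : ℂ) (x : ρ.asModule) k, (e (a • x) k : ρ.asModule) = a • (e x k : ρ.asModule) := by
      intro a x k
      have h1 := map_smul e (algebraMap ℂ (MonoidAlgebra ℂ W) a) x
      rw [algebraMap_smul] at h1
      exact (congrArg Subtype.val (DFunLike.congr_fun h1 k)).trans
        (algebraMap_smul (MonoidAlgebra ℂ W) a ((e x k : ρ.asModule)))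
    have hact : ∀ g (x : ρ.asModule), MonoidAlgebra.single g (1 : ℂ) • x = ρ g x := by
      intro g x
      rw [single_smul, one_smul]
      rfl
    have hg : ∀ g (x : ρ.asModule) k, (e (ρ g x) k : ρ.asModule) = ρ g (e x k : ρ.asModule) := by
      intro g x k
      have h1 := map_smul e (MonoidAlgebra.single g (1 : ℂ)) x
      rw [hact] at h1
      exact (congrArg Subtype.val (DFunLike.congr_fun h1 k)).trans (hact g (e x k : ρ.asModule))
    let e' : V ≃ₗ[ℂ] ∀ k, (Subrepresentation.ofSubmodule' (N k)).toSubmodule :=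
      LinearEquiv.ofBijective
        { toFun := fun x k => e x k
          map_add' := fun x y => by
            ext k
            exact congrArg Subtype.val (DFunLike.congr_fun (map_add e x y) k)
          map_smul' := fun a x => by
            ext k
            exact hsm a x k }
        ⟨fun x y hxy => e.injective (DFinsupp.ext fun k => congrFun hxy k), fun f =>
          ⟨e.symm (DFinsupp.equivFunOnFintype.symm f), funext fun k =>
            DFunLike.congr_fun (e.apply_symm_apply (DFinsupp.equivFunOnFintype.symm f)) k⟩⟩
    exact ⟨repEquiv e' fun g x => funext fun k => Subtype.ext (hg g x k)⟩

end Semisimple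

/-! ### Irreducible representations as twists of representations of the finite quotient -/

section Factor

variable {W G : Type*} [Group W] [Group G] [Finite G] {v : W →* Multiplicative ℤ} {π : W →* G}
  {φ : W} {V : Type*} [AddCommGroup V] [Module ℂ V]

theorem exists_units_zpow_eq (a : ℂˣ) {f : ℤ} (hf : f ≠ 0) : ∃ c : ℂˣ, c ^ f = a := by
  have key : ∀ a : ℂˣ, ∃ c : ℂˣ, c ^ f.natAbs = a := by
    intro a
    obtain ⟨z, hz⟩ := IsAlgClosed.exists_pow_nat_eq (a : ℂ) (Int.natAbs_pos.2 hf)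
    have hz0 : z ≠ 0 := by
      rintro rfl
      rw [zero_pow (Int.natAbs_ne_zero.2 hf)] at hz
      exact a.ne_zero hz.symm
    exact ⟨Units.mk0 z hz0, Units.ext (by simpa using hz)⟩
  obtain ⟨c, rfl⟩ := key a
  rcases Int.natAbs_eq f with h | h
  · exact ⟨c, by rw [h, zpow_natCast, Int.natAbs_natCast]⟩
  · exact ⟨c⁻¹, by rw [h, zpow_neg, inv_zpow, inv_inv, zpow_natCast, Int.natAbs_neg, Int.natAbs_natCast]⟩

/-- The commutator of `z` and `w` is killed by `v`, whose target is abelian, and by `π`, since `π z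
= 1`. -/
theorem apply_mul_comm_of_mem_ker {ρ : Representation ℂ W V}
    (hN : ∀ u, v u = 1 → π u = 1 → ρ u = 1) {z : W} (hz : π z = 1) (w : W) (x : V) :
    ρ z (ρ w x) = ρ w (ρ z x) := by
  have h1 : ρ ((w * z)⁻¹ * (z * w)) = 1 := by
    apply hN
    · rw [map_mul, map_inv, map_mul, map_mul, mul_comm (v w), inv_mul_cancel]
    · simp [hz]
  have h2 : ρ (z * w) = ρ (w * z) := by
    rw [← mul_inv_cancel_left (w * z) (z * w), map_mul, h1, mul_one]
  rw [map_mul, map_mul] at h2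
  exact LinearMap.congr_fun h2 x

theorem isDiag_apply_pow_card {ρ : Representation ℂ W V} (hρ : ρ.IsSemisimpleRepresentation)
    (hN : ∀ u, v u = 1 → π u = 1 → ρ u = 1) (φ : W) : IsDiag (ρ (φ ^ Nat.card G)) :=
  isDiag_of_commute hρ fun w x =>
    apply_mul_comm_of_mem_ker hN (by rw [map_pow, pow_card_eq_one']) w x

theorem exists_comp_eq {M : Type*} [Monoid M] (hπ : Function.Surjective π) {f : W →* M}
    (h : π.ker ≤ f.ker) : ∃ g : G →* M, g.comp π = f := by
  refine ⟨(QuotientGroup.lift π.ker f h).comp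
    (QuotientGroup.quotientKerEquivOfSurjective π hπ).symm.toMonoidHom, MonoidHom.ext fun w => ?_⟩
  have h1 : (QuotientGroup.quotientKerEquivOfSurjective π hπ).symm (π w) = QuotientGroup.mk w := by
    rw [MulEquiv.symm_apply_eq]
    rfl
  exact (congrArg (QuotientGroup.lift π.ker f h) h1).trans rfl

/-- An irreducible representation of `W` that is trivial on `ker v ⊓ ker π` is an unramified twist
of a representation of `G`. -/
theorem exists_twist_eq_comp [FiniteDimensional ℂ V] (hφ : v φ = Multiplicative.ofAdd 1)
    (hπ : Function.Surjective π) {σ : Representation ℂ W V} (hσ : σ.IsIrreducible)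
    (hN : ∀ u, v u = 1 → π u = 1 → σ u = 1) :
    ∃ (c : ℂˣ) (τ : Representation ℂ G V), twist v σ c = τ.comp π := by
  obtain ⟨g, hg⟩ := (Subgroup.isCyclic_iff_exists_zpowers_eq_top (π.ker.map v)).1 inferInstance
  obtain ⟨z, hz, rfl⟩ : g ∈ π.ker.map v := hg ▸ Subgroup.mem_zpowers g
  -- `ker π` contains `φ ^ |G|`, of nonzero degree.
  have hf : (v z).toAdd ≠ 0 := by
    intro h0
    have h1 : v (φ ^ Nat.card G) ∈ Subgroup.zpowers (v z) := by
      rw [hg]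
      exact ⟨_, by rw [SetLike.mem_coe, MonoidHom.mem_ker, map_pow, pow_card_eq_one'], rfl⟩
    rw [toAdd_eq_zero.1 h0, Subgroup.zpowers_one_eq_bot, Subgroup.mem_bot, map_pow, hφ,
      ← ofAdd_nsmul, ofAdd_eq_one, nsmul_one] at h1
    exact Nat.card_pos.ne' (by exact_mod_cast h1)
  have hcomm := apply_mul_comm_of_mem_ker hN (MonoidHom.mem_ker.1 hz)
  obtain ⟨hV, hirr⟩ := (isIrreducible_iff σ).1 hσ
  obtain ⟨a, ha⟩ := Module.End.exists_eigenvalue (σ z)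
  have htop : Module.End.eigenspace (σ z) a = ⊤ := by
    refine (hirr (Module.End.eigenspace (σ z) a) fun w x hx => ?_).resolve_left ha
    rw [Module.End.mem_eigenspace_iff] at hx ⊢
    rw [hcomm, hx, map_smul]
  have hza : ∀ x, σ z x = a • x := fun x =>
    Module.End.mem_eigenspace_iff.1 (htop ▸ Submodule.mem_top)
  have ha0 : a ≠ 0 := by
    rintro rfl
    obtain ⟨x, hx⟩ := exists_ne (0 : V)
    refine hx ((apply_bijective σ z).1 ?_)
    rw [hza, zero_smul, map_zero]
  -- `c` is chosen so that the twist acts trivially at `z`. Every element of `ker π` is a power of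
  -- `z` times an element of `ker v ∩ ker π`, so the twist is trivial on `ker π`.
  obtain ⟨c, hc⟩ := exists_units_zpow_eq (Units.mk0 a ha0)⁻¹ hf
  have hker : π.ker ≤ MonoidHom.ker (twist v σ c) := by
    intro y hy
    obtain ⟨k, hk⟩ : v y ∈ Subgroup.zpowers (v z) := by rw [hg]; exact ⟨y, hy, rfl⟩
    have hk' : v z ^ k = v y := hk
    have h1 : z ∈ MonoidHom.ker (twist v σ c) := by
      rw [MonoidHom.mem_ker]
      ext x
      rw [twist_apply, hc, hza, smul_smul]
      simp [ha0]
    have h2 : (z ^ k)⁻¹ * y ∈ MonoidHom.ker (twist v σ c) := by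
      have hv : v ((z ^ k)⁻¹ * y) = 1 := by rw [map_mul, map_inv, map_zpow, hk', inv_mul_cancel]
      have hp : π ((z ^ k)⁻¹ * y) = 1 := by
        rw [map_mul, map_inv, map_zpow, MonoidHom.mem_ker.1 hz, MonoidHom.mem_ker.1 hy]
        simp
      rw [MonoidHom.mem_ker]
      ext x
      rw [twist_apply, hv, hN _ hv hp]
      simp
    have := mul_mem (zpow_mem h1 k) h2
    rwa [mul_inv_cancel_left] at this
  obtain ⟨τ, hτ⟩ := exists_comp_eq hπ hker
  exact ⟨c, τ, hτ.symm⟩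

end Factor

/-! ### Grouping twists into a direct sum -/

section DirectSum

variable {W : Type*} [Group W] {v : W →* Multiplicative ℤ} {Λ : Type*} {E : Λ → Type*}
  [∀ i, AddCommGroup (E i)] [∀ i, Module ℂ (E i)]

/-- Collecting the twists of the same representation in a product. -/
theorem exists_equiv_directSum (σ : ∀ i, Representation ℂ W (E i)) {n : ℕ} (i : Fin n → Λ)
    (c : Fin n → ℂˣ) : ∃ (k : Λ → ℕ) (c' : ∀ l, Fin (k l) → ℂˣ), Nonempty
      ((Representation.directSum fun l => (σ l).tprod (unrDiag v (c' l))).Equiv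
        (piRep fun a => twist v (σ (i a)) (c a))) := by
  classical
  let ε : ∀ l, Fin (Fintype.card {a // i a = l}) ≃ {a // i a = l} := fun l =>
    (Fintype.equivFin _).symm
  refine ⟨fun l => Fintype.card {a // i a = l}, fun l a => c (ε l a).1, ?_⟩
  let T : (⨁ l, E l ⊗[ℂ] (Fin (Fintype.card {a // i a = l}) → ℂ)) →ₗ[ℂ] ∀ a, E (i a) :=
    LinearMap.pi fun a => LinearMap.proj ((ε (i a)).symm ⟨a, rfl⟩) ∘ₗ
      (TensorProduct.piScalarRight ℂ ℂ (E (i a)) _).toLinearMap ∘ₗ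
        DirectSum.component ℂ Λ (fun l => E l ⊗[ℂ] (Fin (Fintype.card {a // i a = l}) → ℂ)) (i a)
  have hT : ∀ x a, T x a =
      TensorProduct.piScalarRight ℂ ℂ (E (i a)) _ (x (i a)) ((ε (i a)).symm ⟨a, rfl⟩) :=
    fun x a => rfl
  have hinj : Function.Injective T := by
    rw [injective_iff_map_eq_zero]
    intro x hx
    refine DFinsupp.ext fun l => ?_
    apply (TensorProduct.piScalarRight ℂ ℂ (E l) _).injective
    rw [DFinsupp.zero_apply, map_zero]
    ext b
    obtain ⟨⟨a, rfl⟩, rfl⟩ := (ε l).symm.surjective b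
    rw [← hT, hx]
    rfl
  have hsurj : Function.Surjective T := by
    intro f
    let h : ∀ l, {a // i a = l} → E l := fun l a => a.2 ▸ f a.1
    refine ⟨DFinsupp.mk (β := fun l => E l ⊗[ℂ] (Fin (Fintype.card {a // i a = l}) → ℂ))
      (Finset.univ.image i) fun l => (TensorProduct.piScalarRight ℂ ℂ (E l) _).symm fun b => h l (ε l b), funext fun a => ?_⟩
    have hmem : i a ∈ Finset.univ.image i := Finset.mem_image_of_mem _ (Finset.mem_univ a)
    rw [hT]
    have h1 := DFinsupp.mk_of_mem (β := fun l => E l ⊗[ℂ] (Fin (Fintype.card {a // i a = l}) → ℂ))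
      (s := Finset.univ.image i) (x := fun l =>
      (TensorProduct.piScalarRight ℂ ℂ (E l) _).symm fun b => h l (ε l b)) hmem
    refine (congrFun (congrArg _ h1) _).trans ?_
    rw [LinearEquiv.apply_symm_apply, Equiv.apply_symm_apply]
  refine ⟨repEquiv (LinearEquiv.ofBijective T ⟨hinj, hsurj⟩) fun g x => funext fun a => ?_⟩
  change T _ a = twist v (σ (i a)) (c a) g (T x a)
  rw [hT, hT]
  have h1 : (Representation.directSum (fun l => (σ l).tprod (unrDiag v fun b => c (ε l b).1)) g x)
      (i a) = (σ (i a)).tprod (unrDiag v fun b => c (ε (i a) b).1) g (x (i a)) := rfl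
  rw [h1, piScalarRight_tprod_apply, Equiv.apply_symm_apply]

theorem character_directSum [Fintype Λ] [∀ i, FiniteDimensional ℂ (E i)]
    (σ : ∀ i, Representation ℂ W (E i)) (w : W) :
    (Representation.directSum σ).character w = ∑ i, (σ i).character w := by
  classical
  have : Module.Finite ℂ (⨁ i, E i) :=
    Module.Finite.equiv (DirectSum.linearEquivFunOnFintype ℂ Λ E).symm
  have h : Representation.directSum σ w = ∑ i, DirectSum.lof ℂ Λ E i ∘ₗ
      (σ i w ∘ₗ DirectSum.component ℂ Λ E i) := by
    refine DirectSum.linearMap_ext ℂ fun j => LinearMap.ext fun x => ?_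
    rw [LinearMap.comp_apply, LinearMap.comp_apply, LinearMap.sum_apply, Finset.sum_eq_single j]
    · rw [LinearMap.comp_apply, LinearMap.comp_apply, DirectSum.component.lof_self]
      exact DirectSum.lmap_lof _ _ _
    · intro l _ hl
      rw [LinearMap.comp_apply, LinearMap.comp_apply, DirectSum.component.of, dif_neg hl.symm,
        map_zero, map_zero]
    · intro h
      exact absurd (Finset.mem_univ j) h
  rw [character, h, map_sum]
  refine Finset.sum_congr rfl fun i _ => ?_
  rw [LinearMap.trace_comp_comm', LinearMap.comp_assoc]
  have h2 : DirectSum.component ℂ Λ E i ∘ₗ DirectSum.lof ℂ Λ E i = LinearMap.id :=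
    LinearMap.ext fun x => DirectSum.component.lof_self ℂ i x
  rw [h2, LinearMap.comp_id]
  rfl

end DirectSum

end

noncomputable section

open Representation
open scoped TensorProduct DirectSum

/-! ### Unramified representations and their Frobenius eigenvalues -/

section Unramified

variable {W G : Type*} [Group W] [Group G] [Finite G] {v : W →* Multiplicative ℤ} {π : W →* G}
  {φ : W} {E U U' : Type*} [AddCommGroup E] [Module ℂ E] [FiniteDimensional ℂ E]
  [AddCommGroup U] [Module ℂ U] [FiniteDimensional ℂ U]
  [AddCommGroup U'] [Module ℂ U'] [FiniteDimensional ℂ U']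

theorem isIrreducible_trivial : (Representation.trivial ℂ W ℂ).IsIrreducible := by
  rw [isIrreducible_iff]
  exact ⟨inferInstance, fun p _ => eq_bot_or_eq_top (α := Ideal ℂ) p⟩

theorem isSemisimpleRepresentation_piRep {ι : Type*} [Finite ι] {V : ι → Type*}
    [∀ i, AddCommGroup (V i)] [∀ i, Module ℂ (V i)] {σ : ∀ i, Representation ℂ W (V i)}
    (h : ∀ i, (σ i).IsIrreducible) : (piRep σ).IsSemisimpleRepresentation := by
  rw [isSemisimpleRepresentation_iff_isSemisimpleModule_asModule]
  have : ∀ i, IsSimpleModule (MonoidAlgebra ℂ W) (σ i).asModule := fun i =>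
    (irreducible_iff_isSimpleModule_asModule _).1 (h i)
  let p : ∀ i, IntertwiningMap (piRep σ) (σ i) := fun i =>
    { toLinearMap := LinearMap.proj i
      isIntertwining' := fun _ => rfl }
  exact IsSemisimpleModule.of_injective
    (LinearMap.pi fun i => IntertwiningMap.equivLinearMapAsModule _ _ (p i))
    fun x y hxy => funext fun i => congrFun hxy i

theorem isSemisimpleRepresentation_unrDiag {ι : Type*} [Finite ι] (c : ι → ℂˣ) :
    (unrDiag v c).IsSemisimpleRepresentation :=
  isSemisimpleRepresentation_piRep fun i => isIrreducible_twist v isIrreducible_trivial (c i)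

theorem unrDiag_basisFun (hφ : v φ = Multiplicative.ofAdd 1) {n : ℕ} (c : Fin n → ℂˣ) (k : Fin n) :
    unrDiag v c φ (Pi.basisFun ℂ (Fin n) k) = (c k : ℂ) • Pi.basisFun ℂ (Fin n) k := by
  ext j
  rw [unrDiag_apply, hφ, Pi.basisFun_apply, Pi.smul_apply, smul_eq_mul]
  by_cases h : j = k
  · rw [h]; simp
  · simp [h]

theorem exists_basis_of_isSemisimpleRepresentation {Ψ : Representation ℂ W U}
    (hΨ : ∀ u, v u = 1 → Ψ u = 1) (hs : Ψ.IsSemisimpleRepresentation) :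
    ∃ (n : ℕ) (b : Module.Basis (Fin n) ℂ U) (c : Fin n → ℂˣ),
      ∀ k, Ψ φ (b k) = (c k : ℂ) • b k := by
  refine (isDiag_of_commute hs fun w x => ?_).exists_basis ((Group.isUnit φ).map Ψ)
  have := unramified_apply_eq hΨ (show v (φ * w) = v (w * φ) by rw [map_mul, map_mul, mul_comm])
  rw [map_mul, map_mul] at this
  exact LinearMap.congr_fun this x

/-- `φ ^ |G|` acts trivially on `E`, so `y ↦ x ⊗ y` embeds its action on `U` into that on the tensor
product. Hence `Ψ (φ ^ |G|)` is diagonalizable, and so is its root `Ψ φ`. -/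
theorem exists_basis_of_isDiag_tprod [Nontrivial E] {τ : Representation ℂ G E}
    {Ψ : Representation ℂ W U}
    (h : IsDiag (Representation.tprod (τ.comp π : Representation ℂ W E) Ψ (φ ^ Nat.card G))) :
    ∃ (n : ℕ) (b : Module.Basis (Fin n) ℂ U) (c : Fin n → ℂˣ),
      ∀ k, Ψ φ (b k) = (c k : ℂ) • b k := by
  have hu : IsUnit (Ψ φ) := (Group.isUnit φ).map Ψ
  refine IsDiag.exists_basis (IsDiag.of_pow hu (Nat.card_pos (α := G)) ?_) hu
  obtain ⟨x, hx⟩ := exists_ne (0 : E)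
  rw [← map_pow]
  refine h.of_injective (TensorProduct.mk ℂ E U x) ?_ fun y => ?_
  · rw [injective_iff_map_eq_zero]
    intro y hy
    obtain ⟨f, hf⟩ : ∃ f : Module.Dual ℂ E, f x ≠ 0 := by
      by_contra! h0
      exact hx ((Module.forall_dual_apply_eq_zero_iff ℂ x).1 h0)
    have h1 := congrArg (fun z => TensorProduct.lid ℂ U (f.rTensor U z)) hy
    simp only [TensorProduct.mk_apply, LinearMap.rTensor_tmul, TensorProduct.lid_tmul, map_zero] at h1
    exact (smul_eq_zero.1 h1).resolve_left hf
  · rw [Representation.tprod_apply]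
    have h1 : (τ.comp π) (φ ^ Nat.card G) x = x := by
      change τ (π (φ ^ Nat.card G)) x = x
      rw [map_pow, pow_card_eq_one', map_one, Module.End.one_apply]
    exact (congrArg (· ⊗ₜ[ℂ] Ψ (φ ^ Nat.card G) y) h1).symm

theorem character_pow_of_basis {Ψ : Representation ℂ W U} {n : ℕ} (b : Module.Basis (Fin n) ℂ U)
    (c : Fin n → ℂˣ) (h : ∀ k, Ψ φ (b k) = (c k : ℂ) • b k) (m : ℕ) :
    Ψ.character (φ ^ m) = ∑ k, (c k : ℂ) ^ m := by
  refine trace_of_basis b _ fun k => ?_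
  induction m with
  | zero => simp
  | succ m ih => rw [pow_succ, map_mul, Module.End.mul_apply, h, map_smul, ih, smul_smul, pow_succ']

/-- The twist of `τ` by an unramified representation depends only on the `m`-th powers of the
Frobenius eigenvalues, where `m = dim Hom_I(τ, τ)`. -/
theorem nonempty_tprod_equiv_of_map_pow_eq {I : Subgroup G} [I.Normal]
    (hφ : v φ = Multiplicative.ofAdd 1) (hπ : Function.Surjective π) (hI : v.ker.map π = I)
    {τ : Representation ℂ G E} (hτ : τ.IsIrreducible)
    {Ψ : Representation ℂ W U} (hΨ : ∀ u, v u = 1 → Ψ u = 1)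
    {Ψ' : Representation ℂ W U'} (hΨ' : ∀ u, v u = 1 → Ψ' u = 1)
    {n n' : ℕ} (b : Module.Basis (Fin n) ℂ U) (c : Fin n → ℂˣ)
    (h : ∀ k, Ψ φ (b k) = (c k : ℂ) • b k)
    (b' : Module.Basis (Fin n') ℂ U') (c' : Fin n' → ℂˣ)
    (h' : ∀ k, Ψ' φ (b' k) = (c' k : ℂ) • b' k)
    (hc : Finset.univ.val.map (fun k => c k ^ Module.finrank ℂ (homOn I τ τ)) =
      Finset.univ.val.map (fun k => c' k ^ Module.finrank ℂ (homOn I τ τ))) :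
    Nonempty ((Representation.tprod (τ.comp π : Representation ℂ W E) Ψ).Equiv
      (Representation.tprod (τ.comp π : Representation ℂ W E) Ψ')) := by
  obtain ⟨e, he⟩ := exists_equiv_of_map_univ_eq _ _ hc
  have hT : ∀ k, Nonempty ((twist v (τ.comp π : Representation ℂ W E) (c k)).Equiv
      (twist v (τ.comp π : Representation ℂ W E) (c' (e k)))) := by
    intro k
    -- Matched eigenvalues have equal `m`-th powers, so their ratio is an `m`-th root of unity and
    -- does not change the twist of `τ`.
    have h1 : c k * (c' (e k))⁻¹ ∈ twistStabilizer v (τ.comp π : Representation ℂ W E) := by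
      rw [mem_twistStabilizer_iff hφ hπ hI hτ, mul_pow, inv_pow, he, mul_inv_cancel]
    obtain ⟨T⟩ := h1
    have := twistCongr (v := v) T (c' (e k))
    rw [twist_twist, inv_mul_cancel_right] at this
    exact ⟨this⟩
  obtain ⟨e1⟩ := nonempty_equiv_unrDiag hφ hΨ b c h
  obtain ⟨e2⟩ := nonempty_equiv_unrDiag hφ hΨ' b' c' h'
  let σ : Representation ℂ W E := τ.comp π
  obtain ⟨f1⟩ := nonempty_tprod_congr (Representation.Equiv.refl σ) e1
  obtain ⟨f2⟩ := nonempty_tprod_congr (Representation.Equiv.refl σ) e2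
  obtain ⟨g1⟩ := nonempty_tprod_unrDiag_equiv v σ c
  obtain ⟨g2⟩ := nonempty_tprod_unrDiag_equiv v σ c'
  exact ⟨f1.trans (g1.trans ((piRepCongr e fun k => (hT k).some).trans (g2.symm.trans f2.symm)))⟩

end Unramified

/-! ### Decomposition and orthogonality for a family of representations -/

section Family

variable {W G : Type*} [Group W] [Group G] [Finite G] {v : W →* Multiplicative ℤ} {π : W →* G}
  {φ : W} {V : Type*} [AddCommGroup V] [Module ℂ V] [FiniteDimensional ℂ V]
  {Λ : Type*} {E : Λ → Type*} [∀ i, AddCommGroup (E i)] [∀ i, Module ℂ (E i)]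
  [∀ i, FiniteDimensional ℂ (E i)] {I : Subgroup G}

/-- Every semisimple representation is a sum of products of the `τ i` with unramified
representations. -/
theorem exists_equiv_directSum_tprod (hφ : v φ = Multiplicative.ofAdd 1)
    (hπ : Function.Surjective π) {ρ : Representation ℂ W V} (hρ : ρ.IsSemisimpleRepresentation)
    (hN : ∀ u, v u = 1 → π u = 1 → ρ u = 1) (τ : ∀ i, Representation ℂ G (E i))
    (hall : ∀ (k : ℕ) (τ' : Representation ℂ G (Fin k → ℂ)), τ'.IsIrreducible →
      ∃ (i : Λ) (c : ℂˣ), Nonempty ((twist v ((τ i).comp π) c).Equiv (τ'.comp π))) :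
    ∃ (k : Λ → ℕ) (c : ∀ l, Fin (k l) → ℂˣ), Nonempty (ρ.Equiv (Representation.directSum fun l =>
      Representation.tprod ((τ l).comp π : Representation ℂ W (E l)) (unrDiag v (c l)))) := by
  obtain ⟨n, S, hS, ⟨e⟩⟩ := exists_equiv_piRep hρ
  have key : ∀ a, ∃ (i : Λ) (c : ℂˣ),
      Nonempty ((S a).toRepresentation.Equiv (twist v ((τ i).comp π) c)) := by
    intro a
    obtain ⟨c, τ', hτ'⟩ := exists_twist_eq_comp hφ hπ (hS a) fun u h1 h2 => by
      ext x
      exact LinearMap.congr_fun (hN u h1 h2) x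
    have hirr : τ'.IsIrreducible := by
      rw [← isIrreducible_comp hπ, ← hτ']
      exact isIrreducible_twist v (hS a) c
    -- The constituent is transported to coordinates, because `hall` speaks of representations on
    -- `Fin k → ℂ`.
    let f := (Module.finBasis ℂ (S a).toSubmodule).equivFun
    let τ'' : Representation ℂ G (Fin (Module.finrank ℂ (S a).toSubmodule) → ℂ) :=
      (f.conjAlgEquiv ℂ : _ →* _).comp τ'
    let e' : τ'.Equiv τ'' := repEquiv f fun g x => by
      change f (τ' g x) = f (τ' g (f.symm (f x)))
      rw [LinearEquiv.symm_apply_apply]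
    obtain ⟨i, c', ⟨e''⟩⟩ := hall _ τ'' (isIrreducible_of_equiv e' hirr)
    have e3 : Representation.Equiv (τ'.comp π : Representation ℂ W _)
        (τ''.comp π : Representation ℂ W _) := repEquiv f fun g x => equiv_apply_apply e' (π g) x
    have e4 := e''.trans e3.symm
    rw [← hτ'] at e4
    obtain ⟨e5⟩ := nonempty_twist_equiv_mul (c' := c⁻¹) ⟨e4⟩
      (by rw [twist_twist, mul_inv_cancel, twist_one]; exact ⟨Representation.Equiv.refl _⟩)
    exact ⟨i, _, ⟨e5.symm⟩⟩
  choose i c hc using key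
  obtain ⟨k, c', ⟨T⟩⟩ := exists_equiv_directSum
    (fun l => ((τ l).comp π : Representation ℂ W (E l))) i c
  exact ⟨k, c', ⟨e.trans ((piRepCongr (_root_.Equiv.refl _) fun a => (hc a).some).trans T.symm)⟩⟩

/-- Orthogonality over a coset of `I`: terms with `j ≠ i` vanish because `Hom_I` does, and the
exponent is chosen so that Frobenius is trivial on `End_I(τ i)`. -/
theorem sum_star_character_mul_sum [I.Normal] [Fintype I] [Fintype Λ]
    (hφ : v φ = Multiplicative.ofAdd 1)
    (hπ : Function.Surjective π) (hI : v.ker.map π = I) {τ : ∀ i, Representation ℂ G (E i)}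
    (hτ : ∀ i, (τ i).IsIrreducible) (hne : ∀ i j, i ≠ j → homOn I (τ i) (τ j) = ⊥)
    (a : Λ → ℂ) (i : Λ) (d : ℕ) :
    ∑ x : I, (starRingEnd ℂ) ((τ i).character
        (π φ ^ (d * Module.finrank ℂ (homOn I (τ i) (τ i))) * x)) *
      ∑ j, (τ j).character (π φ ^ (d * Module.finrank ℂ (homOn I (τ i) (τ i))) * x) * a j =
      Nat.card I * Module.finrank ℂ (homOn I (τ i) (τ i)) * a i := by
  simp_rw [Finset.mul_sum, ← mul_assoc]
  rw [Finset.sum_comm]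
  simp_rw [← Finset.sum_mul]
  rw [Finset.sum_eq_single i]
  · rw [sum_star_character_mul_character _ _ _ fun T hT => linHom_pow_apply hφ hπ hI (hτ i) d hT]
  · intro j _ hj
    rw [sum_star_character_mul_character, hne i j hj.symm]
    · simp
    · rw [hne i j hj.symm]
      intro T hT
      rw [(Submodule.mem_bot ℂ).1 hT, map_zero]
  · intro h
    exact absurd (Finset.mem_univ i) h

/-- Orthogonality over `I` itself, the case `d = 0`, makes the characters linearly independent in
the finite-dimensional space of functions on `G`. -/
theorem finite_of_homOn_eq_bot [I.Normal] (hφ : v φ = Multiplicative.ofAdd 1)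
    (hπ : Function.Surjective π) (hI : v.ker.map π = I) {τ : ∀ i, Representation ℂ G (E i)}
    (hτ : ∀ i, (τ i).IsIrreducible) (hne : ∀ i j, i ≠ j → homOn I (τ i) (τ j) = ⊥) : Finite Λ := by
  let _ := Fintype.ofFinite I
  have hli : LinearIndependent ℂ fun i => (τ i).character := by
    rw [linearIndependent_iff']
    intro s a h i hi
    have h1 : ∀ g, ∑ j ∈ s, (τ j).character g * a j = 0 := by
      intro g
      have := congrFun h g
      rw [Finset.sum_apply] at this
      simpa [mul_comm] using this
    have h2 := sum_star_character_mul_sum hφ hπ hI (τ := fun j : s => τ j) (fun j => hτ j)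
      (fun j l hjl => hne _ _ fun h => hjl (Subtype.ext h)) (fun j => a j) ⟨i, hi⟩ 0
    have h3 : ∀ g, ∑ j : s, (τ j).character g * a j = 0 := fun g =>
      (Finset.sum_coe_sort s fun j => (τ j).character g * a j).trans (h1 g)
    simp only [h3, mul_zero, Finset.sum_const_zero] at h2
    have hm := finrank_homOn_pos hφ hπ hI (hτ i)
    have hI0 : 0 < Nat.card I := Nat.card_pos
    have h4 : (Nat.card I * Module.finrank ℂ (homOn I (τ i) (τ i)) : ℂ) ≠ 0 := by
      exact_mod_cast (Nat.mul_pos hI0 hm).ne'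
    exact (mul_eq_zero.1 h2.symm).resolve_left h4
  exact hli.finite

end Family

end

noncomputable section

/-! ### Application to the Weil group -/

section WeilRepresentations

open Representation

variable {K : Type*} [Field K] [ValuativeRel K] [TopologicalSpace K]
  [IsNonarchimedeanLocalField K]

theorem IsUnramified.apply_eq_one {V : Type*} [AddCommGroup V] [Module ℂ V]
    {ρ : Representation ℂ (weilGroup K) V} (h : IsUnramified ρ) (w : weilGroup K)
    (hw : weilVal K w = 1) : ρ w = 1 :=
  h w (weilVal_eq_one_iff.1 hw)

variable {F : IntermediateField K (SeparableClosure K)} [FiniteDimensional K F] [IsGalois K F]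

theorem FactorsThroughMaxUnram.apply_eq_one {V : Type*} [AddCommGroup V] [Module ℂ V]
    {ρ : Representation ℂ (weilGroup K) V} (h : FactorsThroughMaxUnram F ρ) (w : weilGroup K)
    (hw : weilVal K w = 1) (hw' : weilRestrict F w = 1) : ρ w = 1 :=
  h w ((mem_fixingSubgroup_maxUnram_iff F).2 ⟨hw, hw'⟩)

theorem inertiaMult_eq {V : Type*} [AddCommGroup V] [Module ℂ V] (τ : Representation ℂ Gal(F/K) V) :
    inertiaMult τ = Module.finrank ℂ (homOn (inertia K F) τ τ) :=
  (invariantsEquivIntertwiningMap (τ.comp (inertia K F).subtype)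
    (τ.comp (inertia K F).subtype)).finrank_eq.symm

/-- An unramified twist by a character of `Gal(F/K)` is a twist by a power of the degree map. -/
theorem exists_twist_equiv_of_isUnramifiedTwist {V V' : Type*} [AddCommGroup V] [Module ℂ V]
    [AddCommGroup V'] [Module ℂ V'] {τ : Representation ℂ Gal(F/K) V}
    {τ' : Representation ℂ Gal(F/K) V'} {φ : weilGroup K}
    (hφ : weilVal K φ = Multiplicative.ofAdd 1) (h : IsUnramifiedTwist τ τ') :
    ∃ c : ℂˣ, Nonempty ((twist (weilVal K) (inflate τ') c).Equiv (inflate τ)) := by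
  obtain ⟨χ, hχ, ⟨e⟩⟩ := h
  have hu : ∀ u, weilVal K u = 1 → inflate χ u = 1 := fun u hu =>
    hχ _ (by rw [← map_weilRestrict_ker]; exact ⟨u, hu, rfl⟩)
  have h1 : ∀ x, inflate χ φ x = inflate χ φ 1 * x := by
    intro x
    rw [mul_comm, ← smul_eq_mul, ← map_smul, smul_eq_mul, mul_one]
  have hc0 : inflate χ φ 1 ≠ 0 := by
    intro h0
    have h2 : inflate χ φ 1 = inflate χ φ 0 := by rw [h0, map_zero]
    exact one_ne_zero ((apply_bijective (inflate χ) φ).1 h2)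
  have h2 := fun w x => twist_apply_eigenvector hφ hu (c := Units.mk0 _ hc0) (x := x) (h1 x) w
  refine ⟨Units.mk0 _ hc0, ⟨(repEquiv (e.toLinearEquiv.trans (TensorProduct.rid ℂ V'))
    fun w x => ?_ : (inflate τ).Equiv (twist (weilVal K) (inflate τ') _)).symm⟩⟩
  have h3 : e (inflate τ w x) = (inflate τ').tprod (inflate χ) w (e x) :=
    equiv_apply_apply e (weilRestrict F w) x
  refine (congrArg (TensorProduct.rid ℂ V') h3).trans ?_
  change _ = twist (weilVal K) (inflate τ') _ w (TensorProduct.rid ℂ V' (e x))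
  generalize e x = y
  induction y with
  | zero => simp
  | add x y hx hy => rw [map_add, map_add, hx, hy, map_add, map_add]
  | tmul x z =>
    rw [Representation.tprod_apply, TensorProduct.map_tmul, TensorProduct.rid_tmul,
      TensorProduct.rid_tmul, h2, twist_apply, map_smul, smul_eq_mul, mul_smul]

/-- On an element `w` of `ker π` both `τ` and `τ'` act trivially, so the isomorphism forces `c ^ v w
= 1`. The character `c ^ v` therefore descends to `Gal(F/K)`. -/
theorem isUnramifiedTwist_of_equiv_twist {V V' : Type*} [AddCommGroup V] [Module ℂ V]
    [AddCommGroup V'] [Module ℂ V'] [Nontrivial V'] {τ : Representation ℂ Gal(F/K) V}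
    {τ' : Representation ℂ Gal(F/K) V'} {c : ℂˣ}
    (e : (twist (weilVal K) (inflate τ') c).Equiv (inflate τ)) : IsUnramifiedTwist τ τ' := by
  have hker : (weilRestrict F).ker ≤
      MonoidHom.ker (twist (weilVal K) (Representation.trivial ℂ (weilGroup K) ℂ) c) := by
    intro w hw
    have hτ : ∀ x, inflate τ' w x = x := by
      intro x
      change τ' (weilRestrict F w) x = x
      rw [MonoidHom.mem_ker.1 hw, map_one, Module.End.one_apply]
    have hτ' : ∀ x, inflate τ w x = x := by
      intro x
      change τ (weilRestrict F w) x = x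
      rw [MonoidHom.mem_ker.1 hw, map_one, Module.End.one_apply]
    obtain ⟨x, hx⟩ := exists_ne (0 : V')
    have h1 := equiv_apply_apply e w x
    rw [hτ', twist_apply, hτ, EmbeddingLike.apply_eq_iff_eq] at h1
    have h2 : (((c ^ (weilVal K w).toAdd : ℂˣ) : ℂ) - 1) • x = 0 := by
      rw [sub_smul, h1, one_smul, sub_self]
    have h3 := sub_eq_zero.1 ((smul_eq_zero.1 h2).resolve_right hx)
    rw [MonoidHom.mem_ker]
    ext
    rw [twist_apply, h3]
    simp
  obtain ⟨χ, hχ⟩ := exists_comp_eq (weilRestrict_surjective F) hker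
  have hχ' : ∀ w z, χ (weilRestrict F w) z = ((c ^ (weilVal K w).toAdd : ℂˣ) : ℂ) * z :=
    fun w z => LinearMap.congr_fun (DFunLike.congr_fun hχ w) z
  refine ⟨χ, ?_, ⟨(repEquiv ((TensorProduct.rid ℂ V').trans e.toLinearEquiv) ?_ :
    (τ'.tprod χ).Equiv τ).symm⟩⟩
  · intro g hg
    rw [← map_weilRestrict_ker] at hg
    obtain ⟨u, hu, rfl⟩ := hg
    ext
    rw [hχ', MonoidHom.mem_ker.1 hu]
    simp
  · intro g y
    obtain ⟨w, rfl⟩ := weilRestrict_surjective F g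
    refine Eq.trans ?_ (equiv_apply_apply e w (TensorProduct.rid ℂ V' y))
    change e (TensorProduct.rid ℂ V' (τ'.tprod χ (weilRestrict F w) y)) = _
    congr 1
    induction y with
    | zero => simp
    | add x y hx hy => rw [map_add, map_add, hx, hy, map_add, map_add]
    | tmul x z =>
      rw [Representation.tprod_apply, TensorProduct.map_tmul, TensorProduct.rid_tmul,
        TensorProduct.rid_tmul, hχ', twist_apply, map_smul, mul_smul]
      rfl

/-- The average of Frobenius traces over the subextensions recovers the coefficient of `τ i`. -/
theorem frobAverage_eq {Λ : Type*} {E : Λ → Type*} [∀ i, AddCommGroup (E i)] [∀ i, Module ℂ (E i)]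
    [∀ i, FiniteDimensional ℂ (E i)] {τ : ∀ i, Representation ℂ Gal(F/K) (E i)}
    (hirr : ∀ i, (τ i).IsIrreducible)
    (hne : ∀ i j, i ≠ j → homOn (inertia K F) (τ i) (τ j) = ⊥) {V : Type*} [AddCommGroup V]
    [Module ℂ V] {ρ : Representation ℂ (weilGroup K) V} {U : Λ → Type*}
    [∀ i, AddCommGroup (U i)] [∀ i, Module ℂ (U i)] [∀ i, FiniteDimensional ℂ (U i)]
    {Ψ : ∀ i, Representation ℂ (weilGroup K) (U i)} (hΨ : ∀ i, IsUnramified (Ψ i))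
    (e : ρ.Equiv (Representation.directSum fun i => (inflate (τ i)).tprod (Ψ i)))
    {φ : weilGroup K} (hφ : weilVal K φ = Multiplicative.ofAdd 1)
    {frob : IntermediateField K (SeparableClosure K) → weilGroup K}
    (hfrob : ∀ L : IntermediateField K (SeparableClosure K), FiniteDimensional K L →
      IsFrob L (frob L)) (i : Λ) {d : ℕ} (hd : 0 < d) :
    (subextensions F (d * inertiaMult (τ i))).Finite ∧
      (Ψ i).character (φ ^ (d * inertiaMult (τ i))) =
        frobAverage frob (τ i) ρ (d * inertiaMult (τ i)) := by
  have hπ := weilRestrict_surjective F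
  have hI := map_weilRestrict_ker F
  have hΛ := finite_of_homOn_eq_bot hφ hπ hI hirr hne
  let _ := Fintype.ofFinite Λ
  let _ := Fintype.ofFinite (inertia K F)
  have hm := finrank_homOn_pos hφ hπ hI (hirr i)
  rw [frobAverage, inertiaMult_eq]
  set n := d * Module.finrank ℂ (homOn (inertia K F) (τ i) (τ i)) with hn
  have hn0 : 0 < n := Nat.mul_pos hd hm
  have hbij := bijOn_subextensions F hn0 hφ frob hfrob
  refine ⟨hbij.finite_iff_finite.2 (Set.toFinite _), ?_⟩
  have hchar : ∀ L ∈ subextensions F n, ∀ {X : Type _} [AddCommGroup X] [Module ℂ X]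
      (σ : Representation ℂ Gal(F/K) X), (inflate σ).character (frob L) =
        σ.character (weilRestrict F φ ^ n * weilRestrict F ((φ ^ n)⁻¹ * frob L)) := by
    intro L _ X _ _ σ
    rw [← map_pow, ← map_mul, mul_inv_cancel_left]
    rfl
  -- The unramified factors see only the degree, so they contribute the same constants `tr Ψ j (φ ^
  -- n)` for every `L`.
  have hρ : ∀ L ∈ subextensions F n, ρ.character (frob L) =
      ∑ j, (τ j).character (weilRestrict F φ ^ n * weilRestrict F ((φ ^ n)⁻¹ * frob L)) *
        (Ψ j).character (φ ^ n) := by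
    intro L hL
    obtain ⟨hfd, -, hr⟩ := (mem_subextensions_iff F).1 hL
    rw [char_iso e, character_directSum]
    refine Finset.sum_congr rfl fun j _ => ?_
    have hv : weilVal K (frob L) = weilVal K (φ ^ n) := by
      rw [weilVal_of_isFrob (hfrob L hfd), hr, map_pow, hφ, ← ofAdd_nsmul, nsmul_one]
    rw [char_tensor, Pi.mul_apply, hchar L hL]
    exact congrArg _ (congrArg (LinearMap.trace ℂ (U j))
      (unramified_apply_eq (hΨ j).apply_eq_one hv))
  have hsum := sum_star_character_mul_sum hφ hπ hI hirr hne (fun j => (Ψ j).character (φ ^ n)) i d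
  rw [← hn] at hsum
  rw [finsum_mem_eq_of_bijOn _ hbij (g := fun x => (starRingEnd ℂ) ((τ i).character
      (weilRestrict F φ ^ n * x)) * ∑ j, (τ j).character (weilRestrict F φ ^ n * x) *
        (Ψ j).character (φ ^ n)) fun L hL => by rw [hρ L hL, hchar L hL],
    finsum_mem_eq_finite_toFinset_sum _ (Set.toFinite _)]
  have hconv : ∀ f : Gal(F/K) → ℂ, ∑ x ∈ (Set.toFinite (inertia K F : Set Gal(F/K))).toFinset, f x =
      ∑ x : inertia K F, f x := fun f =>
    (Finset.sum_subtype _ (fun x => by simp) f)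
  rw [hconv, hsum, ← mul_assoc]
  have h0 : (Nat.card (inertia K F) : ℂ) *
      (Module.finrank ℂ (homOn (inertia K F) (τ i) (τ i)) : ℂ) ≠ 0 := by
    have : 0 < Nat.card (inertia K F) := Nat.card_pos
    exact_mod_cast (Nat.mul_pos this hm).ne'
  rw [one_div, inv_mul_cancel₀ h0, one_mul]

end WeilRepresentations

end

end LocalGalois

/-! ### The main theorem -/

open LocalGalois
theorem theorem1
    {K : Type*} [Field K] [ValuativeRel K] [TopologicalSpace K] [IsNonarchimedeanLocalField K]
    -- a finite Galois extension `F / K` inside `K^s`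
    (F : IntermediateField K (SeparableClosure K)) [FiniteDimensional K F] [IsGalois K F]
    -- a semisimple Weil representation that factors through `Gal(F^nr/K)`
    {V : Type*} [AddCommGroup V] [Module ℂ V] [FiniteDimensional ℂ V]
    (ρ : Representation ℂ (weilGroup K) V) (hss : ρ.IsSemisimpleRepresentation)
    (hρ : FactorsThroughMaxUnram F ρ)
    -- irreducible representations of `Gal(F/K)`, exactly one in each class of unramified twists
    {Λ : Type*} {E : Λ → Type*} [∀ i, AddCommGroup (E i)] [∀ i, Module ℂ (E i)]
    [∀ i, FiniteDimensional ℂ (E i)]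
    (τ : ∀ i, Representation ℂ Gal(F/K) (E i)) (hirr : ∀ i, (τ i).IsIrreducible)
    (hne : ∀ i j, i ≠ j → ¬ IsUnramifiedTwist (τ i) (τ j))
    (hall : ∀ (k : ℕ) (τ' : Representation ℂ Gal(F/K) (Fin k → ℂ)), τ'.IsIrreducible →
      ∃ i, IsUnramifiedTwist τ' (τ i)) :
    -- (i)
    (∃ (k : Λ → ℕ) (Ψ : ∀ i, Representation ℂ (weilGroup K) (Fin (k i) → ℂ)),
      (∀ i, IsUnramified (Ψ i)) ∧
      Nonempty (ρ.Equiv (Representation.directSum fun i => (inflate (τ i)).tprod (Ψ i)))) ∧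
    -- the other parts hold for every decomposition as in (i)
    ∀ (U : Λ → Type*) [∀ i, AddCommGroup (U i)] [∀ i, Module ℂ (U i)]
      [∀ i, FiniteDimensional ℂ (U i)] (Ψ : ∀ i, Representation ℂ (weilGroup K) (U i)),
      (∀ i, IsUnramified (Ψ i)) →
      Nonempty (ρ.Equiv (Representation.directSum fun i => (inflate (τ i)).tprod (Ψ i))) →
    -- for every choice of Frobenius elements
    ∀ (φ : weilGroup K), IsFrob ⊥ φ →
    ∀ (frob : IntermediateField K (SeparableClosure K) → weilGroup K),
      (∀ L : IntermediateField K (SeparableClosure K), FiniteDimensional K L →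
        IsFrob L (frob L)) →
    ∀ i : Λ,
    -- (ii)
    (∀ d : ℕ, 0 < d →
      (subextensions F (d * inertiaMult (τ i))).Finite ∧
      (Ψ i).character (φ ^ (d * inertiaMult (τ i))) =
        frobAverage frob (τ i) ρ (d * inertiaMult (τ i))) ∧
    -- (iii)
    (∀ (U' : Type*) [AddCommGroup U'] [Module ℂ U'] [FiniteDimensional ℂ U']
      (Ψ' : Representation ℂ (weilGroup K) U'), IsUnramified Ψ' →
      ((inflate (τ i)).tprod Ψ').IsSemisimpleRepresentation →
      (∀ d : ℕ, 0 < d → Ψ'.character (φ ^ (d * inertiaMult (τ i))) =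
        frobAverage frob (τ i) ρ (d * inertiaMult (τ i))) →
      Nonempty (((inflate (τ i)).tprod Ψ').Equiv ((inflate (τ i)).tprod (Ψ i)))) ∧
    -- (iv)
    (∀ N : ℕ, Module.finrank ℂ (U i) ≤ N →
      (∃! s : Multiset ℂˣ, s.card ≤ N ∧ ∀ d : ℕ, 1 ≤ d → d ≤ N →
        (s.map fun z : ℂˣ => (z : ℂ) ^ d).sum =
          (Ψ i).character (φ ^ (d * inertiaMult (τ i)))) ∧
      ∀ s : Multiset ℂˣ, s.card ≤ N →
        (∀ d : ℕ, 1 ≤ d → d ≤ N → (s.map fun z : ℂˣ => (z : ℂ) ^ d).sum =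
          (Ψ i).character (φ ^ (d * inertiaMult (τ i)))) →
        -- the eigenvalues are roots of the elements of `s` for some choice of the roots
        (∃ t : Multiset ℂˣ, t.map (fun z : ℂˣ => z ^ inertiaMult (τ i)) = s ∧
          HasEigenvalues (Ψ i φ) t) ∧
        -- and every choice `t` of the roots leads to the same twist
        ∀ t : Multiset ℂˣ, t.map (fun z : ℂˣ => z ^ inertiaMult (τ i)) = s →
          (∃ (k : ℕ) (Ψ' : Representation ℂ (weilGroup K) (Fin k → ℂ)), IsUnramified Ψ' ∧
            Ψ'.IsSemisimpleRepresentation ∧ HasEigenvalues (Ψ' φ) t) ∧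
          ∀ (U' : Type*) [AddCommGroup U'] [Module ℂ U'] [FiniteDimensional ℂ U']
            (Ψ' : Representation ℂ (weilGroup K) U'), IsUnramified Ψ' →
            Ψ'.IsSemisimpleRepresentation → HasEigenvalues (Ψ' φ) t →
            Nonempty (((inflate (τ i)).tprod Ψ').Equiv ((inflate (τ i)).tprod (Ψ i)))) := by
  obtain ⟨φ₀, hφ₀⟩ := exists_weilVal_eq_one K
  have hπ := weilRestrict_surjective F
  have hI := map_weilRestrict_ker F
  have hhom : ∀ i j, i ≠ j → homOn (inertia K F) (τ i) (τ j) = ⊥ := by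
    intro i j hij
    refine homOn_eq_bot hφ₀ hπ hI (hirr i) (hirr j) fun c => ⟨fun e => ?_⟩
    have := ((isIrreducible_iff (τ i)).1 (hirr i)).1
    exact hne j i hij.symm (isUnramifiedTwist_of_equiv_twist e)
  refine ⟨?_, ?_⟩
  · obtain ⟨k, c, e⟩ := exists_equiv_directSum_tprod hφ₀ hπ hss hρ.apply_eq_one τ
      fun k τ' h => by
        obtain ⟨i, hi⟩ := hall k τ' h
        exact ⟨i, exists_twist_equiv_of_isUnramifiedTwist hφ₀ hi⟩
    exact ⟨k, fun l => unrDiag (weilVal K) (c l),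
      fun l w hw => unrDiag_eq_one _ _ (weilVal_eq_one_iff.2 hw), e⟩
  intro U _ _ _ Ψ hΨ ⟨e⟩ φ hφF frob hfrob i
  have hφ := weilVal_of_isFrob_bot hφF
  have hii := fun d hd => frobAverage_eq hirr hhom hΨ e hφ hfrob i (d := d) hd
  have : Nontrivial (E i) := ((isIrreducible_iff (τ i)).1 (hirr i)).1
  -- `Ψ i` is not assumed semisimple. Its Frobenius is diagonalizable because `τ i ⊗ Ψ i` embeds in
  -- the semisimple `ρ`, where `φ ^ |G|` acts centrally.
  obtain ⟨n, b, c, hb⟩ : ∃ (n : ℕ) (b : Module.Basis (Fin n) ℂ (U i)) (c : Fin n → ℂˣ),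
      ∀ k, Ψ i φ (b k) = (c k : ℂ) • b k := by
    classical
    have hd := isDiag_apply_pow_card hss hρ.apply_eq_one φ
    have hof : Function.Injective (DirectSum.lof ℂ Λ (fun i => TensorProduct ℂ (E i) (U i)) i) :=
      DirectSum.of_injective i
    have hj : Function.Injective (e.symm.toLinearEquiv.toLinearMap ∘ₗ
        DirectSum.lof ℂ Λ (fun i => TensorProduct ℂ (E i) (U i)) i) :=
      fun x y h => hof (e.symm.toLinearEquiv.injective h)
    refine exists_basis_of_isDiag_tprod (π := weilRestrict F) (τ := τ i) (hd.of_injective _ hj fun x => ?_)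
    refine Eq.trans ?_ (equiv_apply_apply e.symm (φ ^ Nat.card Gal(F/K)) _)
    have hl : DirectSum.lof ℂ Λ (fun i => TensorProduct ℂ (E i) (U i)) i
        (((inflate (F := F) (τ i)).tprod (Ψ i)) (φ ^ Nat.card Gal(F/K)) x) =
        Representation.directSum (fun i => (inflate (F := F) (τ i)).tprod (Ψ i))
          (φ ^ Nat.card Gal(F/K)) (DirectSum.lof ℂ Λ (fun i => TensorProduct ℂ (E i) (U i)) i x) :=
      (DirectSum.lmap_lof
        (fun i => ((inflate (F := F) (τ i)).tprod (Ψ i)) (φ ^ Nat.card Gal(F/K))) i x).symm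
    exact congrArg e.symm hl
  have hm := inertiaMult_eq (τ i)
  set m := inertiaMult (τ i) with hmdef
  have hψ : ∀ d, (Ψ i).character (φ ^ (d * m)) =
      ((Finset.univ.val.map fun k => c k ^ m).map fun z : ℂˣ => (z : ℂ) ^ d).sum := by
    intro d
    rw [character_pow_of_basis b c hb, Multiset.map_map]
    refine Finset.sum_congr rfl fun k _ => ?_
    rw [Function.comp_apply, Units.val_pow_eq_pow_val, ← pow_mul, mul_comm]
  have hcard : (Finset.univ.val.map fun k => c k ^ m).card = Module.finrank ℂ (U i) := by
    rw [Multiset.card_map, Finset.card_val, Finset.card_univ, Module.finrank_eq_card_basis b]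
  refine ⟨hii, ?_, ?_⟩
  · intro U' _ _ _ Ψ' hΨ' hss' htr
    have hN : ∀ u, weilVal K u = 1 → weilRestrict F u = 1 →
        (inflate (τ i)).tprod Ψ' u = 1 := by
      intro u h1 h2
      have h3 : inflate (τ i) u = 1 := by
        change τ i (weilRestrict F u) = 1
        rw [h2, map_one]
      rw [Representation.tprod_apply, h3, hΨ'.apply_eq_one u h1]
      exact TensorProduct.map_one
    obtain ⟨n', b', c', hb'⟩ := exists_basis_of_isDiag_tprod (isDiag_apply_pow_card hss' hN φ)
    refine nonempty_tprod_equiv_of_map_pow_eq hφ hπ hI (hirr i) hΨ'.apply_eq_one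
      (hΨ i).apply_eq_one b' c' hb' b c hb ?_
    rw [← hm]
    -- The dimension of `Ψ'` is not known in advance, but all power sums are available, so any bound
    -- covering both dimensions will do.
    refine multiset_eq_of_psum_eq (N := max n' n) (by simp) (by simp) fun d hd _ => ?_
    rw [← hψ, (hii d hd).2, ← htr d hd, character_pow_of_basis b' c' hb', Multiset.map_map]
    refine Finset.sum_congr rfl fun k _ => ?_
    rw [Function.comp_apply, Units.val_pow_eq_pow_val, ← pow_mul, mul_comm]
  · intro N hN
    rw [← hcard] at hN
    have huniq : ∀ s : Multiset ℂˣ, s.card ≤ N →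
        (∀ d : ℕ, 1 ≤ d → d ≤ N → (s.map fun z : ℂˣ => (z : ℂ) ^ d).sum =
          (Ψ i).character (φ ^ (d * m))) → s = Finset.univ.val.map fun k => c k ^ m :=
      fun s hs h => multiset_eq_of_psum_eq hs hN fun d h1 h2 => by rw [h d h1 h2, hψ]
    refine ⟨⟨_, ⟨hN, fun d _ _ => (hψ d).symm⟩, fun s hs => huniq s hs.1 hs.2⟩, ?_⟩
    intro s hs hsum
    -- From here on `s` is the multiset of the powers `c k ^ m`, and the `c k` themselves are the
    -- required choice of roots.
    obtain rfl := huniq s hs hsum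
    refine ⟨⟨Finset.univ.val.map c, by rw [Multiset.map_map]; rfl, ?_⟩, ?_⟩
    · rw [HasEigenvalues, roots_charpoly_of_basis b _ hb, Multiset.map_map]
      rfl
    · intro t ht
      refine ⟨?_, ?_⟩
      · obtain ⟨l, rfl⟩ := Quotient.exists_rep t
        refine ⟨l.length, unrDiag (weilVal K) l.get,
          fun w hw => unrDiag_eq_one _ _ (weilVal_eq_one_iff.2 hw),
          isSemisimpleRepresentation_unrDiag _, ?_⟩
        refine (roots_charpoly_of_basis _ _ (unrDiag_basisFun hφ l.get)).trans ?_
        simp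
      · intro U' _ _ _ Ψ' hΨ' hss' hroots
        obtain ⟨n', b', c', hb'⟩ :=
          exists_basis_of_isSemisimpleRepresentation (φ := φ) hΨ'.apply_eq_one hss'
        refine nonempty_tprod_equiv_of_map_pow_eq hφ hπ hI (hirr i) hΨ'.apply_eq_one
          (hΨ i).apply_eq_one b' c' hb' b c hb ?_
        rw [← hm, ← ht]
        rw [HasEigenvalues, roots_charpoly_of_basis b' _ hb'] at hroots
        have : Finset.univ.val.map c' = t := by
          refine Multiset.map_injective Units.val_injective ?_
          rw [Multiset.map_map]
          exact hroots
        rw [← this, Multiset.map_map]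
        rfl
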